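/- Let $a_0,a_1,a_2,\dots$ be i.i.d. real standard Gaussian random variables, and let $f(t)=\sum_{k\ge 0}a_kt^k$, a series that converges almost surely for each $t\in(-1,1)$. For $s,t\in(-1,1)$ put $\sigma(s,t)=\frac1{1-st}$, $c(s,t)=\frac{\sigma(s,t)}{\sqrt{\sigma(s,s)\sigma(t,t)}}=\frac{\sqrt{(1-s^2)(1-t^2)}}{1-st}$ and $$\mathbb K(s,t)=\begin{pmatrix}\dfrac{s-t}{\sqrt{(1-s^2)(1-t^2)}\,(1-st)^2}&\sqrt{\dfrac{1-t^2}{1-s^2}}\,\dfrac1{1-st}\\[2mm]-\sqrt{\dfrac{1-s^2}{1-t^2}}\,\dfrac1{1-st}&\operatorname{sgn}(t-s)\arcsin c(s,t)\end{pmatrix},$$ where $\operatorname{sgn}(x)=|x|/x$ for $x\ne0$ and $\operatorname{sgn}(0)=0$. For distinct $t_1,\dots,t_n\in(-1,1)$ let $\Sigma(\boldsymbol t)=(\sigma(t_i,t_j))_{i,j=1}^n$, which is the covariance matrix of $(f(t_1),\dots,f(t_n))$, and let $(\mathbb K(t_i,t_j))_{i,j=1}^n$ be the $2n\times2n$ skew-symmetric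 matrix whose $(i,j)$ block is the $2\times2$ matrix $\mathbb K(t_i,t_j)$. Then $f(t_1)\cdots f(t_n)$ is integrable and $$E\big[|f(t_1)f(t_2)\cdots f(t_n)|\big]=\Big(\frac2\pi\Big)^{n/2}\big(\det\Sigma(\boldsymbol t)\big)^{-1/2}\operatorname{pf}\big(\mathbb K(t_i,t_j)\big)_{i,j=1}^n .$$ Here the Pfaffian of a $2n\times 2n$ skew-symmetric matrix $B=(b_{ij})$ is $\operatorname{pf}(B)=\sum_\eta\epsilon(\eta)\,b_{\eta(1)\eta(2)}b_{\eta(3)\eta(4)}\cdots b_{\eta(2n-1)\eta(2n)}$, the sum being over all permutations $\eta$ of $\{1,\dots,2n\}$ with $\eta(2i-1)<\eta(2i)$ for $1\le i\le n$ and $\eta(1)<\eta(3)<\cdots<\eta(2n-1)$, and $\epsilon(\eta)$ is the signature of $\eta$. -/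

import Mathlib

open MeasureTheory ProbabilityTheory

/-- The Pfaffian `∑ η, ε(η) b_{η(1)η(2)} b_{η(3)η(4)} ⋯ b_{η(2n-1)η(2n)}` of a skew-symmetric matrix
of size `2n`, the sum being over all permutations `η` with `η(2i-1) < η(2i)` for all `i` and
`η(1) < η(3) < ⋯ < η(2n-1)`. With indices counted from `0`, the places `2i-1` and `2i`
(`1 ≤ i ≤ n`) are the indices `2i` and `2i+1` (`0 ≤ i < n`), which are the values of
`finProdFinEquiv` at `(i, 0)` and `(i, 1)`. -/
def pfaffian {R : Type*} [CommRing R] {n : ℕ} (B : Matrix (Fin (n * 2)) (Fin (n * 2)) R) : R :=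
  ∑ η : Equiv.Perm (Fin (n * 2)) with
      (∀ i : Fin n, η (finProdFinEquiv (i, 0)) < η (finProdFinEquiv (i, 1))) ∧
      (∀ i j : Fin n, i < j → η (finProdFinEquiv (i, 0)) < η (finProdFinEquiv (j, 0))),
    ((Equiv.Perm.sign η : ℤ) : R) *
      ∏ i : Fin n, B (η (finProdFinEquiv (i, 0))) (η (finProdFinEquiv (i, 1)))

namespace GaussianPowerSeries

/-- The value at a real point `t` of the random power series `f(z) = ∑ a_k z^k`. -/
noncomputable def f {Ω : Type*} (a : ℕ → Ω → ℝ) (t : ℝ) (ω : Ω) : ℝ :=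
  ∑' k : ℕ, a k ω * t ^ k

/-- The covariance kernel `σ(s,t) = 1 / (1 - s t)`. -/
noncomputable def sigma (s t : ℝ) : ℝ := 1 / (1 - s * t)

/-- The correlation coefficient `c(s,t) = σ(s,t) / √(σ(s,s) σ(t,t))`. -/
noncomputable def c (s t : ℝ) : ℝ := sigma s t / √(sigma s s * sigma t t)

/-- The `2 × 2` matrix kernel `𝕂(s,t)`. -/
noncomputable def K (s t : ℝ) : Matrix (Fin 2) (Fin 2) ℝ :=
  !![(s - t) / (√((1 - s ^ 2) * (1 - t ^ 2)) * (1 - s * t) ^ 2),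
      √((1 - t ^ 2) / (1 - s ^ 2)) * (1 / (1 - s * t));
     -(√((1 - s ^ 2) / (1 - t ^ 2)) * (1 / (1 - s * t))),
      Real.sign (t - s) * Real.arcsin (c s t)]

/-- The `2n × 2n` matrix `(𝕂(t_i,t_j))` made of `n²` blocks of size `2 × 2`: row `2i + p` and
column `2j + q` carry `𝕂(t_i,t_j)_{pq}`, for `i, j < n` and `p, q < 2`. -/
noncomputable def blockK {n : ℕ} (t : Fin n → ℝ) : Matrix (Fin (n * 2)) (Fin (n * 2)) ℝ :=
  Matrix.reindex finProdFinEquiv finProdFinEquiv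
    (Matrix.of fun x y : Fin n × Fin 2 => K (t x.1) (t y.1) x.2 y.2)

/-- The matrix `Σ(t) = (σ(t_i,t_j))`. -/
noncomputable def Sigma {n : ℕ} (t : Fin n → ℝ) : Matrix (Fin n) (Fin n) ℝ :=
  Matrix.of fun i j => sigma (t i) (t j)

end GaussianPowerSeries

/-! The process `X = f` is Gaussian with the Szegő kernel `σ` as covariance, and the proof rests on
a conformal property of that kernel: conditioned on `X x = 0`, the values `X (u k)` have the law of
`mob x (u k) * X (u k)`, with `mob x` the Möbius map vanishing at `x`. Since `σ` is a Cauchy kernel,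
the regression of `X x` on the values `X (u k)` is given by Lagrange interpolation, and its residual
has standard deviation `√σ(x,x)` times the modulus of a Blaschke product. The conditional density of
`X x` at `0` is then a Gaussian tilt of the law of the `X (u k)`, computed in `map_withDensity_eq`.

The tilt governs derivatives of signs. Formally, `d/dx sgn X(x)` is `2 δ(X x) X'(x)`. If `Φ` is
multiplied by a constant `c` under `y k ↦ mob x (u k) * y k`, as products of values and signs are,
then `hasDerivAt_integral_mul_sign` shows that differentiating `E[Φ sgn X(x)]` replaces the sign by
the value `X x`, up to the factor `√(2/π) √σ(x,x) c`.

Two uses of this give the formula. For pure sign moments at increasing points, the derivative in the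
leftmost point is expanded by Gaussian integration by parts (`integral_prod_sign_mul`). This matches
the first-row expansion of the Pfaffian of `sgn(t-s) arcsin c(s,t)`, and both sides tend to `0` as
that point tends to `-1`, hence `signMoment_eq`. Next, the first row of `K` is the `s`-derivative of
the second, so differentiating at `n` of `2n` points turns signs into values on one side and sign
rows into value rows of the matrix on the other. The constants multiply up to the square root of the
Cauchy determinant `det Σ` (`sqrtDet_mul_mixedMoment`).

Finally the `2n` points are taken to be `s i` and `s i + ε`. As `ε → 0+`, `X(s i) sgn X(s i + ε)`
tends to `|X(s i)|` and the matrix tends to `blockK s`. -/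

namespace GaussianPowerSeries

/-- The Blaschke product with zeros at the points `u i`. -/
noncomputable def blaschke {ι : Type*} [Fintype ι] (u : ι → ℝ) (x : ℝ) : ℝ :=
  ∏ i, (x - u i) / (1 - x * u i)

/-- The factor of the regression coefficient `regCoeff u x k` that does not depend on `x`. -/
noncomputable def regWeight {ι : Type*} [Fintype ι] [DecidableEq ι] (u : ι → ℝ) (k : ι) : ℝ :=
  Lagrange.nodalWeight Finset.univ u k * ∏ i, (1 - u i * u k)

/-- The coefficients of the linear regression of `f x` on the values `f (u k)`. -/
noncomputable def regCoeff {ι : Type*} [Fintype ι] [DecidableEq ι] (u : ι → ℝ) (x : ℝ) (k : ι) :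
    ℝ :=
  regWeight u k * blaschke u x / (x - u k)

theorem one_sub_mul_pos {s t : ℝ} (hs : s ∈ Set.Ioo (-1 : ℝ) 1) (ht : t ∈ Set.Ioo (-1 : ℝ) 1) :
    0 < 1 - s * t := by
  obtain ⟨h1, h2⟩ := hs
  obtain ⟨h3, h4⟩ := ht
  nlinarith

theorem one_sub_sq_pos {s : ℝ} (hs : s ∈ Set.Ioo (-1 : ℝ) 1) : 0 < 1 - s ^ 2 := by
  have := one_sub_mul_pos hs hs
  nlinarith

theorem sigma_comm (s t : ℝ) : sigma s t = sigma t s := by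
  simp [sigma, mul_comm]

/-! ### Regression for the Szegő kernel: Lagrange interpolation and Blaschke products. -/

section Regression

variable {ι : Type*} [Fintype ι] [DecidableEq ι] {u : ι → ℝ} {x : ℝ}

omit [Fintype ι] in
open Polynomial in
-- The right side vanishes at `z = 1/x`, so `1 - x z` divides it. The induction produces the
-- quotient without division, from `(1 - a x)(1 - a z) - (x - a)(z - a) = (1 - a²)(1 - x z)`. At the
-- nodes the last product vanishes, and at `z = x` the Blaschke product appears.
theorem exists_polynomial_blaschke (s : Finset ι) (u : ι → ℝ) (x : ℝ) :
    ∃ R : ℝ[X], R.degree < (s.card : WithBot ℕ) ∧ ∀ z : ℝ, (1 - x * z) * R.eval z =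
      (∏ i ∈ s, (1 - x * u i)) * (∏ i ∈ s, (1 - z * u i)) -
        (∏ i ∈ s, (x - u i)) * ∏ i ∈ s, (z - u i) := by
  induction s using Finset.induction_on with
  | empty => exact ⟨0, by simp, by simp⟩
  | insert a s ha ih =>
    obtain ⟨R, hR, h⟩ := ih
    refine ⟨(C (1 - u a * x) * (1 - C (u a) * X)) * R +
      C ((1 - u a ^ 2) * ∏ i ∈ s, (x - u i)) * ∏ i ∈ s, (X - C (u i)), ?_, ?_⟩
    · rw [Finset.card_insert_of_notMem ha]
      have h1 : (1 - C (u a) * X : ℝ[X]).degree ≤ 1 := by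
        refine (degree_sub_le _ _).trans (max_le ?_ ?_)
        · simp
        · exact degree_C_mul_X_le _
      refine lt_of_le_of_lt (degree_add_le _ _) (max_lt ?_ ?_)
      · by_cases hR0 : R = 0
        · simp [hR0]
        · rw [degree_mul, degree_mul]
          rw [degree_eq_natDegree hR0] at hR ⊢
          have h2 : (C (1 - u a * x) : ℝ[X]).degree ≤ 0 := degree_C_le
          have hR' : R.natDegree + 1 ≤ s.card := by exact_mod_cast hR
          calc (C (1 - u a * x) : ℝ[X]).degree + (1 - C (u a) * X : ℝ[X]).degree + R.natDegree
              ≤ 0 + 1 + (R.natDegree : WithBot ℕ) := by gcongr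
            _ = ((R.natDegree + 1 : ℕ) : WithBot ℕ) := by push_cast; ring
            _ < ((s.card + 1 : ℕ) : WithBot ℕ) := by exact_mod_cast by omega
      · rw [← smul_eq_C_mul]
        refine lt_of_le_of_lt (degree_smul_le _ _) ?_
        rw [degree_prod]
        simp only [degree_X_sub_C, Finset.sum_const, nsmul_eq_mul, mul_one]
        exact_mod_cast Nat.lt_succ_self _
    · intro z
      rw [Finset.prod_insert ha, Finset.prod_insert ha, Finset.prod_insert ha,
        Finset.prod_insert ha]
      simp only [eval_add, eval_mul, eval_sub, eval_C, eval_X, eval_one, eval_prod]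
      linear_combination (1 - u a * x) * (1 - u a * z) * h z

variable (hu : ∀ i, u i ∈ Set.Ioo (-1 : ℝ) 1) (hinj : Function.Injective u)
  (hx : x ∈ Set.Ioo (-1 : ℝ) 1) (hxu : ∀ i, x ≠ u i)

omit [DecidableEq ι] in
include hu hx hxu in
theorem blaschke_ne_zero : blaschke u x ≠ 0 :=
  Finset.prod_ne_zero_iff.2 fun i _ =>
    div_ne_zero (sub_ne_zero.2 (hxu i)) (one_sub_mul_pos hx (hu i)).ne'

include hu hx in
-- With `Q(z) = ∏ (1 - z u i)`, these are the coefficients that recover `p/Q` at `x` from its values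
-- at the nodes when `deg p` is less than the number of nodes. The kernels `σ(·, u j)` have this
-- form.
theorem regCoeff_eq (k : ι) (hk : x ≠ u k) : regCoeff u x k =
    (Lagrange.basis Finset.univ u k).eval x * (∏ i, (1 - u k * u i)) / ∏ i, (1 - x * u i) := by
  rw [Lagrange.eval_basis_not_at_node (Finset.mem_univ k) hk, Lagrange.eval_nodal, regCoeff,
    regWeight, blaschke, Finset.prod_div_distrib]
  have : ∏ i, (1 - x * u i) ≠ 0 :=
    Finset.prod_ne_zero_iff.2 fun i _ => (one_sub_mul_pos hx (hu i)).ne'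
  have h2 : x - u k ≠ 0 := sub_ne_zero.2 hk
  simp_rw [mul_comm (u _) (u k)]
  field_simp

include hinj in
open Polynomial in
theorem eval_eq_sum_basis {p : ℝ[X]} (hp : p.degree < (Fintype.card ι : WithBot ℕ)) (x : ℝ) :
    p.eval x = ∑ k, (Lagrange.basis Finset.univ u k).eval x * p.eval (u k) := by
  conv_lhs => rw [Lagrange.eq_interpolate (s := Finset.univ) (v := u) hinj.injOn hp]
  simp [Lagrange.interpolate_apply, eval_finsetSum, mul_comm]

include hu hinj hx hxu in
open Polynomial in
-- These are the normal equations: `Q σ(·, u j)` is a polynomial of degree below the number of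
-- nodes, so its interpolation is exact.
theorem sum_regCoeff_mul_sigma (j : ι) :
    ∑ k, regCoeff u x k * sigma (u k) (u j) = sigma x (u j) := by
  have hp : (∏ i ∈ Finset.univ.erase j, (1 - C (u i) * X) : ℝ[X]).degree <
      (Fintype.card ι : WithBot ℕ) := by
    refine lt_of_le_of_lt (b := ((Fintype.card ι - 1 : ℕ) : WithBot ℕ)) ?_ ?_
    · refine (degree_prod_le _ _).trans ?_
      refine (Finset.sum_le_card_nsmul _ _ 1 fun i _ => ?_).trans ?_
      · refine (degree_sub_le _ _).trans (max_le ?_ ?_)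
        · simp
        · exact degree_C_mul_X_le _
      · simp [Finset.card_erase_of_mem]
    · have : 0 < Fintype.card ι := Fintype.card_pos_iff.2 ⟨j⟩
      exact_mod_cast by omega
  have h := eval_eq_sum_basis hinj hp x
  simp only [eval_prod, eval_sub, eval_one, eval_mul, eval_C, eval_X] at h
  have hQ : ∏ i, (1 - x * u i) ≠ 0 :=
    Finset.prod_ne_zero_iff.2 fun i _ => (one_sub_mul_pos hx (hu i)).ne'
  have key : ∀ y : ℝ, y ∈ Set.Ioo (-1 : ℝ) 1 → ∏ i ∈ Finset.univ.erase j, (1 - u i * y) =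
      (∏ i, (1 - y * u i)) * sigma y (u j) := by
    intro y hy
    rw [← Finset.mul_prod_erase _ _ (Finset.mem_univ j), sigma]
    have := (one_sub_mul_pos hy (hu j)).ne'
    simp_rw [mul_comm (u _) y]
    field_simp
  rw [key x hx] at h
  simp_rw [key _ (hu _)] at h
  simp_rw [regCoeff_eq hu hx _ (hxu _)]
  rw [← mul_right_inj' hQ, h, Finset.mul_sum]
  refine Finset.sum_congr rfl fun k _ => ?_
  field_simp

include hu hinj hx hxu in
-- Here interpolation is not exact. The polynomial from `exists_polynomial_blaschke` agrees with
-- `Q(x) Q σ(·, x)` at the nodes, and its defect at `x` is the Blaschke term. Hence the residual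
-- variance is `σ(x,x) B(x)²`.
theorem sum_regCoeff_mul_sigma_self :
    ∑ k, regCoeff u x k * sigma (u k) x = sigma x x * (1 - blaschke u x ^ 2) := by
  obtain ⟨R, hR, h⟩ := exists_polynomial_blaschke Finset.univ u x
  have hQ : ∏ i, (1 - x * u i) ≠ 0 :=
    Finset.prod_ne_zero_iff.2 fun i _ => (one_sub_mul_pos hx (hu i)).ne'
  have hxx := (one_sub_mul_pos hx hx).ne'
  have hk : ∀ k, R.eval (u k) = (∏ i, (1 - x * u i)) * (∏ i, (1 - u k * u i)) * sigma (u k) x := by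
    intro k
    have h1 := h (u k)
    rw [Finset.prod_eq_zero (f := fun i => u k - u i) (Finset.mem_univ k) (sub_self _), mul_zero,
      sub_zero] at h1
    rw [← h1, sigma, mul_comm (u k) x]
    have := (one_sub_mul_pos hx (hu k)).ne'
    field_simp
  have h2 := h x
  rw [eval_eq_sum_basis hinj hR x] at h2
  simp_rw [hk] at h2
  simp_rw [regCoeff_eq hu hx _ (hxu _)]
  rw [blaschke, Finset.prod_div_distrib, sigma]
  have h3 : ∑ k, (Lagrange.basis Finset.univ u k).eval x * (∏ i, (1 - u k * u i)) /
      (∏ i, (1 - x * u i)) * sigma (u k) x = (∑ k, (Lagrange.basis Finset.univ u k).eval x *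
        ((∏ i, (1 - x * u i)) * (∏ i, (1 - u k * u i)) * sigma (u k) x)) /
          (∏ i, (1 - x * u i)) ^ 2 := by
    rw [Finset.sum_div]
    refine Finset.sum_congr rfl fun k _ => ?_
    field_simp
  rw [h3, eq_div_of_mul_eq hxx ((mul_comm _ _).trans h2)]
  field_simp

end Regression

theorem sigma_self_pos {x : ℝ} (hx : x ∈ Set.Ioo (-1 : ℝ) 1) : 0 < sigma x x :=
  one_div_pos.2 (one_sub_mul_pos hx hx)

/-- Subtracting the regression from row `0` clears that row except for its first entry, which
becomes the residual variance. -/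
theorem det_Sigma_cons {n : ℕ} {u : Fin n → ℝ} {x : ℝ} (hu : ∀ i, u i ∈ Set.Ioo (-1 : ℝ) 1)
    (hinj : Function.Injective u) (hx : x ∈ Set.Ioo (-1 : ℝ) 1) (hxu : ∀ i, x ≠ u i) :
    (Sigma (Fin.cons x u : Fin (n + 1) → ℝ)).det =
      sigma x x * blaschke u x ^ 2 * (Sigma u).det := by
  have h := Matrix.det_updateRow_sum (Sigma (Fin.cons x u : Fin (n + 1) → ℝ)) 0
    (Fin.cons 1 fun k => -regCoeff u x k : Fin (n + 1) → ℝ)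
  rw [Fin.cons_zero, one_smul] at h
  rw [← h, Matrix.det_succ_row_zero, Fin.sum_univ_succ, add_eq_left.2]
  · have hs : ((Sigma (Fin.cons x u : Fin (n + 1) → ℝ)).updateRow 0
        (∑ k, (Fin.cons 1 fun k => -regCoeff u x k : Fin (n + 1) → ℝ) k •
          Sigma (Fin.cons x u : Fin (n + 1) → ℝ) k)).submatrix Fin.succ (Fin.succAbove 0) =
        Sigma u := by
      ext i j
      simp [Sigma, Matrix.updateRow_apply]
    rw [hs]
    have h2 := sum_regCoeff_mul_sigma_self hu hinj hx hxu
    simp [Fin.sum_univ_succ, Sigma, Finset.sum_apply, h2]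
    left
    ring
  · refine Finset.sum_eq_zero fun j _ => ?_
    have h1 := sum_regCoeff_mul_sigma hu hinj hx hxu j
    simp [Fin.sum_univ_succ, Sigma, Finset.sum_apply, h1]

theorem det_Sigma_eq {n : ℕ} {u : Fin n → ℝ} (hu : ∀ i, u i ∈ Set.Ioo (-1 : ℝ) 1)
    (hinj : Function.Injective u) : (Sigma u).det =
      (∏ i, sigma (u i) (u i)) *
        ∏ i, ∏ j ∈ Finset.Ioi i, ((u i - u j) / (1 - u i * u j)) ^ 2 := by
  induction n with
  | zero => simp
  | succ n ih =>
    have h : u = Fin.cons (u 0) (Fin.tail u) := (Fin.cons_self_tail u).symm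
    have h0 : ∀ i, u 0 ≠ Fin.tail u i := fun i hi => (Fin.succ_ne_zero i).symm (hinj hi)
    have h1 : Function.Injective (Fin.tail u) := fun i j hij => Fin.succ_injective _ (hinj hij)
    conv_lhs => rw [h]
    rw [det_Sigma_cons (u := Fin.tail u) (fun i => hu i.succ) h1 (hu 0) h0,
      ih (u := Fin.tail u) (fun i => hu i.succ) h1,
      Fin.prod_univ_succ, Fin.prod_univ_succ (f := fun i => ∏ j ∈ Finset.Ioi i, _),
      Fin.prod_Ioi_zero]
    simp_rw [Fin.prod_Ioi_succ, blaschke, Finset.prod_pow, Fin.tail]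
    ring

/-- The square root of the determinant of `Sigma`, restricted to the rows and columns in `J`. -/
noncomputable def sqrtDet {n : ℕ} (J : Finset (Fin n)) (s : Fin n → ℝ) : ℝ :=
  (∏ i ∈ J, √(sigma (s i) (s i))) *
    ∏ i ∈ J, ∏ j ∈ J with i < j, |(s i - s j) / (1 - s i * s j)|

theorem sqrtDet_univ_pos {n : ℕ} {u : Fin n → ℝ} (hu : ∀ i, u i ∈ Set.Ioo (-1 : ℝ) 1)
    (hinj : Function.Injective u) : 0 < sqrtDet Finset.univ u := by
  refine mul_pos (Finset.prod_pos fun i _ => Real.sqrt_pos.2 (sigma_self_pos (hu i)))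
    (Finset.prod_pos fun i _ => Finset.prod_pos fun j hj => abs_pos.2 (div_ne_zero ?_ ?_))
  · exact sub_ne_zero.2 fun h => (Finset.mem_filter.1 hj).2.ne (hinj h)
  · exact (one_sub_mul_pos (hu i) (hu j)).ne'

theorem det_Sigma_rpow {n : ℕ} {u : Fin n → ℝ} (hu : ∀ i, u i ∈ Set.Ioo (-1 : ℝ) 1)
    (hinj : Function.Injective u) :
    (Sigma u).det ^ (-(1 / 2) : ℝ) = (sqrtDet Finset.univ u)⁻¹ := by
  have h : (Sigma u).det = sqrtDet Finset.univ u ^ 2 := by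
    rw [det_Sigma_eq hu hinj, sqrtDet, mul_pow, ← Finset.prod_pow, ← Finset.prod_pow]
    congr 1
    · exact Finset.prod_congr rfl fun i _ => (Real.sq_sqrt (sigma_self_pos (hu i)).le).symm
    · refine Finset.prod_congr rfl fun i _ => ?_
      rw [← Finset.prod_pow]
      refine Finset.prod_congr (by ext; simp) fun j _ => (sq_abs _).symm
  have h0 := sqrtDet_univ_pos hu hinj
  rw [h, Real.rpow_neg (sq_nonneg _), ← Real.sqrt_eq_rpow, Real.sqrt_sq h0.le]

/-- The gained factor is, apart from `√(2/π)`, the one that appears when a sign at `s i` is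
differentiated into a value. -/
theorem sqrtDet_insert_of_lt {n : ℕ} {J : Finset (Fin n)} {i : Fin n} (s : Fin n → ℝ)
    (hi : ∀ j ∈ J, i < j) : sqrtDet (insert i J) s = sqrtDet J s *
      (√(sigma (s i) (s i)) * ∏ j ∈ J, |(s i - s j) / (1 - s i * s j)|) := by
  have hiJ : i ∉ J := fun h => lt_irrefl _ (hi i h)
  rw [sqrtDet, sqrtDet, Finset.prod_insert hiJ, Finset.prod_insert hiJ]
  have h1 : {j ∈ insert i J | i < j} = J := by
    ext j
    simp only [Finset.mem_filter, Finset.mem_insert]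
    constructor
    · rintro ⟨rfl | h, h'⟩
      · exact absurd h' (lt_irrefl _)
      · exact h
    · exact fun h => ⟨Or.inr h, hi j h⟩
  have h2 : ∀ k ∈ J, {j ∈ insert i J | k < j} = {j ∈ J | k < j} := by
    intro k hk
    rw [Finset.filter_insert, if_neg (hi k hk).not_gt]
  rw [h1, Finset.prod_congr (s₁ := J) (f := fun k => ∏ j ∈ insert i J with k < j, _) rfl
    fun k hk => by rw [h2 k hk]]
  ring

end GaussianPowerSeries

/-! ### The Pfaffian as a recursive first-row expansion. -/

section Pfaffian

variable {R : Type*} [CommRing R]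

/-- The Pfaffian of a matrix of arbitrary size `N`, defined by expansion along the first row. -/
def pfRec : (N : ℕ) → Matrix (Fin N) (Fin N) R → R
  | 0, _ => 1
  | 1, _ => 0
  | N + 2, A => ∑ j : Fin (N + 1), (-1) ^ (j : ℕ) * A 0 j.succ *
      pfRec N (A.submatrix (fun k => (j.succAbove k).succ) fun k => (j.succAbove k).succ)

/-- The position of an element of `Fin n × Fin 2` in `Fin N`, where `N = n * 2`. -/
def pairPos {n N : ℕ} (h : n * 2 = N) (i : Fin n) (p : Fin 2) : Fin N :=
  Fin.cast h (finProdFinEquiv (i, p))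

/-- The permutations over which the sum in the Pfaffian extends. -/
def IsPfaffianPerm {n N : ℕ} (h : n * 2 = N) (η : Equiv.Perm (Fin N)) : Prop :=
  (∀ i : Fin n, η (pairPos h i 0) < η (pairPos h i 1)) ∧
    ∀ i j : Fin n, i < j → η (pairPos h i 0) < η (pairPos h j 0)

instance {n N : ℕ} (h : n * 2 = N) : DecidablePred (IsPfaffianPerm h) := fun η => by
  unfold IsPfaffianPerm
  infer_instance

theorem pairPos_zero_zero {n N : ℕ} (h : (n + 1) * 2 = N + 2) : pairPos h 0 0 = 0 := by
  ext; simp [pairPos, finProdFinEquiv]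

theorem pairPos_zero_one {n N : ℕ} (h : (n + 1) * 2 = N + 2) :
    pairPos h 0 1 = (0 : Fin (N + 1)).succ := by
  ext; simp [pairPos, finProdFinEquiv]

theorem pairPos_succ {n N : ℕ} (h : (n + 1) * 2 = N + 2) (h' : n * 2 = N) (i : Fin n)
    (p : Fin 2) : pairPos h i.succ p = (pairPos h' i p).succ.succ := by
  ext; simp [pairPos, finProdFinEquiv]; ring

theorem exists_pairPos_eq {n N : ℕ} (h : n * 2 = N) (x : Fin N) :
    ∃ i p, x = pairPos h i p := by
  subst h
  obtain ⟨⟨i, p⟩, rfl⟩ := finProdFinEquiv.surjective x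
  exact ⟨i, p, rfl⟩

/-- The permutation sending `0, 1, k + 2` to `0, j + 1`, and the `η k`-th element of the rest. -/
def consPairPerm {N : ℕ} (j : Fin (N + 1)) (η : Equiv.Perm (Fin N)) :
    Equiv.Perm (Fin (N + 2)) :=
  Equiv.Perm.decomposeFin.symm (0, j.cycleRange⁻¹ * Equiv.Perm.decomposeFin.symm (0, η))

theorem consPairPerm_zero {N : ℕ} (j : Fin (N + 1)) (η : Equiv.Perm (Fin N)) :
    consPairPerm j η 0 = 0 := by
  simp [consPairPerm]

theorem consPairPerm_one {N : ℕ} (j : Fin (N + 1)) (η : Equiv.Perm (Fin N)) :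
    consPairPerm j η (Fin.succ 0) = j.succ := by
  rw [consPairPerm, Equiv.Perm.decomposeFin_symm_apply_succ]
  simp [Equiv.Perm.inv_def, Fin.cycleRange_symm_zero]

theorem consPairPerm_succ {N : ℕ} (j : Fin (N + 1)) (η : Equiv.Perm (Fin N)) (k : Fin N) :
    consPairPerm j η k.succ.succ = (j.succAbove (η k)).succ := by
  rw [consPairPerm, Equiv.Perm.decomposeFin_symm_apply_succ, Equiv.Perm.mul_apply,
    Equiv.Perm.decomposeFin_symm_apply_succ]
  simp [Equiv.Perm.inv_def, Fin.cycleRange_symm_succ]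

theorem sign_consPairPerm {N : ℕ} (j : Fin (N + 1)) (η : Equiv.Perm (Fin N)) :
    Equiv.Perm.sign (consPairPerm j η) = (-1) ^ (j : ℕ) * Equiv.Perm.sign η := by
  simp [consPairPerm, Equiv.Perm.decomposeFin.symm_sign, Fin.sign_cycleRange]

theorem exists_consPairPerm_eq {N : ℕ} (η : Equiv.Perm (Fin (N + 2))) (h : η 0 = 0) :
    ∃ j η', consPairPerm j η' = η := by
  obtain ⟨⟨p, e⟩, rfl⟩ := Equiv.Perm.decomposeFin.symm.surjective η
  rw [Equiv.Perm.decomposeFin_symm_apply_zero] at h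
  subst h
  obtain ⟨⟨p, e'⟩, he⟩ := Equiv.Perm.decomposeFin.symm.surjective ((e 0).cycleRange * e)
  have h0 : p = 0 := by
    have := Equiv.Perm.decomposeFin_symm_apply_zero p e'
    rw [he] at this
    simpa using this.symm
  subst h0
  exact ⟨e 0, e', by rw [consPairPerm, he, inv_mul_cancel_left]⟩

theorem consPairPerm_injective {N : ℕ} {j j' : Fin (N + 1)} {η η' : Equiv.Perm (Fin N)}
    (h : consPairPerm j η = consPairPerm j' η') : j = j' ∧ η = η' := by
  have hj : j = j' := by
    have := congrArg (fun e => e (Fin.succ 0)) h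
    simpa only [consPairPerm_one, Fin.succ_inj] using this
  subst hj
  refine ⟨rfl, Equiv.ext fun k => ?_⟩
  have := congrArg (fun e => e k.succ.succ) h
  simpa [consPairPerm_succ] using this

theorem isPfaffianPerm_consPairPerm {n N : ℕ} (h : (n + 1) * 2 = N + 2) (h' : n * 2 = N)
    (j : Fin (N + 1)) (η : Equiv.Perm (Fin N)) :
    IsPfaffianPerm h (consPairPerm j η) ↔ IsPfaffianPerm h' η := by
  have hlt : ∀ a b : Fin N, (j.succAbove a).succ < (j.succAbove b).succ ↔ a < b := by
    intro a b
    rw [Fin.succ_lt_succ_iff, Fin.succAbove_lt_succAbove_iff]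
  rw [IsPfaffianPerm, IsPfaffianPerm, Fin.forall_fin_succ (n := n)]
  refine and_congr ?_ ?_
  · simp only [pairPos_succ h h', pairPos_zero_zero, pairPos_zero_one, consPairPerm_succ,
      consPairPerm_one, consPairPerm_zero, hlt, Fin.succ_pos, true_and]
  · constructor
    · intro H a b hab
      simpa only [pairPos_succ h h', consPairPerm_succ, hlt] using
        H a.succ b.succ (Fin.succ_lt_succ_iff.2 hab)
    · intro H a b hab
      obtain ⟨b, rfl⟩ := Fin.exists_succ_eq.2 (Fin.ne_zero_of_lt hab)
      rw [pairPos_succ h h' b, consPairPerm_succ]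
      cases a using Fin.cases with
      | zero => rw [pairPos_zero_zero, consPairPerm_zero]; exact Fin.succ_pos _
      | succ a =>
        rw [pairPos_succ h h' a, consPairPerm_succ, hlt]
        exact H a b (Fin.succ_lt_succ_iff.1 hab)

/-- An admissible permutation fixes `0`. The partner `j + 1` of `0` is arbitrary, and what remains
is an admissible permutation of the other indices. -/
theorem pfaffianSum_succ {n N : ℕ} (h : (n + 1) * 2 = N + 2) (h' : n * 2 = N)
    (B : Matrix (Fin (N + 2)) (Fin (N + 2)) R) :
    (∑ η : Equiv.Perm (Fin (N + 2)) with IsPfaffianPerm h η, ((Equiv.Perm.sign η : ℤ) : R) *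
      ∏ i, B (η (pairPos h i 0)) (η (pairPos h i 1))) =
    ∑ j : Fin (N + 1), (-1) ^ (j : ℕ) * B 0 j.succ *
      ∑ η : Equiv.Perm (Fin N) with IsPfaffianPerm h' η, ((Equiv.Perm.sign η : ℤ) : R) *
        ∏ i, B (j.succAbove (η (pairPos h' i 0))).succ (j.succAbove (η (pairPos h' i 1))).succ := by
  simp_rw [Finset.mul_sum]
  rw [← Finset.sum_product', eq_comm]
  refine Finset.sum_bij (fun x _ => consPairPerm x.1 x.2) ?_ ?_ ?_ ?_
  · intro x hx
    simpa [isPfaffianPerm_consPairPerm h h'] using hx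
  · intro x _ y _ hxy
    exact Prod.ext (consPairPerm_injective hxy).1 (consPairPerm_injective hxy).2
  · intro η hη
    rw [Finset.mem_filter] at hη
    -- The smallest index must come first in its pair, and that pair must be the first one.
    have h0 : η 0 = 0 := by
      obtain ⟨x, hx⟩ := η.surjective 0
      obtain ⟨i, p, rfl⟩ := exists_pairPos_eq h x
      have hp : p = 0 := by
        by_contra hp
        have : p = 1 := by omega
        subst this
        have := hη.2.1 i
        rw [hx] at this
        exact absurd this (Fin.not_lt_zero _)
      subst hp
      have hi : i = 0 := by
        by_contra hi
        have := hη.2.2 0 i (Fin.pos_of_ne_zero hi)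
        rw [hx] at this
        exact absurd this (Fin.not_lt_zero _)
      subst hi
      rwa [pairPos_zero_zero] at hx
    obtain ⟨j, η', rfl⟩ := exists_consPairPerm_eq η h0
    exact ⟨(j, η'), by simpa [isPfaffianPerm_consPairPerm h h'] using hη, rfl⟩
  · intro x _
    rw [Fin.prod_univ_succ, sign_consPairPerm]
    simp only [pairPos_succ h h', pairPos_zero_zero, pairPos_zero_one, consPairPerm_succ,
      consPairPerm_one, consPairPerm_zero]
    push_cast
    ring

/-- The size is any `N` with `n * 2 = N`, so that it can be replaced by `N + 2`, where `pfRec`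
unfolds. -/
theorem pfaffianSum_eq_pfRec {n N : ℕ} (h : n * 2 = N) (B : Matrix (Fin N) (Fin N) R) :
    (∑ η : Equiv.Perm (Fin N) with IsPfaffianPerm h η, ((Equiv.Perm.sign η : ℤ) : R) *
      ∏ i, B (η (pairPos h i 0)) (η (pairPos h i 1))) = pfRec N B := by
  induction n generalizing N with
  | zero =>
    obtain rfl : N = 0 := by omega
    have : (Finset.univ.filter (IsPfaffianPerm h)) = Finset.univ := by
      refine Finset.filter_true_of_mem fun η _ => ⟨fun i => i.elim0, fun i => i.elim0⟩
    rw [this]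
    simp [pfRec]
  | succ n ih =>
    obtain ⟨N, rfl⟩ : ∃ M, N = M + 2 := ⟨n * 2, by omega⟩
    rw [pfaffianSum_succ h (by omega), pfRec]
    refine Finset.sum_congr rfl fun j _ => ?_
    rw [← ih (by omega)]
    rfl

theorem pfaffian_eq_pfRec {n : ℕ} (B : Matrix (Fin (n * 2)) (Fin (n * 2)) R) :
    pfaffian B = pfRec (n * 2) B := by
  rw [← pfaffianSum_eq_pfRec rfl, pfaffian]
  exact Finset.sum_congr (Finset.filter_congr fun η _ => Iff.rfl) fun η _ => rfl

end Pfaffian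

/-! ### Behaviour of the Pfaffian under simultaneous permutation of rows and columns. -/

section Invariance

/-- The permutation of `Fin n × Fin 2`, viewed as `Fin (n * 2)`, that permutes the pairs by `π`
and the members of the `i`-th pair by `e i`. -/
def pairPerm {n : ℕ} (e : Fin n → Equiv.Perm (Fin 2)) (π : Equiv.Perm (Fin n)) :
    Equiv.Perm (Fin (n * 2)) :=
  finProdFinEquiv.permCongr
    ((Equiv.prodCongrLeft fun _ : Fin 2 => π) * Equiv.prodCongrRight e)

theorem pairPerm_apply {n : ℕ} (e : Fin n → Equiv.Perm (Fin 2)) (π : Equiv.Perm (Fin n))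
    (i : Fin n) (p : Fin 2) :
    pairPerm e π (finProdFinEquiv (i, p)) = finProdFinEquiv (π i, e i p) := by
  simp [pairPerm, Equiv.permCongr_apply]

/-- Permuting whole pairs applies `π` once to the first members and once to the second, so its sign
is squared away. -/
theorem sign_pairPerm {n : ℕ} (e : Fin n → Equiv.Perm (Fin 2)) (π : Equiv.Perm (Fin n)) :
    Equiv.Perm.sign (pairPerm e π) = ∏ i, Equiv.Perm.sign (e i) := by
  rw [pairPerm, Equiv.Perm.sign_permCongr, Equiv.Perm.sign_mul, Equiv.Perm.sign_prodCongrRight,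
    Equiv.Perm.sign_prodCongrLeft]
  simp

/-- The term of the Pfaffian that belongs to the permutation `η`. -/
def pfaffianTerm {n : ℕ} (B : Matrix (Fin (n * 2)) (Fin (n * 2)) ℝ) (η : Equiv.Perm (Fin (n * 2))) :
    ℝ :=
  ((Equiv.Perm.sign η : ℤ) : ℝ) *
    ∏ i : Fin n, B (η (finProdFinEquiv (i, 0))) (η (finProdFinEquiv (i, 1)))

theorem perm_fin_two (e : Equiv.Perm (Fin 2)) : e = 1 ∨ e = Equiv.swap 0 1 := by
  revert e; decide

/-- Each swap inside a pair changes the sign of the permutation and, by skew symmetry, that of one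
entry. The two changes cancel. -/
theorem pfaffianTerm_mul_pairPerm {n : ℕ} {B : Matrix (Fin (n * 2)) (Fin (n * 2)) ℝ}
    (hB : ∀ x y, B x y = -B y x) (η : Equiv.Perm (Fin (n * 2)))
    (e : Fin n → Equiv.Perm (Fin 2)) (π : Equiv.Perm (Fin n)) :
    pfaffianTerm B (η * pairPerm e π) = pfaffianTerm B η := by
  have h : ∀ i, B (η (finProdFinEquiv (π i, e i 0))) (η (finProdFinEquiv (π i, e i 1))) =
      ((Equiv.Perm.sign (e i) : ℤ) : ℝ) *
        B (η (finProdFinEquiv (π i, 0))) (η (finProdFinEquiv (π i, 1))) := by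
    intro i
    rcases perm_fin_two (e i) with h | h
    · simp [h]
    · rw [h, Equiv.swap_apply_left, Equiv.swap_apply_right, hB, Equiv.Perm.sign_swap (by decide)]
      simp
  have h2 : (((∏ i, Equiv.Perm.sign (e i) : ℤˣ) : ℤ) : ℝ) * ∏ i, ((Equiv.Perm.sign (e i) : ℤ) : ℝ) =
      1 := by
    rw [Units.coe_prod, Int.cast_prod, ← Finset.prod_mul_distrib]
    refine Finset.prod_eq_one fun i _ => ?_
    rw [← Int.cast_mul, Int.units_coe_mul_self, Int.cast_one]
  simp only [pfaffianTerm, Equiv.Perm.sign_mul, sign_pairPerm, Equiv.Perm.mul_apply,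
    pairPerm_apply, h, Finset.prod_mul_distrib]
  rw [Equiv.prod_comp π fun i => B (η (finProdFinEquiv (i, 0))) (η (finProdFinEquiv (i, 1)))]
  push_cast at h2 ⊢
  linear_combination (((Equiv.Perm.sign η : ℤ) : ℝ) *
    ∏ i : Fin n, B (η (finProdFinEquiv (i, 0))) (η (finProdFinEquiv (i, 1)))) * h2

theorem isPfaffianPerm_iff {n : ℕ} (η : Equiv.Perm (Fin (n * 2))) : IsPfaffianPerm rfl η ↔
    (∀ i : Fin n, η (finProdFinEquiv (i, 0)) < η (finProdFinEquiv (i, 1))) ∧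
      ∀ i j : Fin n, i < j → η (finProdFinEquiv (i, 0)) < η (finProdFinEquiv (j, 0)) :=
  Iff.rfl

theorem exists_isPfaffianPerm_mul_pairPerm {n : ℕ} (η : Equiv.Perm (Fin (n * 2))) :
    ∃ τ e π, IsPfaffianPerm (n := n) rfl τ ∧ τ * pairPerm e π = η := by
  let e : Fin n → Equiv.Perm (Fin 2) := fun i =>
    if η (finProdFinEquiv (i, 0)) < η (finProdFinEquiv (i, 1)) then 1 else Equiv.swap 0 1
  have he : ∀ i, η (finProdFinEquiv (i, e i 0)) < η (finProdFinEquiv (i, e i 1)) := by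
    intro i
    by_cases h : η (finProdFinEquiv (i, 0)) < η (finProdFinEquiv (i, 1))
    · simp [e, h]
    · simp only [e, h, if_false, Equiv.swap_apply_left, Equiv.swap_apply_right]
      refine lt_of_le_of_ne (not_lt.1 h) fun h' => ?_
      have := finProdFinEquiv.injective (η.injective h')
      simp at this
  let m : Fin n → Fin (n * 2) := fun i => η (finProdFinEquiv (i, e i 0))
  have hm : Function.Injective m := fun i j hij => by
    have := finProdFinEquiv.injective (η.injective hij)
    exact (Prod.ext_iff.1 this).1
  let π := Tuple.sort m
  have hπ : StrictMono (m ∘ π) :=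
    (Tuple.monotone_sort m).strictMono_of_injective (hm.comp π.injective)
  have hτ : ∀ i p, (η * (pairPerm (fun i => (e i)⁻¹) π⁻¹)⁻¹) (finProdFinEquiv (i, p)) =
      η (finProdFinEquiv (π i, e (π i) p)) := by
    intro i p
    rw [Equiv.Perm.mul_apply]
    congr 1
    rw [Equiv.Perm.inv_eq_iff_eq, pairPerm_apply]
    simp
  refine ⟨η * (pairPerm (fun i => (e i)⁻¹) π⁻¹)⁻¹, fun i => (e i)⁻¹, π⁻¹, ?_,
    inv_mul_cancel_right _ _⟩
  rw [isPfaffianPerm_iff]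
  simp only [hτ]
  exact ⟨fun i => he _, fun i j hij => hπ hij⟩

theorem pairPerm_eq_of_isPfaffianPerm {n : ℕ} {τ τ' : Equiv.Perm (Fin (n * 2))}
    (hτ : IsPfaffianPerm (n := n) rfl τ) (hτ' : IsPfaffianPerm (n := n) rfl τ')
    {e e' : Fin n → Equiv.Perm (Fin 2)} {π π' : Equiv.Perm (Fin n)}
    (h : τ * pairPerm e π = τ' * pairPerm e' π') : τ = τ' ∧ e = e' ∧ π = π' := by
  rw [isPfaffianPerm_iff] at hτ hτ'
  have h1 : ∀ i p, τ (finProdFinEquiv (π i, e i p)) = τ' (finProdFinEquiv (π' i, e' i p)) := by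
    intro i p
    simpa [pairPerm_apply] using congrArg (fun η => η (finProdFinEquiv (i, p))) h
  have he : e = e' := by
    funext i
    have ha := hτ.1 (π i)
    have hb := hτ'.1 (π' i)
    have h0 := h1 i 0
    have h2 := h1 i 1
    rcases perm_fin_two (e i) with h3 | h3 <;> rcases perm_fin_two (e' i) with h4 | h4 <;>
      simp only [h3, h4, Equiv.Perm.one_apply, Equiv.swap_apply_left,
        Equiv.swap_apply_right] at h0 h2 ⊢
    · rw [h0, h2] at ha
      exact absurd ha hb.not_gt
    · rw [h0, h2] at ha
      exact absurd ha hb.not_gt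
  subst he
  have h2 : ∀ i p, τ (finProdFinEquiv (π i, p)) = τ' (finProdFinEquiv (π' i, p)) := by
    intro i p
    simpa using h1 i ((e i)⁻¹ p)
  -- Two strictly increasing enumerations with the same range coincide.
  have hf : (fun i => τ (finProdFinEquiv (i, 0))) = fun i => τ' (finProdFinEquiv (i, 0)) := by
    have a1 : StrictMono fun i => τ (finProdFinEquiv (i, 0)) := fun i j hij => hτ.2 i j hij
    have a2 : StrictMono fun i => τ' (finProdFinEquiv (i, 0)) := fun i j hij => hτ'.2 i j hij
    refine (StrictMono.range_inj a1 a2).1 ?_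
    rw [← π.surjective.range_comp, ← π'.surjective.range_comp fun i => τ' _]
    congr 1
    funext i
    exact h2 i 0
  have hπ : π = π' := by
    ext1 i
    have h3 := h2 i 0
    rw [← congrFun hf (π' i)] at h3
    simpa using h3
  subst hπ
  exact ⟨mul_right_cancel h, rfl, rfl⟩

/-- Every permutation factors uniquely as an admissible one times a `pairPerm`, which leaves the
term unchanged. The cardinality is `2^n n!`. -/
theorem sum_pfaffianTerm {n : ℕ} {B : Matrix (Fin (n * 2)) (Fin (n * 2)) ℝ}
    (hB : ∀ x y, B x y = -B y x) : ∑ η, pfaffianTerm B η =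
      Fintype.card ((Fin n → Equiv.Perm (Fin 2)) × Equiv.Perm (Fin n)) * pfaffian B := by
  have h : pfaffian B = ∑ τ with IsPfaffianPerm (n := n) rfl τ, pfaffianTerm B τ :=
    Finset.sum_congr (Finset.filter_congr fun η _ => Iff.rfl) fun η _ => rfl
  rw [h, Finset.mul_sum]
  have h1 : ∀ τ, (Fintype.card ((Fin n → Equiv.Perm (Fin 2)) × Equiv.Perm (Fin n)) : ℝ) *
      pfaffianTerm B τ = ∑ w : (Fin n → Equiv.Perm (Fin 2)) × Equiv.Perm (Fin n),
        pfaffianTerm B (τ * pairPerm w.1 w.2) := by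
    intro τ
    simp_rw [pfaffianTerm_mul_pairPerm hB]
    rw [Finset.sum_const, nsmul_eq_mul, Finset.card_univ]
  simp_rw [h1]
  rw [← Finset.sum_product', eq_comm]
  refine Finset.sum_bij (fun x _ => x.1 * pairPerm x.2.1 x.2.2) ?_ ?_ ?_ ?_
  · simp
  · intro x hx y hy hxy
    obtain ⟨h2, h3, h4⟩ := pairPerm_eq_of_isPfaffianPerm (by simpa using hx) (by simpa using hy) hxy
    exact Prod.ext h2 (Prod.ext h3 h4)
  · intro η _
    obtain ⟨τ, e, π, h2, rfl⟩ := exists_isPfaffianPerm_mul_pairPerm η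
    exact ⟨(τ, e, π), by simpa using h2, rfl⟩
  · exact fun _ _ => rfl

/-- The admissibility condition is not stable under composition with `ρ`, but in the sum over all
permutations `ρ` is absorbed by reindexing. -/
theorem pfaffian_submatrix {n : ℕ} {B : Matrix (Fin (n * 2)) (Fin (n * 2)) ℝ}
    (hB : ∀ x y, B x y = -B y x) (ρ : Equiv.Perm (Fin (n * 2))) :
    pfaffian (B.submatrix ρ ρ) = ((Equiv.Perm.sign ρ : ℤ) : ℝ) * pfaffian B := by
  have h1 := sum_pfaffianTerm hB
  have h2 := sum_pfaffianTerm (B := B.submatrix ρ ρ) fun x y => hB _ _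
  have h3 : ∑ η, pfaffianTerm (B.submatrix ρ ρ) η =
      ((Equiv.Perm.sign ρ : ℤ) : ℝ) * ∑ η, pfaffianTerm B η := by
    rw [← Equiv.sum_comp (Equiv.mulLeft ρ) (pfaffianTerm B), Finset.mul_sum]
    refine Finset.sum_congr rfl fun η _ => ?_
    simp only [pfaffianTerm, Equiv.coe_mulLeft, Equiv.Perm.sign_mul, Equiv.Perm.mul_apply,
      Matrix.submatrix_apply, Units.val_mul, Int.cast_mul, ← mul_assoc]
    rw [← Int.cast_mul, Int.units_coe_mul_self, Int.cast_one, one_mul]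
  have h4 : (Fintype.card ((Fin n → Equiv.Perm (Fin 2)) × Equiv.Perm (Fin n)) : ℝ) ≠ 0 :=
    Nat.cast_ne_zero.2 Fintype.card_ne_zero
  rw [h1, h2] at h3
  exact mul_left_cancel₀ h4 (by rw [h3]; ring)

end Invariance

/-! ### Differentiating a Pfaffian in one row and column. -/

section Calculus

/-- The index `x` occurs in exactly one factor of each term, so every term is linear in the row and
column `x`. The entry `(x, x)` never occurs. -/
theorem hasDerivAt_pfaffian {n : ℕ} {A : ℝ → Matrix (Fin (n * 2)) (Fin (n * 2)) ℝ}
    {A' : Matrix (Fin (n * 2)) (Fin (n * 2)) ℝ} {t : ℝ} (x : Fin (n * 2))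
    (hrow : ∀ y ≠ x, HasDerivAt (fun s => A s x y) (A' x y) t)
    (hcol : ∀ y ≠ x, HasDerivAt (fun s => A s y x) (A' y x) t)
    (hconst : ∀ y z, y ≠ x → z ≠ x → ∀ s, A s y z = A' y z) :
    HasDerivAt (fun s => pfaffian (A s)) (pfaffian A') t := by
  unfold pfaffian
  refine HasDerivAt.fun_sum fun η _ => HasDerivAt.const_mul _ ?_
  obtain ⟨⟨i, p⟩, hip⟩ := finProdFinEquiv.surjective (η⁻¹ x)
  have hx : η (finProdFinEquiv (i, p)) = x := by rw [hip]; simp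
  have hne : ∀ j q, (j, q) ≠ (i, p) → η (finProdFinEquiv (j, q)) ≠ x := by
    intro j q hjq h
    exact hjq (finProdFinEquiv.injective (η.injective (h.trans hx.symm)))
  have h1 : ∀ s, ∏ j, A s (η (finProdFinEquiv (j, 0))) (η (finProdFinEquiv (j, 1))) =
      A s (η (finProdFinEquiv (i, 0))) (η (finProdFinEquiv (i, 1))) *
        ∏ j ∈ Finset.univ.erase i, A' (η (finProdFinEquiv (j, 0))) (η (finProdFinEquiv (j, 1))) := by
    intro s
    rw [← Finset.mul_prod_erase _ _ (Finset.mem_univ i)]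
    congr 1
    refine Finset.prod_congr rfl fun j hj => hconst _ _ ?_ ?_ s <;>
    · refine hne _ _ fun h => Finset.ne_of_mem_erase hj (Prod.ext_iff.1 h).1
  simp_rw [h1]
  rw [← Finset.mul_prod_erase _ _ (Finset.mem_univ i)]
  refine HasDerivAt.mul_const ?_ _
  have hp : p = 0 ∨ p = 1 := by omega
  rcases hp with rfl | rfl
  · rw [hx]
    exact hrow _ (hne _ _ (by simp))
  · rw [hx]
    exact hcol _ (hne _ _ (by simp))

theorem continuous_pfaffian {n : ℕ} :
    Continuous (pfaffian : Matrix (Fin (n * 2)) (Fin (n * 2)) ℝ → ℝ) := by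
  unfold pfaffian
  refine continuous_finsetSum _ fun η _ => continuous_const.mul (continuous_finsetProd _ fun i _ => ?_)
  exact continuous_id.matrix_elem _ _

end Calculus

/-! ### Gaussian processes with Szegő covariance: regression and conditioning on a zero. -/

namespace GaussianPowerSeries

variable {Ω : Type*} [MeasurableSpace Ω]

/-- A centered Gaussian process on `(-1, 1)` with covariance kernel `sigma`. -/
structure IsSzegoProcess (X : ℝ → Ω → ℝ) (P : Measure Ω) : Prop where
  aemeasurable : ∀ t ∈ Set.Ioo (-1 : ℝ) 1, AEMeasurable (X t) P
  integral_cexp : ∀ {ι : Type} [Fintype ι] (u ξ : ι → ℝ), (∀ k, u k ∈ Set.Ioo (-1 : ℝ) 1) →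
    ∫ ω, Complex.exp (((∑ k, ξ k * X (u k) ω : ℝ) : ℂ) * Complex.I) ∂P =
      ((Real.exp (-(∑ k, ∑ l, ξ k * ξ l * sigma (u k) (u l)) / 2) : ℝ) : ℂ)

section QuadraticForm

variable {ι : Type} [Fintype ι] [DecidableEq ι] {u : ι → ℝ} {x : ℝ}

omit [DecidableEq ι] in
theorem sum_sum_sigma_add_mul (u ξ ζ : ι → ℝ) (z : ℝ) :
    ∑ k, ∑ l, (ξ k + z * ζ k) * (ξ l + z * ζ l) * sigma (u k) (u l) =
      (∑ k, ∑ l, ξ k * ξ l * sigma (u k) (u l)) +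
        2 * z * (∑ k, ξ k * ∑ l, ζ l * sigma (u l) (u k)) +
        z ^ 2 * ∑ k, ζ k * ∑ l, ζ l * sigma (u l) (u k) := by
  have h : ∑ k, ∑ l, ζ k * ξ l * sigma (u k) (u l) =
      ∑ k, ξ k * ∑ l, ζ l * sigma (u l) (u k) := by
    rw [Finset.sum_comm]
    refine Finset.sum_congr rfl fun k _ => ?_
    rw [Finset.mul_sum]
    exact Finset.sum_congr rfl fun l _ => by ring
  have h2 : ∑ k, ∑ l, ξ k * ζ l * sigma (u k) (u l) =
      ∑ k, ξ k * ∑ l, ζ l * sigma (u l) (u k) := by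
    refine Finset.sum_congr rfl fun k _ => ?_
    rw [Finset.mul_sum]
    exact Finset.sum_congr rfl fun l _ => by rw [sigma_comm]; ring
  have h3 : ∑ k, ∑ l, ζ k * ζ l * sigma (u k) (u l) =
      ∑ k, ζ k * ∑ l, ζ l * sigma (u l) (u k) := by
    refine Finset.sum_congr rfl fun k _ => ?_
    rw [Finset.mul_sum]
    exact Finset.sum_congr rfl fun l _ => by rw [sigma_comm]; ring
  have h4 : ∀ k l, (ξ k + z * ζ k) * (ξ l + z * ζ l) * sigma (u k) (u l) =
      ξ k * ξ l * sigma (u k) (u l) + z * (ζ k * ξ l * sigma (u k) (u l)) +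
        z * (ξ k * ζ l * sigma (u k) (u l)) + z ^ 2 * (ζ k * ζ l * sigma (u k) (u l)) := by
    intro k l; ring
  simp_rw [h4, Finset.sum_add_distrib, ← Finset.mul_sum, h, h2, h3]
  ring

/-- The coefficients of the regression of `f x` on the values `f (u k)`, divided by the signed
standard deviation of the residual. -/
noncomputable def regSlope (u : ι → ℝ) (x : ℝ) (k : ι) : ℝ :=
  regWeight u k * √(1 - x ^ 2) / (x - u k)

/-- The standard deviation of the residual of the regression of `f x` on the values `f (u k)`,
with the sign of the Blaschke product. -/
noncomputable def residual (u : ι → ℝ) (x : ℝ) : ℝ := blaschke u x * √(sigma x x)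

variable (hu : ∀ i, u i ∈ Set.Ioo (-1 : ℝ) 1) (hinj : Function.Injective u)
  (hx : x ∈ Set.Ioo (-1 : ℝ) 1) (hxu : ∀ i, x ≠ u i)

omit [DecidableEq ι] in
include hu hx hxu in
theorem residual_ne_zero : residual u x ≠ 0 :=
  mul_ne_zero (blaschke_ne_zero hu hx hxu) (Real.sqrt_pos.2 (sigma_self_pos hx)).ne'

theorem sqrt_sigma_mul_sqrt (hx : x ∈ Set.Ioo (-1 : ℝ) 1) : √(sigma x x) * √(1 - x ^ 2) = 1 := by
  have := one_sub_mul_pos hx hx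
  rw [← Real.sqrt_mul (sigma_self_pos hx).le, sigma, ← pow_two, one_div,
    inv_mul_cancel₀ (one_sub_sq_pos hx).ne', Real.sqrt_one]

include hx in
theorem regCoeff_eq_mul (k : ι) : regCoeff u x k = residual u x * regSlope u x k := by
  rw [regCoeff, residual, regSlope]
  linear_combination (-regWeight u k * blaschke u x / (x - u k)) * sqrt_sigma_mul_sqrt hx

include hu hinj hx hxu in
theorem sum_regCoeff_mul_sum : ∑ k, regCoeff u x k * ∑ l, regCoeff u x l * sigma (u l) (u k) =
    sigma x x - residual u x ^ 2 := by
  simp_rw [sum_regCoeff_mul_sigma hu hinj hx hxu, sigma_comm x]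
  rw [sum_regCoeff_mul_sigma_self hu hinj hx hxu, residual, mul_pow,
    Real.sq_sqrt (sigma_self_pos hx).le]
  ring

include hu hinj hx hxu in
theorem sum_regSlope_mul_sigma (k : ι) :
    ∑ l, regSlope u x l * sigma (u l) (u k) = sigma x (u k) / residual u x := by
  rw [eq_div_iff (residual_ne_zero hu hx hxu), ← sum_regCoeff_mul_sigma hu hinj hx hxu k,
    Finset.sum_mul]
  refine Finset.sum_congr rfl fun l _ => ?_
  rw [regCoeff_eq_mul hx]
  ring

include hu hinj hx hxu in
-- The left side is total variance over residual variance. It will be the `1 + q` of a Gaussian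
-- integral, which yields the normalising constant `|B(x)|`.
theorem one_add_sum_regSlope : 1 + ∑ k, regSlope u x k * ∑ l, regSlope u x l * sigma (u l) (u k) =
    (blaschke u x ^ 2)⁻¹ := by
  have h := sum_regCoeff_mul_sum hu hinj hx hxu
  have hr := residual_ne_zero hu hx hxu
  simp_rw [regCoeff_eq_mul hx, mul_assoc (residual u x), ← Finset.mul_sum] at h
  have h1 : ∑ k, regSlope u x k * (residual u x * ∑ l, regSlope u x l * sigma (u l) (u k)) =
      residual u x * ∑ k, regSlope u x k * ∑ l, regSlope u x l * sigma (u l) (u k) := by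
    rw [Finset.mul_sum]
    exact Finset.sum_congr rfl fun k _ => by ring
  rw [h1] at h
  have hB := blaschke_ne_zero hu hx hxu
  have h2 : residual u x ^ 2 = blaschke u x ^ 2 * sigma x x := by
    rw [residual, mul_pow, Real.sq_sqrt (sigma_self_pos hx).le]
  have hσ := (sigma_self_pos hx).ne'
  refine eq_inv_of_mul_eq_one_left (mul_left_cancel₀ hσ ?_)
  linear_combination h + (-1 - ∑ k, regSlope u x k * ∑ l, regSlope u x l * sigma (u l) (u k)) * h2

/-- The Möbius transformation of the unit disc with zero `t`. -/
noncomputable def mob (t s : ℝ) : ℝ := (s - t) / (1 - t * s)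

/-- The right side is the covariance of `X s` and `X t` given `X x = 0`, so conditioning on a zero
amounts to multiplication by Möbius factors. -/
theorem mob_mul_mob_mul_sigma {s t : ℝ} (hs : s ∈ Set.Ioo (-1 : ℝ) 1)
    (ht : t ∈ Set.Ioo (-1 : ℝ) 1) (hx : x ∈ Set.Ioo (-1 : ℝ) 1) :
    mob x s * mob x t * sigma s t = sigma s t - sigma x s * sigma x t / sigma x x := by
  have h1 := (one_sub_mul_pos hx hs).ne'
  have h2 := (one_sub_mul_pos hx ht).ne'
  have h3 := (one_sub_mul_pos hs ht).ne'
  have h4 := (one_sub_mul_pos hx hx).ne'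
  have h5 : 1 - s * x ≠ 0 := by rwa [mul_comm]
  simp only [mob, sigma]
  rw [mul_comm x s] at *
  field_simp
  ring

end QuadraticForm

theorem integral_gaussianReal_exp_quadratic (p q : ℝ) (hq : 0 < 1 + q) :
    ∫ z, Real.exp (-(2 * z * p + z ^ 2 * q) / 2) ∂gaussianReal 0 1 =
      (√(1 + q))⁻¹ * Real.exp (p ^ 2 / (1 + q) / 2) := by
  -- The factor `exp (-z² q / 2)` is absorbed by passing to variance `1/(1+q)`. What remains is a
  -- moment generating function at `-p`.
  set v : NNReal := ⟨(1 + q)⁻¹, (inv_pos.2 hq).le⟩ with hv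
  have hv' : (v : ℝ) = (1 + q)⁻¹ := rfl
  have hv0 : v ≠ 0 := by
    rw [← NNReal.coe_ne_zero, hv']
    exact (inv_pos.2 hq).ne'
  have h := congrFun (mgf_fun_id_gaussianReal (μ := 0) (v := v)) (-p)
  rw [mgf, integral_gaussianReal_eq_integral_smul hv0] at h
  rw [integral_gaussianReal_eq_integral_smul one_ne_zero]
  have h2 : ∀ z, gaussianPDFReal 0 1 z • Real.exp (-(2 * z * p + z ^ 2 * q) / 2) =
      (√(1 + q))⁻¹ * (gaussianPDFReal 0 v z • Real.exp (-p * z)) := by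
    intro z
    have hs : √(2 * Real.pi * v) = √(2 * Real.pi) * (√(1 + q))⁻¹ := by
      rw [Real.sqrt_mul (by positivity), hv', Real.sqrt_inv]
    simp only [gaussianPDFReal, smul_eq_mul, hs, NNReal.coe_one, mul_one, sub_zero]
    rw [hv']
    have h3 : √(1 + q) ≠ 0 := (Real.sqrt_pos.2 hq).ne'
    have h4 : √(2 * Real.pi) ≠ 0 := (Real.sqrt_pos.2 (by positivity)).ne'
    have h5 : -z ^ 2 / 2 + -(2 * z * p + z ^ 2 * q) / 2 = -z ^ 2 / (2 * (1 + q)⁻¹) + -p * z := by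
      field_simp
      ring
    have h6 : Real.exp (-z ^ 2 / 2) * Real.exp (-(2 * z * p + z ^ 2 * q) / 2) =
        Real.exp (-z ^ 2 / (2 * (1 + q)⁻¹)) * Real.exp (-p * z) := by
      rw [← Real.exp_add, ← Real.exp_add, h5]
    rw [mul_assoc, h6, mul_inv, inv_inv]
    field_simp
  simp_rw [h2]
  rw [integral_const_mul, h, hv']
  congr 2
  field_simp
  ring

theorem integral_gaussianReal_cexp (s : ℝ) :
    ∫ z, Complex.exp (((z * s : ℝ) : ℂ) * Complex.I) ∂gaussianReal 0 1 =
      ((Real.exp (-s ^ 2 / 2) : ℝ) : ℂ) := by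
  have h := charFun_gaussianReal (μ := 0) (v := 1) s
  rw [charFun_apply_real] at h
  rw [Complex.ofReal_exp]
  convert h using 3
  · push_cast; ring_nf
  · push_cast; ring

theorem norm_cexp_ofReal_mul_I (r : ℝ) : ‖Complex.exp ((r : ℂ) * Complex.I)‖ = 1 :=
  Complex.norm_exp_ofReal_mul_I r

theorem pi_dual_apply {ι : Type} [Fintype ι] [DecidableEq ι] (L : StrongDual ℝ (ι → ℝ))
    (y : ι → ℝ) : L y = ∑ k, L (Pi.single k 1) * y k := by
  have h := LinearMap.pi_apply_eq_sum_univ (L : (ι → ℝ) →ₗ[ℝ] ℝ) y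
  simp only [ContinuousLinearMap.coe_coe, smul_eq_mul] at h
  rw [h]
  refine Finset.sum_congr rfl fun k _ => ?_
  rw [mul_comm]
  congr 2
  funext j
  simp [Pi.single_apply, eq_comm]

namespace IsSzegoProcess

variable {X : ℝ → Ω → ℝ} {P : Measure Ω} [IsProbabilityMeasure P] (h : IsSzegoProcess X P)

include h in
omit [IsProbabilityMeasure P] in
theorem aemeasurable_pi {ι : Type} [Fintype ι] {u : ι → ℝ} (hu : ∀ i, u i ∈ Set.Ioo (-1 : ℝ) 1) :
    AEMeasurable (fun ω k => X (u k) ω) P :=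
  aemeasurable_pi_lambda _ fun k => h.aemeasurable _ (hu k)

include h in
theorem map_eq_gaussianReal {x : ℝ} (hx : x ∈ Set.Ioo (-1 : ℝ) 1) :
    P.map (X x) = gaussianReal 0 (sigma x x).toNNReal := by
  have : IsProbabilityMeasure (P.map (X x)) := Measure.isProbabilityMeasure_map (h.aemeasurable x hx)
  refine Measure.ext_of_charFun (funext fun ξ => ?_)
  rw [charFun_gaussianReal, charFun_apply_real, integral_map (h.aemeasurable x hx) (by fun_prop)]
  have := h.integral_cexp (ι := Unit) (fun _ => x) (fun _ => ξ) fun _ => hx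
  simp only [Finset.univ_unique, Finset.sum_singleton] at this
  rw [Real.coe_toNNReal _ (sigma_self_pos hx).le]
  push_cast at this
  rw [this]
  congr 1
  push_cast
  ring

section Regression

variable {ι : Type} [Fintype ι] [DecidableEq ι] {u : ι → ℝ} {x : ℝ}
  (hu : ∀ i, u i ∈ Set.Ioo (-1 : ℝ) 1) (hinj : Function.Injective u)
  (hx : x ∈ Set.Ioo (-1 : ℝ) 1) (hxu : ∀ i, x ≠ u i)

omit [IsProbabilityMeasure P] in
include h hu in
theorem aemeasurable_regression : AEMeasurable (fun p : Ω × ℝ => ((fun k => X (u k) p.1),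
      ∑ k, regCoeff u x k * X (u k) p.1 + residual u x * p.2)) (P.prod (gaussianReal 0 1)) := by
  have h1 : ∀ k, AEMeasurable (fun p : Ω × ℝ => X (u k) p.1) (P.prod (gaussianReal 0 1)) :=
    fun k => (h.aemeasurable _ (hu k)).comp_fst
  refine (aemeasurable_pi_lambda _ h1).prodMk (AEMeasurable.add ?_ (by fun_prop))
  exact Finset.aemeasurable_fun_sum _ fun k _ => (h1 k).const_mul _

include h hu hinj hx hxu in
-- Both sides are centred Gaussian, and the normal equations together with the residual variance
-- make their covariances agree. This realises `X x` as regression plus independent noise.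
theorem map_regression : P.map (fun ω => ((fun k => X (u k) ω), X x ω)) =
    (P.prod (gaussianReal 0 1)).map (fun p => ((fun k => X (u k) p.1),
      ∑ k, regCoeff u x k * X (u k) p.1 + residual u x * p.2)) := by
  have hm1 : AEMeasurable (fun ω => ((fun k => X (u k) ω), X x ω)) P :=
    (h.aemeasurable_pi hu).prodMk (h.aemeasurable x hx)
  have hm2 := h.aemeasurable_regression (u := u) (x := x) hu
  have : IsProbabilityMeasure (P.map (fun ω => ((fun k => X (u k) ω), X x ω))) :=
    Measure.isProbabilityMeasure_map hm1
  have := Measure.isProbabilityMeasure_map hm2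
  refine Measure.ext_of_charFunDual (funext fun L => ?_)
  rw [charFunDual_apply, charFunDual_apply, integral_map hm1 (by fun_prop),
    integral_map hm2 (by fun_prop)]
  set ξ : ι → ℝ := fun k => L (Pi.single k 1, 0)
  set η : ℝ := L (0, 1)
  have hL : ∀ y r, L (y, r) = ∑ k, ξ k * y k + η * r := by
    intro y r
    have h1 : L (y, r) = L (y, 0) + L (0, r) := by rw [← map_add]; simp
    have h2 := pi_dual_apply (L.comp (ContinuousLinearMap.inl ℝ (ι → ℝ) ℝ)) y
    have h3 : L (0, r) = η * r := by
      have : ((0 : ι → ℝ), r) = r • ((0 : ι → ℝ), (1 : ℝ)) := by simp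
      rw [this, map_smul, smul_eq_mul, mul_comm]
    rw [h1, h3]
    congr 1
  simp_rw [hL]
  -- The point `x` is adjoined to the family `u` as the index `none`.
  have e1 := h.integral_cexp (ι := Option ι) (fun o => o.elim x u) (fun o => o.elim η ξ)
    (by rintro (_ | k); exacts [hx, hu k])
  simp only [Fintype.sum_option, Option.elim_none, Option.elim_some] at e1
  have e2 : ∀ p : Ω × ℝ, (∑ k, ξ k * X (u k) p.1 +
      η * (∑ k, regCoeff u x k * X (u k) p.1 + residual u x * p.2) : ℝ) =
      (∑ k, (ξ k + η * regCoeff u x k) * X (u k) p.1) + p.2 * (η * residual u x) := by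
    intro p
    rw [mul_add, Finset.mul_sum, ← add_assoc, ← Finset.sum_add_distrib]
    congr 1
    · exact Finset.sum_congr rfl fun k _ => by ring
    · ring
  have e3 := h.integral_cexp u (fun k => ξ k + η * regCoeff u x k) hu
  simp_rw [e2]
  simp only [Complex.ofReal_add _ (_ * (η * residual u x)), add_mul (_ : ℂ) _ Complex.I,
    Complex.exp_add]
  rw [integral_prod_mul (fun ω => Complex.exp (((∑ k, (ξ k + η * regCoeff u x k) * X (u k) ω : ℝ) : ℂ)
    * Complex.I)) (fun z => Complex.exp (((z * (η * residual u x) : ℝ) : ℂ) * Complex.I)),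
    integral_gaussianReal_cexp, e3, ← Complex.ofReal_mul, ← Real.exp_add]
  have e6 : ∀ ω, ∑ k, ξ k * X (u k) ω + η * X x ω = η * X x ω + ∑ k, ξ k * X (u k) ω :=
    fun ω => add_comm _ _
  simp_rw [e6]
  rw [e1]
  congr 2
  rw [sum_sum_sigma_add_mul, sum_regCoeff_mul_sum hu hinj hx hxu]
  simp_rw [sum_regCoeff_mul_sigma hu hinj hx hxu]
  have e4 : ∑ k, (ξ k * η * sigma (u k) x + ∑ l, ξ k * ξ l * sigma (u k) (u l)) =
      η * (∑ k, ξ k * sigma x (u k)) + ∑ k, ∑ l, ξ k * ξ l * sigma (u k) (u l) := by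
    rw [Finset.sum_add_distrib, Finset.mul_sum]
    congr 1
    exact Finset.sum_congr rfl fun k _ => by rw [sigma_comm]; ring
  have e5 : ∑ k, η * ξ k * sigma x (u k) = η * ∑ k, ξ k * sigma x (u k) := by
    rw [Finset.mul_sum]
    exact Finset.sum_congr rfl fun k _ => by ring
  rw [e4, e5]
  ring

include h hu hinj hx hxu in
theorem integral_regression {g : (ι → ℝ) × ℝ → ℝ} (hg : Measurable g) :
    ∫ ω, g ((fun k => X (u k) ω), X x ω) ∂P = ∫ p : Ω × ℝ, g ((fun k => X (u k) p.1),
      ∑ k, regCoeff u x k * X (u k) p.1 + residual u x * p.2) ∂(P.prod (gaussianReal 0 1)) := by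
  have h1 := h.map_regression hu hinj hx hxu
  have hm1 : AEMeasurable (fun ω => ((fun k => X (u k) ω), X x ω)) P :=
    (h.aemeasurable_pi hu).prodMk (h.aemeasurable x hx)
  have hm2 := h.aemeasurable_regression (u := u) (x := x) hu
  rw [← integral_map hm1 hg.aestronglyMeasurable, h1, integral_map hm2 hg.aestronglyMeasurable]

include h hu hinj hx hxu in
theorem integrable_regression {g : (ι → ℝ) × ℝ → ℝ} (hg : Measurable g) :
    Integrable (fun ω => g ((fun k => X (u k) ω), X x ω)) P ↔
      Integrable (fun p : Ω × ℝ => g ((fun k => X (u k) p.1),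
        ∑ k, regCoeff u x k * X (u k) p.1 + residual u x * p.2)) (P.prod (gaussianReal 0 1)) := by
  have h1 := h.map_regression hu hinj hx hxu
  have hm1 : AEMeasurable (fun ω => ((fun k => X (u k) ω), X x ω)) P :=
    (h.aemeasurable_pi hu).prodMk (h.aemeasurable x hx)
  have hm2 := h.aemeasurable_regression (u := u) (x := x) hu
  have h2 := integrable_map_measure (g := g) hg.aestronglyMeasurable hm1
  rw [h1, integrable_map_measure hg.aestronglyMeasurable hm2] at h2
  exact h2.symm

include h hu hinj hx hxu in
-- Up to a constant, the density is the conditional density of `X x` at `0` given the `X (u k)`.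
-- Tilting therefore conditions on `X x = 0`, and the conditional law is that of the Möbius
-- multiples.
theorem map_withDensity_eq :
    (P.map (fun ω k => X (u k) ω)).withDensity
      (fun y => ENNReal.ofReal (Real.exp (-(∑ k, regSlope u x k * y k) ^ 2 / 2))) =
    ENNReal.ofReal |blaschke u x| • P.map (fun ω k => mob x (u k) * X (u k) ω) := by
  have hm1 := h.aemeasurable_pi hu
  have hm2 : AEMeasurable (fun ω k => mob x (u k) * X (u k) ω) P :=
    aemeasurable_pi_lambda _ fun k => (h.aemeasurable _ (hu k)).const_mul _
  have := Measure.isProbabilityMeasure_map hm1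
  have := Measure.isProbabilityMeasure_map hm2
  have hmd : Measurable fun y : ι → ℝ =>
      ENNReal.ofReal (Real.exp (-(∑ k, regSlope u x k * y k) ^ 2 / 2)) := by fun_prop
  have hfin : IsFiniteMeasure ((P.map (fun ω k => X (u k) ω)).withDensity
      (fun y => ENNReal.ofReal (Real.exp (-(∑ k, regSlope u x k * y k) ^ 2 / 2)))) := by
    refine isFiniteMeasure_withDensity (ne_of_lt ?_)
    refine lt_of_le_of_lt (lintegral_mono (g := fun _ => 1) fun y => ?_) (by simp)
    rw [← ENNReal.ofReal_one]
    refine ENNReal.ofReal_le_ofReal (Real.exp_le_one_iff.2 ?_)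
    have := sq_nonneg (∑ k, regSlope u x k * y k)
    linarith
  have hfin2 : IsFiniteMeasure (ENNReal.ofReal |blaschke u x| •
      P.map (fun ω k => mob x (u k) * X (u k) ω)) := by
    exact Measure.smul_finite _ ENNReal.ofReal_ne_top
  refine Measure.ext_of_charFunDual (funext fun L => ?_)
  rw [charFunDual_apply, charFunDual_apply, integral_smul_measure,
    integral_withDensity_eq_integral_toReal_smul hmd (by simp), integral_map hm1 (by fun_prop),
    integral_map hm2 (by fun_prop)]
  set ξ : ι → ℝ := fun k => L (Pi.single k 1)
  have hB := blaschke_ne_zero hu hx hxu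
  have hq := one_add_sum_regSlope hu hinj hx hxu
  -- The Gaussian weight is written as an average of characters over an auxiliary standard normal
  -- `z`. After exchanging integrals only characteristic functions of `X` are needed.
  have e1 : ∀ ω, (ENNReal.ofReal (Real.exp (-(∑ k, regSlope u x k * X (u k) ω) ^ 2 / 2))).toReal •
      Complex.exp ((L fun k => X (u k) ω : ℝ) * Complex.I) =
      ∫ z, Complex.exp (((∑ k, (ξ k + z * regSlope u x k) * X (u k) ω : ℝ) : ℂ) * Complex.I)
        ∂gaussianReal 0 1 := by
    intro ω
    rw [ENNReal.toReal_ofReal (Real.exp_pos _).le, pi_dual_apply L, Complex.real_smul,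
      ← integral_gaussianReal_cexp, ← integral_mul_const]
    refine integral_congr_ae (Filter.Eventually.of_forall fun z => ?_)
    dsimp only
    rw [← Complex.exp_add, ← add_mul, ← Complex.ofReal_add, Finset.mul_sum,
      ← Finset.sum_add_distrib]
    congr 4
    funext k
    ring
  simp_rw [e1]
  rw [integral_integral_swap]
  swap
  · refine (integrable_const (1 : ℝ)).mono' ?_ ?_
    · have h1 : ∀ k, AEMeasurable (fun p : Ω × ℝ => X (u k) p.1) (P.prod (gaussianReal 0 1)) :=
        fun k => (h.aemeasurable _ (hu k)).comp_fst
      refine AEMeasurable.aestronglyMeasurable ?_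
      refine Complex.measurable_exp.comp_aemeasurable (AEMeasurable.mul_const ?_ _)
      refine Complex.measurable_ofReal.comp_aemeasurable ?_
      refine Finset.aemeasurable_fun_sum _ fun k _ => AEMeasurable.mul (by fun_prop) (h1 k)
    · exact Filter.Eventually.of_forall fun p => (norm_cexp_ofReal_mul_I _).le
  simp_rw [fun z : ℝ => h.integral_cexp u (fun k => ξ k + z * regSlope u x k) hu,
    sum_sum_sigma_add_mul, sum_regSlope_mul_sigma hu hinj hx hxu]
  have e2 : ∀ ω, (L fun k => mob x (u k) * X (u k) ω) =
      ∑ k, (ξ k * mob x (u k)) * X (u k) ω := by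
    intro ω
    rw [pi_dual_apply L]
    exact Finset.sum_congr rfl fun k _ => by ring
  simp_rw [e2]
  rw [h.integral_cexp u _ hu, integral_complex_ofReal, ENNReal.toReal_ofReal (abs_nonneg _),
    Complex.real_smul, ← Complex.ofReal_mul]
  congr 1
  set Q := ∑ k, ∑ l, ξ k * ξ l * sigma (u k) (u l) with hQ
  set p := ∑ k, ξ k * (sigma x (u k) / residual u x) with hp
  simp_rw [sum_regSlope_mul_sigma hu hinj hx hxu] at hq
  set q := ∑ k, regSlope u x k * (sigma x (u k) / residual u x) with hqdef
  have e3 : ∀ z : ℝ, Real.exp (-(Q + 2 * z * p + z ^ 2 * q) / 2) =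
      Real.exp (-Q / 2) * Real.exp (-(2 * z * p + z ^ 2 * q) / 2) := by
    intro z
    rw [← Real.exp_add]
    congr 1
    ring
  simp_rw [e3]
  rw [integral_const_mul, integral_gaussianReal_exp_quadratic p q (by rw [hq]; positivity), hq,
    Real.sqrt_inv, Real.sqrt_sq_eq_abs, inv_inv, mul_left_comm, ← Real.exp_add]
  congr 2
  have e4 : ∑ k, ∑ l, ξ k * mob x (u k) * (ξ l * mob x (u l)) * sigma (u k) (u l) =
      Q - (∑ k, ξ k * sigma x (u k)) ^ 2 / sigma x x := by
    rw [pow_two, Finset.sum_mul_sum, hQ, Finset.sum_div, ← Finset.sum_sub_distrib]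
    refine Finset.sum_congr rfl fun k _ => ?_
    rw [Finset.sum_div, ← Finset.sum_sub_distrib]
    refine Finset.sum_congr rfl fun l _ => ?_
    linear_combination ξ k * ξ l * mob_mul_mob_mul_sigma (hu k) (hu l) hx
  have e5 : p = (∑ k, ξ k * sigma x (u k)) / residual u x := by
    rw [hp, Finset.sum_div]
    exact Finset.sum_congr rfl fun k _ => by ring
  have e6 : residual u x ^ 2 = blaschke u x ^ 2 * sigma x x := by
    rw [residual, mul_pow, Real.sq_sqrt (sigma_self_pos hx).le]
  rw [e4, e5, div_pow, e6]
  have := (sigma_self_pos hx).ne'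
  field_simp
  ring

include h hu hinj hx hxu in
theorem integral_mul_exp_sq {g : (ι → ℝ) → ℝ} (hg : Measurable g) :
    ∫ ω, g (fun k => X (u k) ω) * Real.exp (-(∑ k, regSlope u x k * X (u k) ω) ^ 2 / 2) ∂P =
      |blaschke u x| * ∫ ω, g (fun k => mob x (u k) * X (u k) ω) ∂P := by
  have hm1 := h.aemeasurable_pi hu
  have hm2 : AEMeasurable (fun ω k => mob x (u k) * X (u k) ω) P :=
    aemeasurable_pi_lambda _ fun k => (h.aemeasurable _ (hu k)).const_mul _
  have hmd : Measurable fun y : ι → ℝ =>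
      ENNReal.ofReal (Real.exp (-(∑ k, regSlope u x k * y k) ^ 2 / 2)) := by fun_prop
  have hm3 : Measurable fun y : ι → ℝ =>
      (ENNReal.ofReal (Real.exp (-(∑ k, regSlope u x k * y k) ^ 2 / 2))).toReal • g y :=
    hmd.ennreal_toReal.smul hg
  have h1 := congrArg (fun m => ∫ y, g y ∂m) (h.map_withDensity_eq hu hinj hx hxu)
  rw [integral_smul_measure, integral_withDensity_eq_integral_toReal_smul hmd (by simp),
    integral_map hm1 hm3.aestronglyMeasurable,
    integral_map hm2 hg.aestronglyMeasurable, ENNReal.toReal_ofReal (abs_nonneg _), smul_eq_mul] at h1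
  rw [← h1]
  refine integral_congr_ae (Filter.Eventually.of_forall fun ω => ?_)
  simp only [ENNReal.toReal_ofReal (Real.exp_pos _).le, smul_eq_mul, mul_comm]

end Regression

end IsSzegoProcess

end GaussianPowerSeries

/-! ### The sign function. -/

section Sign

theorem Real.sign_mul_sign (x y : ℝ) : Real.sign (x * y) = Real.sign x * Real.sign y := by
  rcases lt_trichotomy x 0 with hx | rfl | hx <;> rcases lt_trichotomy y 0 with hy | rfl | hy <;>
    simp [Real.sign_of_neg, Real.sign_of_pos, Real.sign_zero, *, mul_pos_of_neg_of_neg,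
      mul_neg_of_neg_of_pos, mul_neg_of_pos_of_neg]

theorem Real.self_mul_sign_eq_abs (x : ℝ) : x * Real.sign x = |x| := by
  rcases lt_trichotomy x 0 with hx | rfl | hx
  · rw [Real.sign_of_neg hx, abs_of_neg hx]; ring
  · simp
  · rw [Real.sign_of_pos hx, abs_of_pos hx]; ring

theorem Real.abs_sign_le_one (x : ℝ) : |Real.sign x| ≤ 1 := by
  rcases Real.sign_apply_eq x with h | h | h <;> simp [h]

theorem Real.measurable_real_sign : Measurable Real.sign := by
  unfold Real.sign
  exact Measurable.ite measurableSet_Iio measurable_const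
    (Measurable.ite measurableSet_Ioi measurable_const measurable_const)

theorem Real.sign_mul_sign_self {x : ℝ} (hx : x ≠ 0) : Real.sign x * Real.sign x = 1 := by
  rcases Real.sign_apply_eq_of_ne_zero x hx with h | h <;> simp [h]

theorem Real.sign_eventuallyEq {f : ℝ → ℝ} {x : ℝ} (hf : ContinuousAt f x) (h : f x ≠ 0) :
    ∀ᶠ y in nhds x, Real.sign (f y) = Real.sign (f x) := by
  rcases h.lt_or_gt with h | h
  · filter_upwards [hf.eventually (gt_mem_nhds h)] with y hy
    rw [Real.sign_of_neg hy, Real.sign_of_neg h]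
  · filter_upwards [hf.eventually (lt_mem_nhds h)] with y hy
    rw [Real.sign_of_pos hy, Real.sign_of_pos h]

end Sign

/-! ### The sign smoothed by Gaussian noise. -/

namespace GaussianPowerSeries

/-- The expectation of `sign (x + Z)` for a standard Gaussian `Z`. -/
noncomputable def gaussSign (x : ℝ) : ℝ := ∫ z, Real.sign (x + z) ∂gaussianReal 0 1

theorem abs_gaussSign_le (x : ℝ) : |gaussSign x| ≤ 1 := by
  have h := norm_integral_le_of_norm_le_const (μ := gaussianReal 0 1) (C := 1)
    (f := fun z => Real.sign (x + z)) (Filter.Eventually.of_forall fun _ => Real.abs_sign_le_one _)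
  simpa [gaussSign] using h

theorem gaussSign_zero : gaussSign 0 = 0 := by
  have h : ∫ z, Real.sign z ∂gaussianReal 0 1 = -∫ z, Real.sign z ∂gaussianReal 0 1 := by
    conv_lhs => rw [← neg_zero (G := ℝ), ← gaussianReal_map_neg]
    rw [integral_map (by fun_prop) Real.measurable_real_sign.aestronglyMeasurable]
    simp_rw [Real.sign_neg]
    exact integral_neg _
  simp only [gaussSign, zero_add]
  linarith

theorem continuous_gaussianPDFReal : Continuous (gaussianPDFReal 0 1) := by
  unfold gaussianPDFReal
  fun_prop

theorem gaussianPDFReal_standard (x : ℝ) :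
    2 * gaussianPDFReal 0 1 x = √(2 / Real.pi) * Real.exp (-x ^ 2 / 2) := by
  have h : (2 : ℝ) * (√(2 * Real.pi))⁻¹ = √(2 / Real.pi) := by
    rw [Real.sqrt_mul (by norm_num), Real.sqrt_div (by norm_num)]
    have := Real.sq_sqrt (show (0 : ℝ) ≤ 2 by norm_num)
    have h2 : √2 ≠ 0 := by positivity
    have h3 : √Real.pi ≠ 0 := by positivity
    field_simp
    exact this.symm
  simp only [gaussianPDFReal, NNReal.coe_one, mul_one, sub_zero]
  rw [← mul_assoc, h]

theorem gaussSign_eq (x : ℝ) :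
    gaussSign x = 1 - 2 * ∫ z in Set.Iic (-x), gaussianPDFReal 0 1 z := by
  rw [gaussSign, integral_gaussianReal_eq_integral_smul one_ne_zero]
  have h : (fun z => gaussianPDFReal 0 1 z • Real.sign (x + z)) =ᵐ[volume]
      fun z => gaussianPDFReal 0 1 z - 2 * (Set.Iic (-x)).indicator (gaussianPDFReal 0 1) z := by
    have h0 : ∀ᵐ z : ℝ, z ≠ -x := by simp [ae_iff]
    filter_upwards [h0] with z hz
    rcases hz.lt_or_gt with hz | hz
    · rw [Set.indicator_of_mem (Set.mem_Iic.2 hz.le), Real.sign_of_neg (by linarith), smul_eq_mul]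
      ring
    · rw [Set.indicator_of_notMem (by simpa using hz), Real.sign_of_pos (by linarith), smul_eq_mul]
      ring
  rw [integral_congr_ae h, integral_sub (integrable_gaussianPDFReal 0 1)
    (((integrable_gaussianPDFReal 0 1).indicator measurableSet_Iic).const_mul 2),
    integral_gaussianPDFReal_eq_one 0 one_ne_zero, integral_const_mul,
    integral_indicator measurableSet_Iic]

theorem hasDerivAt_gaussSign (x : ℝ) :
    HasDerivAt gaussSign (√(2 / Real.pi) * Real.exp (-x ^ 2 / 2)) x := by
  have hi := integrable_gaussianPDFReal 0 1
  have h1 : ∀ y, gaussSign y = 1 - 2 * ((∫ z in Set.Iic 0, gaussianPDFReal 0 1 z) +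
      ∫ z in (0 : ℝ)..(-y), gaussianPDFReal 0 1 z) := by
    intro y
    rw [gaussSign_eq, ← intervalIntegral.integral_Iic_sub_Iic hi.integrableOn hi.integrableOn]
    ring
  have h2 : HasDerivAt (fun y => ∫ z in (0 : ℝ)..y, gaussianPDFReal 0 1 z)
      (gaussianPDFReal 0 1 (-x)) (-x) :=
    intervalIntegral.integral_hasDerivAt_right hi.intervalIntegrable
      (continuous_gaussianPDFReal.stronglyMeasurableAtFilter _ _)
      continuous_gaussianPDFReal.continuousAt
  have h3 := ((((h2.scomp x (hasDerivAt_neg x)).const_add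
    (∫ z in Set.Iic 0, gaussianPDFReal 0 1 z)).const_mul 2).const_sub 1)
  rw [funext h1]
  refine h3.congr_deriv ?_
  rw [← gaussianPDFReal_standard]
  simp [gaussianPDFReal]

theorem continuous_gaussSign : Continuous gaussSign :=
  continuous_iff_continuousAt.2 fun x => (hasDerivAt_gaussSign x).continuousAt

/-- Since `z φ(z)` is the derivative of `-φ`, each of the half-lines cut at `-x` contributes `φ(x)`.
-/
theorem integral_mul_sign_add (x : ℝ) :
    ∫ z, z * Real.sign (x + z) ∂gaussianReal 0 1 = √(2 / Real.pi) * Real.exp (-x ^ 2 / 2) := by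
  have hd : ∀ z, HasDerivAt (fun z => -gaussianPDFReal 0 1 z) (gaussianPDFReal 0 1 z * z) z := by
    intro z
    have h1 : HasDerivAt (fun z : ℝ => -z ^ 2 / 2) (-z) z := by
      exact ((hasDerivAt_pow 2 z).neg.div_const 2).congr_deriv (by simp; ring)
    have h2 := (h1.exp.const_mul (√(2 * Real.pi))⁻¹).neg
    have h3 : (fun z => -gaussianPDFReal 0 1 z) =
        -fun y => (√(2 * Real.pi))⁻¹ * Real.exp (-y ^ 2 / 2) := by
      funext z
      simp [gaussianPDFReal]
    rw [h3]
    exact h2.congr_deriv (by simp [gaussianPDFReal]; ring)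
  have hi : Integrable (fun z => gaussianPDFReal 0 1 z * z) := by
    have h := (integrable_mul_exp_neg_mul_sq (b := 1 / 2) (by norm_num)).const_mul
      (√(2 * Real.pi))⁻¹
    refine h.congr (Filter.Eventually.of_forall fun z => ?_)
    simp only [gaussianPDFReal, NNReal.coe_one, mul_one, sub_zero]
    rw [show -(1 / 2) * z ^ 2 = -z ^ 2 / 2 by ring]
    ring
  have hlim : ∀ l : Filter ℝ, Filter.Tendsto (fun z : ℝ => z ^ 2) l Filter.atTop →
      Filter.Tendsto (fun z => -gaussianPDFReal 0 1 z) l (nhds 0) := by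
    intro l hl
    have h1 : Filter.Tendsto (fun z : ℝ => Real.exp (-z ^ 2 / 2)) l (nhds 0) := by
      refine Real.tendsto_exp_atBot.comp ?_
      have := (hl.atTop_div_const (show (0 : ℝ) < 2 by norm_num))
      refine (Filter.tendsto_neg_atTop_atBot.comp this).congr fun z => ?_
      simp; ring
    have h2 := (h1.const_mul (√(2 * Real.pi))⁻¹).neg
    simp only [mul_zero, neg_zero] at h2
    refine h2.congr fun z => ?_
    simp [gaussianPDFReal]
  have hr := integral_Ioi_of_hasDerivAt_of_tendsto (a := -x)
    (continuous_gaussianPDFReal.neg.continuousWithinAt) (fun z _ => hd z) hi.integrableOn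
    (hlim _ (Filter.tendsto_pow_atTop two_ne_zero))
  have hl := integral_Iic_of_hasDerivAt_of_tendsto (a := -x)
    (continuous_gaussianPDFReal.neg.continuousWithinAt) (fun z _ => hd z) hi.integrableOn
    (hlim _ ?_)
  swap
  · exact ((Filter.tendsto_pow_atTop two_ne_zero).comp Filter.tendsto_neg_atBot_atTop).congr
      fun z => by simp
  rw [integral_gaussianReal_eq_integral_smul one_ne_zero]
  have hint : Integrable (fun z => gaussianPDFReal 0 1 z • (z * Real.sign (x + z))) := by
    refine hi.norm.mono' ?_ (Filter.Eventually.of_forall fun z => ?_)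
    · exact (measurable_gaussianPDFReal 0 1).smul (measurable_id.mul
        (Real.measurable_real_sign.comp (measurable_const_add x))) |>.aestronglyMeasurable
    · rw [smul_eq_mul, ← mul_assoc, norm_mul]
      exact mul_le_of_le_one_right (norm_nonneg _) (Real.abs_sign_le_one _)
  rw [← intervalIntegral.integral_Iic_add_Ioi hint.integrableOn hint.integrableOn (b := -x),
    ← gaussianPDFReal_standard]
  have h1 : ∫ z in Set.Ioi (-x), gaussianPDFReal 0 1 z • (z * Real.sign (x + z)) =
      ∫ z in Set.Ioi (-x), gaussianPDFReal 0 1 z * z := by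
    refine setIntegral_congr_fun measurableSet_Ioi fun z hz => ?_
    have : 0 < x + z := by have := Set.mem_Ioi.1 hz; linarith
    simp [Real.sign_of_pos this]
  have h2 : ∫ z in Set.Iic (-x), gaussianPDFReal 0 1 z • (z * Real.sign (x + z)) =
      -∫ z in Set.Iic (-x), gaussianPDFReal 0 1 z * z := by
    rw [← integral_neg, integral_Iic_eq_integral_Iio, integral_Iic_eq_integral_Iio]
    refine setIntegral_congr_fun measurableSet_Iio fun z hz => ?_
    have : x + z < 0 := by have := Set.mem_Iio.1 hz; linarith
    simp [Real.sign_of_neg this]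
  rw [h1, h2, hr, hl]
  simp [gaussianPDFReal]
  ring

/-! ### Dependence of the regression slopes on the point. -/

section Slope

variable {ι : Type} [Fintype ι] [DecidableEq ι] {u : ι → ℝ} {x : ℝ}

/-- The derivative of `regSlope u x k` with respect to `x`. -/
noncomputable def regSlopeDeriv (u : ι → ℝ) (x : ℝ) (k : ι) : ℝ :=
  -(1 - x * u k) / ((1 - x ^ 2) * (x - u k)) * regSlope u x k

theorem continuousAt_regSlope (hxu : ∀ i, x ≠ u i) (k : ι) :
    ContinuousAt (fun t => regSlope u t k) x := by
  unfold regSlope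
  refine ContinuousAt.div (by fun_prop) (by fun_prop) (sub_ne_zero.2 (hxu k))

theorem hasDerivAt_regSlope (hx : x ∈ Set.Ioo (-1 : ℝ) 1) (hxu : ∀ i, x ≠ u i) (k : ι) :
    HasDerivAt (fun t => regSlope u t k) (regSlopeDeriv u x k) x := by
  have h1 : HasDerivAt (fun t : ℝ => 1 - t ^ 2) (-(2 * x)) x :=
    ((hasDerivAt_pow 2 x).const_sub 1).congr_deriv (by simp)
  have hp := one_sub_sq_pos hx
  have hk := sub_ne_zero.2 (hxu k)
  have h2 := ((h1.sqrt hp.ne').const_mul (regWeight u k)).div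
    ((hasDerivAt_id x).sub_const (u k)) hk
  refine h2.congr_deriv ?_
  have hs : √(1 - x ^ 2) ≠ 0 := (Real.sqrt_pos.2 hp).ne'
  have hs2 : √(1 - x ^ 2) ^ 2 = 1 - x ^ 2 := Real.sq_sqrt hp.le
  have hp' := hp.ne'
  rw [regSlopeDeriv, regSlope]
  simp only [id]
  rw [← hs2] at hp' ⊢
  rw [Real.sqrt_sq (Real.sqrt_nonneg _)]
  field_simp
  rw [hs2]
  ring

theorem continuousAt_regSlopeDeriv (hx : x ∈ Set.Ioo (-1 : ℝ) 1) (hxu : ∀ i, x ≠ u i) (k : ι) :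
    ContinuousAt (fun t => regSlopeDeriv u t k) x := by
  unfold regSlopeDeriv
  refine ContinuousAt.mul (ContinuousAt.div (by fun_prop) (by fun_prop) ?_)
    (continuousAt_regSlope hxu k)
  exact mul_ne_zero (one_sub_sq_pos hx).ne' (sub_ne_zero.2 (hxu k))

/-- The logarithmic derivative of the slope is `σ(x,x) / mob x (u k)`. Hence the Möbius factor
brought by conditioning turns the derivative back into a multiple of the slope. -/
theorem regSlopeDeriv_mul_mob (hu : ∀ i, u i ∈ Set.Ioo (-1 : ℝ) 1)
    (hx : x ∈ Set.Ioo (-1 : ℝ) 1) (hxu : ∀ i, x ≠ u i) (k : ι) :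
    regSlopeDeriv u x k * mob x (u k) = sigma x x * regSlope u x k := by
  have h1 := (one_sub_mul_pos hx (hu k)).ne'
  have h2 := (one_sub_sq_pos hx).ne'
  have h3 := sub_ne_zero.2 (hxu k)
  rw [regSlopeDeriv, mob, sigma, ← pow_two]
  field_simp
  ring

omit [DecidableEq ι] in
theorem continuousAt_blaschke (hu : ∀ i, u i ∈ Set.Ioo (-1 : ℝ) 1)
    (hx : x ∈ Set.Ioo (-1 : ℝ) 1) : ContinuousAt (blaschke u) x := by
  unfold blaschke
  refine tendsto_finsetProd _ fun i _ => ?_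
  exact ContinuousAt.div (by fun_prop) (by fun_prop) (one_sub_mul_pos hx (hu i)).ne'

omit [DecidableEq ι] in
theorem sign_residual (hx : x ∈ Set.Ioo (-1 : ℝ) 1) :
    Real.sign (residual u x) = Real.sign (blaschke u x) := by
  rw [residual, Real.sign_mul_sign, Real.sign_of_pos (Real.sqrt_pos.2 (sigma_self_pos hx)), mul_one]

end Slope

/-! ### Differentiating the expectation of a sign. -/

namespace IsSzegoProcess

variable {Ω : Type*} [MeasurableSpace Ω] {X : ℝ → Ω → ℝ} {P : Measure Ω} [IsProbabilityMeasure P]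
  (h : IsSzegoProcess X P)

variable {ι : Type} [Fintype ι] [DecidableEq ι] {u : ι → ℝ} {x : ℝ}
  (hu : ∀ i, u i ∈ Set.Ioo (-1 : ℝ) 1) (hinj : Function.Injective u)
  (hx : x ∈ Set.Ioo (-1 : ℝ) 1) (hxu : ∀ i, x ≠ u i)

theorem sum_regCoeff_eq (u : ι → ℝ) (hx : x ∈ Set.Ioo (-1 : ℝ) 1) (y : ι → ℝ) :
    ∑ k, regCoeff u x k * y k = residual u x * ∑ k, regSlope u x k * y k := by
  rw [Finset.mul_sum]
  exact Finset.sum_congr rfl fun k _ => by rw [regCoeff_eq_mul hx, mul_assoc]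

include h hu hinj hx hxu in
-- Dividing regression plus noise by the signed residual gives `S + Z` with `S` the slope sum.
-- Integrating out `Z` yields `gaussSign S`, which is smooth in the point.
theorem integral_mul_sign {Φ : (ι → ℝ) → ℝ} (hΦ : Measurable Φ)
    (hint : Integrable (fun ω => Φ fun k => X (u k) ω) P) :
    ∫ ω, Φ (fun k => X (u k) ω) * Real.sign (X x ω) ∂P = Real.sign (blaschke u x) *
      ∫ ω, Φ (fun k => X (u k) ω) * gaussSign (∑ k, regSlope u x k * X (u k) ω) ∂P := by
  have hg : Measurable fun q : (ι → ℝ) × ℝ => Φ q.1 * Real.sign q.2 :=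
    (hΦ.comp measurable_fst).mul (Real.measurable_real_sign.comp measurable_snd)
  have h1 := h.integral_regression hu hinj hx hxu hg
  have h2 : Integrable (fun ω => Φ (fun k => X (u k) ω) * Real.sign (X x ω)) P := by
    refine hint.norm.mono' (hint.aestronglyMeasurable.mul (Real.measurable_real_sign.comp_aemeasurable
      (h.aemeasurable x hx)).aestronglyMeasurable) (Filter.Eventually.of_forall fun ω => ?_)
    rw [norm_mul]
    exact mul_le_of_le_one_right (norm_nonneg _) (Real.abs_sign_le_one _)
  have h3 := (h.integrable_regression hu hinj hx hxu hg).1 h2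
  dsimp only at h1 h3
  rw [h1, integral_prod _ h3, ← integral_const_mul]
  refine integral_congr_ae (Filter.Eventually.of_forall fun ω => ?_)
  dsimp only
  rw [integral_const_mul, gaussSign, ← sign_residual hx, ← integral_const_mul, ← integral_const_mul,
    ← integral_const_mul]
  refine integral_congr_ae (Filter.Eventually.of_forall fun z => ?_)
  dsimp only
  rw [sum_regCoeff_eq u hx, ← mul_add, Real.sign_mul_sign]
  ring

include h hu hinj hx hxu in
theorem integral_mul_self {Φ : (ι → ℝ) → ℝ} (hΦ : Measurable Φ)
    (hint : Integrable (fun ω => Φ fun k => X (u k) ω) P)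
    (hintX : ∀ k, Integrable (fun ω => Φ (fun k => X (u k) ω) * X (u k) ω) P) :
    ∫ ω, Φ (fun k => X (u k) ω) * X x ω ∂P =
      ∫ ω, Φ (fun k => X (u k) ω) * ∑ k, regCoeff u x k * X (u k) ω ∂P := by
  have hg : Measurable fun q : (ι → ℝ) × ℝ => Φ q.1 * q.2 :=
    (hΦ.comp measurable_fst).mul measurable_snd
  have h1 := h.integral_regression hu hinj hx hxu hg
  have hz : Integrable (fun z : ℝ => z) (gaussianReal 0 1) :=
    (memLp_id_gaussianReal (μ := 0) (v := 1) 1).integrable (by simp)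
  have h2 : Integrable (fun ω => Φ (fun k => X (u k) ω) * ∑ k, regCoeff u x k * X (u k) ω) P := by
    simp_rw [Finset.mul_sum]
    refine integrable_finsetSum _ fun k _ => ?_
    refine ((hintX k).const_mul (regCoeff u x k)).congr (Filter.Eventually.of_forall fun ω => ?_)
    dsimp only
    ring
  have h3 : Integrable (fun p : Ω × ℝ => Φ (fun k => X (u k) p.1) *
      ∑ k, regCoeff u x k * X (u k) p.1) (P.prod (gaussianReal 0 1)) := h2.comp_fst _
  have h4 : Integrable (fun p : Ω × ℝ => Φ (fun k => X (u k) p.1) * (residual u x * p.2))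
      (P.prod (gaussianReal 0 1)) := hint.mul_prod (hz.const_mul _)
  dsimp only at h1
  simp_rw [mul_add] at h1
  rw [h1, integral_add h3 h4,
    integral_prod_mul (fun ω => Φ fun k => X (u k) ω) fun z => residual u x * z,
    integral_const_mul, integral_id_gaussianReal, mul_zero, mul_zero, add_zero,
    integral_fun_fst fun ω => Φ (fun k => X (u k) ω) * ∑ k, regCoeff u x k * X (u k) ω]
  simp

include h hu hinj hx hxu in
-- Integrating out the noise by `integral_mul_sign_add` leaves the weight `exp (-S² / 2)`, and the
-- tilt formula applies.
theorem integral_mul_residual_mul_sign {F : (ι → ℝ) → ℝ} (hF : Measurable F)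
    (hF1 : ∀ y, |F y| ≤ 1) :
    ∫ ω, F (fun k => X (u k) ω) * ((X x ω - ∑ k, regCoeff u x k * X (u k) ω) *
      Real.sign (X x ω)) ∂P = √(2 / Real.pi) * (|residual u x| * |blaschke u x|) *
        ∫ ω, F (fun k => mob x (u k) * X (u k) ω) ∂P := by
  have hg : Measurable fun q : (ι → ℝ) × ℝ =>
      F q.1 * ((q.2 - ∑ k, regCoeff u x k * q.1 k) * Real.sign q.2) := by
    refine (hF.comp measurable_fst).mul (Measurable.mul ?_
      (Real.measurable_real_sign.comp measurable_snd))
    fun_prop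
  have h1 := h.integral_regression hu hinj hx hxu hg
  have hz : Integrable (fun z : ℝ => z) (gaussianReal 0 1) :=
    (memLp_id_gaussianReal (μ := 0) (v := 1) 1).integrable (by simp)
  have hi : Integrable (fun p : Ω × ℝ => |residual u x| * |p.2|) (P.prod (gaussianReal 0 1)) :=
    (hz.abs.comp_snd P).const_mul _
  have hm : AEStronglyMeasurable (fun p : Ω × ℝ => F (fun k => X (u k) p.1) *
      ((∑ k, regCoeff u x k * X (u k) p.1 + residual u x * p.2 - ∑ k, regCoeff u x k * X (u k) p.1) *
        Real.sign (∑ k, regCoeff u x k * X (u k) p.1 + residual u x * p.2)))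
      (P.prod (gaussianReal 0 1)) :=
    (hg.comp_aemeasurable (h.aemeasurable_regression (u := u) (x := x) hu)).aestronglyMeasurable
  have h3 : Integrable (fun p : Ω × ℝ => F (fun k => X (u k) p.1) *
      ((∑ k, regCoeff u x k * X (u k) p.1 + residual u x * p.2 - ∑ k, regCoeff u x k * X (u k) p.1) *
        Real.sign (∑ k, regCoeff u x k * X (u k) p.1 + residual u x * p.2)))
      (P.prod (gaussianReal 0 1)) := by
    refine hi.mono' hm (Filter.Eventually.of_forall fun p => ?_)
    rw [add_sub_cancel_left, norm_mul, norm_mul, norm_mul]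
    simp only [Real.norm_eq_abs]
    calc _ ≤ 1 * (|residual u x| * |p.2| * 1) := by
          gcongr
          · exact hF1 _
          · exact Real.abs_sign_le_one _
      _ = _ := by ring
  dsimp only at h1
  rw [h1, integral_prod _ h3, mul_assoc, mul_assoc, ← h.integral_mul_exp_sq hu hinj hx hxu hF,
    ← mul_assoc, ← integral_const_mul]
  refine integral_congr_ae (Filter.Eventually.of_forall fun ω => ?_)
  dsimp only
  rw [integral_const_mul]
  have h4 : ∀ z : ℝ, (∑ k, regCoeff u x k * X (u k) ω + residual u x * z -
      ∑ k, regCoeff u x k * X (u k) ω) *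
        Real.sign (∑ k, regCoeff u x k * X (u k) ω + residual u x * z) =
      |residual u x| * (z * Real.sign ((∑ k, regSlope u x k * X (u k) ω) + z)) := by
    intro z
    rw [add_sub_cancel_left, sum_regCoeff_eq u hx, ← mul_add, Real.sign_mul_sign,
      ← Real.self_mul_sign_eq_abs]
    ring
  simp_rw [h4]
  rw [integral_const_mul, integral_mul_sign_add]
  ring

include h hu hinj hx hxu in
-- Differentiating `gaussSign S` gives `exp (-S² / 2)` times the derivative of `S`. The tilt turns
-- the weight into Möbius factors, which give `c` on `Φ` and convert the derivative of `S` into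
-- `σ(x,x) S`; and `residual * S` is the regression of `X x`.
theorem hasDerivAt_integral_mul_sign {Φ : (ι → ℝ) → ℝ} (hΦ : Measurable Φ)
    (hint : Integrable (fun ω => Φ fun k => X (u k) ω) P)
    (hintX : ∀ k, Integrable (fun ω => Φ (fun k => X (u k) ω) * X (u k) ω) P) {c : ℝ}
    (hc : ∀ y : ι → ℝ, Φ (fun k => mob x (u k) * y k) = c * Φ y) :
    HasDerivAt (fun t => ∫ ω, Φ (fun k => X (u k) ω) * Real.sign (X t ω) ∂P)
      (√(2 / Real.pi) * √(sigma x x) * (c * ∫ ω, Φ (fun k => X (u k) ω) * X x ω ∂P)) x := by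
  have hB := blaschke_ne_zero hu hx hxu
  have hnhds : ∀ᶠ t in nhds x, t ∈ Set.Ioo (-1 : ℝ) 1 ∧ ∀ i, t ≠ u i := by
    refine Filter.Eventually.and (Ioo_mem_nhds hx.1 hx.2) (Filter.eventually_all.2 fun i => ?_)
    exact isOpen_ne.mem_nhds (hxu i)
  -- Away from the nodes the sign of the Blaschke product is locally constant, so only the smoothed
  -- sign is differentiated.
  have hEq : (fun t => ∫ ω, Φ (fun k => X (u k) ω) * Real.sign (X t ω) ∂P) =ᶠ[nhds x]
      fun t => Real.sign (blaschke u x) *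
        ∫ ω, Φ (fun k => X (u k) ω) * gaussSign (∑ k, regSlope u t k * X (u k) ω) ∂P := by
    filter_upwards [hnhds, Real.sign_eventuallyEq (continuousAt_blaschke hu hx) hB] with t ht hs
    rw [h.integral_mul_sign hu hinj ht.1 ht.2 hΦ hint, hs]
  refine HasDerivAt.congr_of_eventuallyEq ?_ hEq
  have hb : ∀ᶠ t in nhds x, ∀ k, |regSlopeDeriv u t k| ≤ |regSlopeDeriv u x k| + 1 := by
    refine Filter.eventually_all.2 fun k => ?_
    have := (continuousAt_regSlopeDeriv hx hxu k).abs.eventually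
      (gt_mem_nhds (lt_add_one |regSlopeDeriv u x k|))
    exact this.mono fun t ht => ht.le
  have hmX : ∀ k, AEStronglyMeasurable (X (u k)) P :=
    fun k => (h.aemeasurable _ (hu k)).aestronglyMeasurable
  have hmS : ∀ β : ι → ℝ, AEStronglyMeasurable (fun ω => ∑ k, β k * X (u k) ω) P :=
    fun β => Finset.aestronglyMeasurable_fun_sum _ fun k _ => (hmX k).const_mul _
  have hD := (hasDerivAt_integral_of_dominated_loc_of_deriv_le (μ := P)
    (F := fun t ω => Φ (fun k => X (u k) ω) * gaussSign (∑ k, regSlope u t k * X (u k) ω))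
    (F' := fun t ω => Φ (fun k => X (u k) ω) * (√(2 / Real.pi) *
      Real.exp (-(∑ k, regSlope u t k * X (u k) ω) ^ 2 / 2) *
        ∑ k, regSlopeDeriv u t k * X (u k) ω))
    (bound := fun ω => √(2 / Real.pi) * ∑ k, (|regSlopeDeriv u x k| + 1) *
      |Φ (fun k => X (u k) ω) * X (u k) ω|) (hnhds.and hb) ?_ ?_ ?_ ?_ ?_ ?_).2
  · refine (hD.const_mul (Real.sign (blaschke u x))).congr_deriv ?_
    have hg : Measurable fun y : ι → ℝ => Φ y * ∑ k, regSlopeDeriv u x k * y k := by fun_prop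
    have h1 := h.integral_mul_exp_sq hu hinj hx hxu hg
    have h2 : ∀ y : ι → ℝ, Φ (fun k => mob x (u k) * y k) *
        ∑ k, regSlopeDeriv u x k * (mob x (u k) * y k) =
        c * sigma x x * (Φ y * ∑ k, regSlope u x k * y k) := by
      intro y
      have : ∑ k, regSlopeDeriv u x k * (mob x (u k) * y k) =
          sigma x x * ∑ k, regSlope u x k * y k := by
        rw [Finset.mul_sum]
        refine Finset.sum_congr rfl fun k _ => ?_
        rw [← mul_assoc, regSlopeDeriv_mul_mob hu hx hxu, mul_assoc]
      rw [hc, this]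
      ring
    simp_rw [h2] at h1
    rw [integral_const_mul] at h1
    rw [h.integral_mul_self hu hinj hx hxu hΦ hint hintX]
    simp_rw [sum_regCoeff_eq u hx]
    have h3 : ∀ ω, Φ (fun k => X (u k) ω) * (√(2 / Real.pi) *
        Real.exp (-(∑ k, regSlope u x k * X (u k) ω) ^ 2 / 2) *
          ∑ k, regSlopeDeriv u x k * X (u k) ω) = √(2 / Real.pi) *
        (Φ (fun k => X (u k) ω) * (∑ k, regSlopeDeriv u x k * X (u k) ω) *
          Real.exp (-(∑ k, regSlope u x k * X (u k) ω) ^ 2 / 2)) := by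
      intro ω
      ring
    have h4 : ∀ ω, Φ (fun k => X (u k) ω) * (residual u x * ∑ k, regSlope u x k * X (u k) ω) =
        residual u x * (Φ (fun k => X (u k) ω) * ∑ k, regSlope u x k * X (u k) ω) := by
      intro ω
      ring
    simp_rw [h3, h4]
    rw [integral_const_mul, integral_const_mul, h1, residual]
    have h5 : Real.sign (blaschke u x) * |blaschke u x| = blaschke u x := by
      rw [← Real.self_mul_sign_eq_abs, mul_left_comm, Real.sign_mul_sign_self hB, mul_one]
    have h6 := Real.mul_self_sqrt (sigma_self_pos hx).le
    linear_combination (√(2 / Real.pi) * c *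
      ∫ ω, Φ (fun k => X (u k) ω) * ∑ k, regSlope u x k * X (u k) ω ∂P) *
        (sigma x x * h5 - blaschke u x * h6)
  · refine Filter.Eventually.of_forall fun t => hint.aestronglyMeasurable.mul ?_
    exact continuous_gaussSign.comp_aestronglyMeasurable (hmS _)
  · refine hint.norm.mono' (hint.aestronglyMeasurable.mul
      (continuous_gaussSign.comp_aestronglyMeasurable (hmS _)))
      (Filter.Eventually.of_forall fun ω => ?_)
    rw [norm_mul]
    exact mul_le_of_le_one_right (norm_nonneg _) (abs_gaussSign_le _)
  · refine hint.aestronglyMeasurable.mul (AEStronglyMeasurable.mul ?_ (hmS _))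
    have : Continuous fun s : ℝ => √(2 / Real.pi) * Real.exp (-s ^ 2 / 2) := by fun_prop
    exact this.comp_aestronglyMeasurable (hmS _)
  · refine Filter.Eventually.of_forall fun ω t ht => ?_
    rw [norm_mul, norm_mul, norm_mul]
    simp only [Real.norm_eq_abs, abs_mul]
    rw [abs_of_nonneg (Real.sqrt_nonneg _), abs_of_pos (Real.exp_pos _)]
    have h1 : |∑ k, regSlopeDeriv u t k * X (u k) ω| ≤
        ∑ k, (|regSlopeDeriv u x k| + 1) * |X (u k) ω| := by
      refine (Finset.abs_sum_le_sum_abs _ _).trans (Finset.sum_le_sum fun k _ => ?_)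
      rw [abs_mul]
      gcongr
      exact ht.2 k
    have h2 : Real.exp (-(∑ k, regSlope u t k * X (u k) ω) ^ 2 / 2) ≤ 1 := by
      refine Real.exp_le_one_iff.2 ?_
      have := sq_nonneg (∑ k, regSlope u t k * X (u k) ω)
      linarith
    calc _ ≤ |Φ fun k => X (u k) ω| * (√(2 / Real.pi) * 1 *
          ∑ k, (|regSlopeDeriv u x k| + 1) * |X (u k) ω|) := by gcongr
      _ = _ := by
        rw [Finset.mul_sum, Finset.mul_sum, Finset.mul_sum]
        exact Finset.sum_congr rfl fun k _ => by ring
  · refine Integrable.const_mul (integrable_finsetSum _ fun k _ => ?_) _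
    exact (hintX k).abs.const_mul _
  · refine Filter.Eventually.of_forall fun ω t ht => HasDerivAt.const_mul _ ?_
    have h1 : HasDerivAt (fun t => ∑ k, regSlope u t k * X (u k) ω)
        (∑ k, regSlopeDeriv u t k * X (u k) ω) t :=
      HasDerivAt.fun_sum fun k _ => (hasDerivAt_regSlope ht.1.1 ht.1.2 k).mul_const _
    exact (hasDerivAt_gaussSign _).comp t h1

include h hu hinj in
-- Every slope contains `√(1 - t²)`, which vanishes at `-1`. In the limit the sign is independent of
-- the other values and has mean `gaussSign 0 = 0`.
theorem tendsto_integral_mul_sign {Φ : (ι → ℝ) → ℝ} (hΦ : Measurable Φ)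
    (hint : Integrable (fun ω => Φ fun k => X (u k) ω) P) :
    Filter.Tendsto (fun t => ∫ ω, Φ (fun k => X (u k) ω) * Real.sign (X t ω) ∂P)
      (nhdsWithin (-1) (Set.Ioi (-1))) (nhds 0) := by
  have hne : ∀ i, (-1 : ℝ) ≠ u i := fun i => (hu i).1.ne
  have hnhds : ∀ᶠ t in nhdsWithin (-1 : ℝ) (Set.Ioi (-1)), t ∈ Set.Ioo (-1 : ℝ) 1 ∧ ∀ i, t ≠ u i := by
    refine Filter.Eventually.and (Ioo_mem_nhdsGT (by norm_num)) (Filter.eventually_all.2 fun i => ?_)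
    exact nhdsWithin_le_nhds (isOpen_ne.mem_nhds (hne i))
  have hmS : ∀ β : ι → ℝ, AEStronglyMeasurable (fun ω => ∑ k, β k * X (u k) ω) P :=
    fun β => Finset.aestronglyMeasurable_fun_sum _ fun k _ =>
      (h.aemeasurable _ (hu k)).aestronglyMeasurable.const_mul _
  have h1 : Filter.Tendsto (fun t => ∫ ω, Φ (fun k => X (u k) ω) *
      gaussSign (∑ k, regSlope u t k * X (u k) ω) ∂P) (nhdsWithin (-1) (Set.Ioi (-1)))
      (nhds (∫ ω, Φ (fun k => X (u k) ω) * gaussSign (∑ k, regSlope u (-1) k * X (u k) ω) ∂P)) := by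
    refine tendsto_integral_filter_of_dominated_convergence (fun ω => |Φ fun k => X (u k) ω|) ?_ ?_
      hint.abs ?_
    · refine Filter.Eventually.of_forall fun t => hint.aestronglyMeasurable.mul ?_
      exact continuous_gaussSign.comp_aestronglyMeasurable (hmS _)
    · refine Filter.Eventually.of_forall fun t => Filter.Eventually.of_forall fun ω => ?_
      rw [norm_mul]
      exact mul_le_of_le_one_right (norm_nonneg _) (abs_gaussSign_le _)
    · refine Filter.Eventually.of_forall fun ω => Filter.Tendsto.const_mul _ ?_
      refine (continuous_gaussSign.tendsto _).comp (tendsto_finsetSum _ fun k _ => ?_)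
      exact ((continuousAt_regSlope hne k).tendsto.mono_left nhdsWithin_le_nhds).mul_const _
  have h2 : ∀ k, regSlope u (-1) k = 0 := fun k => by simp [regSlope]
  simp only [h2, zero_mul, Finset.sum_const_zero, gaussSign_zero, mul_zero, integral_zero] at h1
  refine squeeze_zero_norm' ?_ (tendsto_norm_zero.comp h1)
  filter_upwards [hnhds] with t ht
  rw [h.integral_mul_sign hu hinj ht.1 ht.2 hΦ hint, norm_mul]
  exact mul_le_of_le_one_left (norm_nonneg _) (Real.abs_sign_le_one _)

end IsSzegoProcess

/-! ### The kernel `K`: skew symmetry, derivatives, behaviour at `-1`. -/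

section Kernel

variable {s t : ℝ}

theorem K_apply_zero_zero (s t : ℝ) :
    K s t 0 0 = (s - t) / (√((1 - s ^ 2) * (1 - t ^ 2)) * (1 - s * t) ^ 2) := rfl

theorem K_apply_zero_one (s t : ℝ) :
    K s t 0 1 = √((1 - t ^ 2) / (1 - s ^ 2)) * (1 / (1 - s * t)) := rfl

theorem K_apply_one_zero (s t : ℝ) :
    K s t 1 0 = -(√((1 - s ^ 2) / (1 - t ^ 2)) * (1 / (1 - s * t))) := rfl

theorem K_apply_one_one (s t : ℝ) :
    K s t 1 1 = Real.sign (t - s) * Real.arcsin (c s t) := rfl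

theorem K_skew (s t : ℝ) (p q : Fin 2) : K s t p q = -K t s q p := by
  have hc : c s t = c t s := by rw [c, c, sigma_comm, mul_comm (sigma s s)]
  have hs : Real.sign (t - s) = -Real.sign (s - t) := by rw [← Real.sign_neg, neg_sub]
  have h2 : (1 - s * t) = 1 - t * s := by ring
  have h3 : (1 - s ^ 2) * (1 - t ^ 2) = (1 - t ^ 2) * (1 - s ^ 2) := by ring
  have h4 : s - t = -(t - s) := by ring
  fin_cases p <;> fin_cases q
  · simp [K, h2, h3]
    rw [← neg_div, ← h4]
  · simp [K, h2]
  · simp [K, h2]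
  · simp [K, hc, hs]

theorem c_eq (hs : s ∈ Set.Ioo (-1 : ℝ) 1) (ht : t ∈ Set.Ioo (-1 : ℝ) 1) :
    c s t = √(1 - s ^ 2) * √(1 - t ^ 2) / (1 - s * t) := by
  have h1 := sqrt_sigma_mul_sqrt hs
  have h2 := sqrt_sigma_mul_sqrt ht
  rw [c, Real.sqrt_mul (sigma_self_pos hs).le, sigma]
  have h3 := (one_sub_mul_pos hs ht).ne'
  have h4 : √(sigma s s) ≠ 0 := left_ne_zero_of_mul_eq_one h1
  have h5 : √(sigma t t) ≠ 0 := left_ne_zero_of_mul_eq_one h2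
  field_simp
  linear_combination (-1 : ℝ) * h1 - √(sigma s s) * √(1 - s ^ 2) * h2

theorem K_zero_one (hs : s ∈ Set.Ioo (-1 : ℝ) 1) (ht : t ∈ Set.Ioo (-1 : ℝ) 1) :
    K s t 0 1 = √(sigma s s) * (sigma s t * √(1 - t ^ 2)) := by
  have h1 := sqrt_sigma_mul_sqrt hs
  have h2 : √(1 - s ^ 2) ≠ 0 := right_ne_zero_of_mul_eq_one h1
  rw [K_apply_zero_one, Real.sqrt_div (one_sub_sq_pos ht).le, eq_div_of_mul_eq h2 h1, sigma]
  ring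

theorem hasDerivAt_K_one_one (hs : s ∈ Set.Ioo (-1 : ℝ) 1) (ht : t ∈ Set.Ioo (-1 : ℝ) 1)
    (hst : s ≠ t) : HasDerivAt (fun s => K s t 1 1) (K s t 0 1) s := by
  have h1 := one_sub_mul_pos hs ht
  have h2 := one_sub_sq_pos hs
  have h3 := one_sub_sq_pos ht
  have hS := Real.sqrt_pos.2 h2
  have hS2 := Real.sq_sqrt h2.le
  have hT2 := Real.sq_sqrt h3.le
  have hT := Real.sqrt_pos.2 h3
  have hd : t - s ≠ 0 := sub_ne_zero.2 hst.symm
  have hEq : (fun s => K s t 1 1) =ᶠ[nhds s] fun r => Real.sign (t - s) *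
      Real.arcsin (√(1 - r ^ 2) * √(1 - t ^ 2) / (1 - r * t)) := by
    have hc : ContinuousAt (fun r : ℝ => t - r) s := by fun_prop
    filter_upwards [Real.sign_eventuallyEq hc hd, Ioo_mem_nhds hs.1 hs.2] with r hr hr'
    rw [K_apply_one_one, ← c_eq hr' ht, hr]
  refine HasDerivAt.congr_of_eventuallyEq ?_ hEq
  set C := √(1 - s ^ 2) * √(1 - t ^ 2) / (1 - s * t) with hC
  -- The square root in the derivative of arcsine thus becomes `|t - s| / (1 - s t)`, and the sign
  -- in the kernel removes the absolute value.
  have hC2 : 1 - C ^ 2 = ((t - s) / (1 - s * t)) ^ 2 := by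
    rw [hC, div_pow, mul_pow, hS2, hT2]
    field_simp
    ring
  have hpos : 0 < 1 - C ^ 2 := by
    rw [hC2]
    positivity
  have hne : C ≠ -1 ∧ C ≠ 1 := ⟨fun h => by simp [h] at hpos, fun h => by simp [h] at hpos⟩
  have d1 : HasDerivAt (fun r : ℝ => 1 - r ^ 2) (-(2 * s)) s :=
    ((hasDerivAt_pow 2 s).const_sub 1).congr_deriv (by simp)
  have d2 : HasDerivAt (fun r : ℝ => 1 - r * t) (-t) s :=
    (((hasDerivAt_id s).mul_const t).const_sub 1).congr_deriv (by simp)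
  have d3 := ((d1.sqrt h2.ne').mul_const √(1 - t ^ 2)).div d2 h1.ne'
  have d4 := ((Real.hasDerivAt_arcsin hne.1 hne.2).comp s d3).const_mul (Real.sign (t - s))
  refine d4.congr_deriv ?_
  rw [hC2, Real.sqrt_sq_eq_abs, abs_div, abs_of_pos h1, ← Real.self_mul_sign_eq_abs,
    K_zero_one hs ht]
  have hss : Real.sign (t - s) ≠ 0 := by rwa [Ne, Real.sign_eq_zero_iff]
  have hσ : √(sigma s s) = 1 / √(1 - s ^ 2) := by
    rw [eq_div_iff hS.ne', sqrt_sigma_mul_sqrt hs]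
  rw [hσ, sigma]
  field_simp
  rw [hS2]
  ring

theorem hasDerivAt_K_one_zero (hs : s ∈ Set.Ioo (-1 : ℝ) 1) (ht : t ∈ Set.Ioo (-1 : ℝ) 1) :
    HasDerivAt (fun s => K s t 1 0) (K s t 0 0) s := by
  have h1 := one_sub_mul_pos hs ht
  have h2 := one_sub_sq_pos hs
  have h3 := one_sub_sq_pos ht
  have hS := Real.sqrt_pos.2 h2
  have hS2 := Real.sq_sqrt h2.le
  have hT := Real.sqrt_pos.2 h3
  have hEq : (fun s => K s t 1 0) = fun r => -(√(1 - r ^ 2) / (√(1 - t ^ 2) * (1 - r * t))) := by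
    funext r
    rw [K_apply_one_zero, Real.sqrt_div' _ h3.le, div_mul_div_comm, mul_one]
  rw [hEq]
  have d1 : HasDerivAt (fun r : ℝ => 1 - r ^ 2) (-(2 * s)) s :=
    ((hasDerivAt_pow 2 s).const_sub 1).congr_deriv (by simp)
  have d2 : HasDerivAt (fun r : ℝ => √(1 - t ^ 2) * (1 - r * t)) (√(1 - t ^ 2) * -t) s :=
    ((((hasDerivAt_id s).mul_const t).const_sub 1).const_mul _).congr_deriv (by simp)
  have d3 := ((d1.sqrt h2.ne').div d2 (mul_pos hT h1).ne').neg
  refine d3.congr_deriv ?_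
  rw [K_apply_zero_zero, Real.sqrt_mul h2.le]
  field_simp
  rw [hS2]
  ring

theorem hasDerivAt_K (hs : s ∈ Set.Ioo (-1 : ℝ) 1) (ht : t ∈ Set.Ioo (-1 : ℝ) 1)
    (hst : s ≠ t) (q : Fin 2) : HasDerivAt (fun s => K s t 1 q) (K s t 0 q) s := by
  fin_cases q
  · exact hasDerivAt_K_one_zero hs ht
  · exact hasDerivAt_K_one_one hs ht hst

theorem tendsto_K_one_one (ht : t ∈ Set.Ioo (-1 : ℝ) 1) :
    Filter.Tendsto (fun s => K s t 1 1) (nhdsWithin (-1) (Set.Ioi (-1))) (nhds 0) := by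
  have h1 : Filter.Tendsto (fun s : ℝ => Real.arcsin (√(1 - s ^ 2) * √(1 - t ^ 2) / (1 - s * t)))
      (nhdsWithin (-1) (Set.Ioi (-1))) (nhds 0) := by
    have hne : (1 - (-1) * t) ≠ 0 := by have := ht.1; linarith
    have hc : ContinuousAt (fun s : ℝ => Real.arcsin (√(1 - s ^ 2) * √(1 - t ^ 2) / (1 - s * t)))
        (-1) :=
      Real.continuous_arcsin.continuousAt.comp (ContinuousAt.div (by fun_prop) (by fun_prop) hne)
    have := hc.tendsto.mono_left (nhdsWithin_le_nhds (s := Set.Ioi (-1)))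
    simpa using this
  refine squeeze_zero_norm' ?_ (tendsto_norm_zero.comp h1)
  filter_upwards [Ioo_mem_nhdsGT (show (-1 : ℝ) < 1 by norm_num)] with s hs
  rw [K_apply_one_one, norm_mul, c_eq hs ht]
  exact mul_le_of_le_one_left (norm_nonneg _) (Real.abs_sign_le_one _)

end Kernel

/-! ### Sign moments. -/

/-- Exactly `j` of the points lie to the left of `u j`, each giving a negative Möbius factor. -/
theorem prod_sign_succAbove {N : ℕ} {u : Fin (N + 1) → ℝ} (hu : ∀ i, u i ∈ Set.Ioo (-1 : ℝ) 1)
    (hmono : StrictMono u) (j : Fin (N + 1)) :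
    ∏ k, Real.sign (mob (u j) (u (j.succAbove k))) = (-1) ^ (j : ℕ) := by
  have h1 : ∀ k : Fin N, Real.sign (mob (u j) (u (j.succAbove k))) =
      if (k : ℕ) < j then -1 else 1 := by
    intro k
    have hp := one_sub_mul_pos (hu j) (hu (j.succAbove k))
    split_ifs with hk
    · have h2 : j.succAbove k < j := Fin.succAbove_lt_iff_castSucc_lt j k |>.2 hk
      exact Real.sign_of_neg (div_neg_of_neg_of_pos (sub_neg.2 (hmono h2)) hp)
    · have h2 : j < j.succAbove k :=
        Fin.lt_succAbove_iff_le_castSucc j k |>.2 (not_lt.1 hk)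
      exact Real.sign_of_pos (div_pos (sub_pos.2 (hmono h2)) hp)
  simp_rw [h1]
  rw [Fin.prod_univ_eq_prod_range (fun k => if k < (j : ℕ) then (-1 : ℝ) else 1) N,
    Finset.prod_ite, Finset.prod_const, Finset.prod_const_one, mul_one]
  congr 1
  have : (Finset.range N).filter (fun k => k < (j : ℕ)) = Finset.range j := by
    ext k
    simp only [Finset.mem_filter, Finset.mem_range]
    have := j.2
    omega
  rw [this, Finset.card_range]

/-- The expectation of the product of the signs of the values at the points `u k`. -/
noncomputable def signMoment {Ω : Type*} [MeasurableSpace Ω] (X : ℝ → Ω → ℝ) (P : Measure Ω) {N : ℕ}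
    (u : Fin N → ℝ) : ℝ :=
  ∫ ω, ∏ k, Real.sign (X (u k) ω) ∂P

theorem measurable_prod_sign {ι : Type} [Fintype ι] :
    Measurable fun y : ι → ℝ => ∏ k, Real.sign (y k) :=
  Finset.measurable_fun_prod _ fun k _ => Real.measurable_real_sign.comp (measurable_pi_apply k)

theorem abs_prod_sign_le {ι : Type} [Fintype ι] (y : ι → ℝ) : |∏ k, Real.sign (y k)| ≤ 1 := by
  rw [Finset.abs_prod]
  exact Finset.prod_le_one (fun _ _ => abs_nonneg _) fun _ _ => Real.abs_sign_le_one _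

namespace IsSzegoProcess

variable {Ω : Type*} [MeasurableSpace Ω] {X : ℝ → Ω → ℝ} {P : Measure Ω} [IsProbabilityMeasure P]
  (h : IsSzegoProcess X P)

include h in
theorem memLp {x : ℝ} (hx : x ∈ Set.Ioo (-1 : ℝ) 1) {p : ENNReal} (hp : p ≠ ⊤) :
    MemLp (X x) p P := by
  have h1 := memLp_id_gaussianReal' (μ := 0) (v := (sigma x x).toNNReal) p hp
  rw [← h.map_eq_gaussianReal hx,
    memLp_map_measure_iff aestronglyMeasurable_id (h.aemeasurable x hx)] at h1
  exact h1

include h in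
theorem integrable_prod {ι : Type} (s : Finset ι) {u : ι → ℝ}
    (hu : ∀ i, u i ∈ Set.Ioo (-1 : ℝ) 1) : Integrable (fun ω => ∏ i ∈ s, X (u i) ω) P := by
  -- Hölder's inequality with every exponent equal to `card + 1`, which stays positive for the empty
  -- product and makes the exponents' reciprocals sum to at most `1`.
  have h1 : MemLp (fun ω => ∏ i ∈ s, X (u i) ω) (∑ i ∈ s, ((s.card : ENNReal) + 1)⁻¹)⁻¹ P :=
    MemLp.prod' fun i _ => h.memLp (hu i) (by simp)
  refine h1.integrable ?_
  rw [ENNReal.one_le_inv, Finset.sum_const, nsmul_eq_mul]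
  calc (s.card : ENNReal) * ((s.card : ENNReal) + 1)⁻¹
      ≤ ((s.card : ENNReal) + 1) * ((s.card : ENNReal) + 1)⁻¹ := by gcongr; exact le_self_add
    _ ≤ 1 := ENNReal.mul_inv_le_one _

variable {ι : Type} [Fintype ι] [DecidableEq ι]

omit [DecidableEq ι] in
include h in
theorem integrable_prod_sign {u : ι → ℝ} (hu : ∀ i, u i ∈ Set.Ioo (-1 : ℝ) 1) :
    Integrable (fun ω => ∏ k, Real.sign (X (u k) ω)) P :=
  (integrable_const (1 : ℝ)).mono'
    (measurable_prod_sign.comp_aemeasurable (h.aemeasurable_pi hu)).aestronglyMeasurable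
    (Filter.Eventually.of_forall fun _ => abs_prod_sign_le _)

omit [DecidableEq ι] in
include h in
theorem integrable_prod_sign_mul {u : ι → ℝ} (hu : ∀ i, u i ∈ Set.Ioo (-1 : ℝ) 1) (k : ι) :
    Integrable (fun ω => (∏ k, Real.sign (X (u k) ω)) * X (u k) ω) P := by
  have h1 := (h.memLp (hu k) (p := 1) (by simp)).integrable le_rfl
  refine h1.abs.mono' ((h.integrable_prod_sign hu).aestronglyMeasurable.mul h1.aestronglyMeasurable)
    (Filter.Eventually.of_forall fun ω => ?_)
  rw [norm_mul]
  exact mul_le_of_le_one_left (norm_nonneg _) (abs_prod_sign_le _)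

/-- The inverse of the covariance matrix at the points `u i`. -/
noncomputable def precision {N : ℕ} (u : Fin (N + 1) → ℝ) :
    Matrix (Fin (N + 1)) (Fin (N + 1)) ℝ :=
  Matrix.of fun j => (residual (fun k => u (j.succAbove k)) (u j) ^ 2)⁻¹ •
    (Fin.insertNth (α := fun _ => ℝ) j 1 fun k => -regCoeff (fun k => u (j.succAbove k)) (u j) k)

theorem precision_mulVec {N : ℕ} (u y : Fin (N + 1) → ℝ) (j : Fin (N + 1)) :
    (precision u).mulVec y j = (residual (fun k => u (j.succAbove k)) (u j) ^ 2)⁻¹ *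
      (y j - ∑ k, regCoeff (fun k => u (j.succAbove k)) (u j) k * y (j.succAbove k)) := by
  simp only [Matrix.mulVec, dotProduct, precision, Matrix.of_apply, Pi.smul_apply, smul_eq_mul]
  rw [Fin.sum_univ_succAbove _ j, mul_sub, Finset.mul_sum, sub_eq_add_neg, ← Finset.sum_neg_distrib]
  congr 1
  · simp
  · refine Finset.sum_congr rfl fun k _ => ?_
    simp
    ring

variable {N : ℕ} {u : Fin (N + 1) → ℝ} {x : ℝ} (hu : ∀ i, u i ∈ Set.Ioo (-1 : ℝ) 1)
  (hinj : Function.Injective u)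

include hu hinj in
-- Row `j` of the inverse forms the residual of point `j` on the others, divided by its variance.
-- The residual is uncorrelated with those others.
theorem precision_mul_Sigma : precision u * Sigma u = 1 := by
  ext j l
  have h1 : (precision u * Sigma u) j l = (precision u).mulVec (fun i => sigma (u i) (u l)) j := rfl
  have hu' : ∀ k, u (j.succAbove k) ∈ Set.Ioo (-1 : ℝ) 1 := fun k => hu _
  have hinj' : Function.Injective fun k => u (j.succAbove k) :=
    hinj.comp Fin.succAbove_right_injective
  have hne : ∀ k, u j ≠ u (j.succAbove k) := fun k hk => (Fin.succAbove_ne j k).symm (hinj hk)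
  rw [h1, precision_mulVec]
  rcases eq_or_ne l j with rfl | hl
  · have h2 := residual_ne_zero hu' (hu l) hne
    rw [sum_regCoeff_mul_sigma_self hu' hinj' (hu l) hne, Matrix.one_apply_eq,
      inv_mul_eq_iff_eq_mul₀ (pow_ne_zero 2 h2), residual, mul_pow,
      Real.sq_sqrt (sigma_self_pos (hu l)).le]
    ring
  · obtain ⟨k, rfl⟩ := Fin.exists_succAbove_eq hl
    rw [sum_regCoeff_mul_sigma hu' hinj' (hu j) hne, Matrix.one_apply_ne hl.symm]
    ring

include h hu hinj in
-- Row `j` isolates the residual at `u j`, so only `sgn X(u j)` interacts with it. The tilt then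
-- turns the remaining signs into themselves times signs of Möbius factors.
theorem precision_mulVec_integral (j : Fin (N + 1)) :
    (precision u).mulVec (fun i => ∫ ω, (∏ k, Real.sign (X (u k) ω)) * X (u i) ω ∂P) j =
      √(2 / Real.pi) * √(1 - u j ^ 2) * (∏ k, Real.sign (mob (u j) (u (j.succAbove k)))) *
        signMoment X P fun k => u (j.succAbove k) := by
  have hu' : ∀ k, u (j.succAbove k) ∈ Set.Ioo (-1 : ℝ) 1 := fun k => hu _
  have hinj' : Function.Injective fun k => u (j.succAbove k) :=
    hinj.comp Fin.succAbove_right_injective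
  have hne : ∀ k, u j ≠ u (j.succAbove k) := fun k hk => (Fin.succAbove_ne j k).symm (hinj hk)
  have h1 := h.integral_mul_residual_mul_sign hu' hinj' (hu j) hne measurable_prod_sign abs_prod_sign_le
  rw [precision_mulVec]
  have h2 : (∫ ω, (∏ k, Real.sign (X (u k) ω)) * X (u j) ω ∂P) -
      ∑ k, regCoeff (fun k => u (j.succAbove k)) (u j) k *
        ∫ ω, (∏ k, Real.sign (X (u k) ω)) * X (u (j.succAbove k)) ω ∂P =
      ∫ ω, (∏ k, Real.sign (X (u (j.succAbove k)) ω)) * ((X (u j) ω -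
        ∑ k, regCoeff (fun k => u (j.succAbove k)) (u j) k * X (u (j.succAbove k)) ω) *
          Real.sign (X (u j) ω)) ∂P := by
    simp_rw [← integral_const_mul]
    rw [← integral_finsetSum _ fun k _ => (h.integrable_prod_sign_mul hu _).const_mul _,
      ← integral_sub (h.integrable_prod_sign_mul hu _)
        (integrable_finsetSum _ fun k _ => (h.integrable_prod_sign_mul hu _).const_mul _)]
    refine integral_congr_ae (Filter.Eventually.of_forall fun ω => ?_)
    dsimp only
    have h3 : ∑ k, regCoeff (fun k => u (j.succAbove k)) (u j) k *
        ((∏ k, Real.sign (X (u k) ω)) * X (u (j.succAbove k)) ω) = (∏ k, Real.sign (X (u k) ω)) *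
          ∑ k, regCoeff (fun k => u (j.succAbove k)) (u j) k * X (u (j.succAbove k)) ω := by
      rw [Finset.mul_sum]
      exact Finset.sum_congr rfl fun k _ => by ring
    rw [h3, Fin.prod_univ_succAbove _ j]
    ring
  rw [h2, h1]
  simp_rw [Real.sign_mul_sign, Finset.prod_mul_distrib]
  rw [integral_const_mul, signMoment]
  have hB := blaschke_ne_zero hu' (hu j) hne
  have hB' : |blaschke (fun k => u (j.succAbove k)) (u j)| ≠ 0 := abs_ne_zero.2 hB
  have h4 := sqrt_sigma_mul_sqrt (hu j)
  have h5 : √(sigma (u j) (u j)) ≠ 0 := left_ne_zero_of_mul_eq_one h4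
  rw [← sq_abs (residual _ _), residual, abs_mul, abs_of_nonneg (Real.sqrt_nonneg _),
    eq_div_of_mul_eq h5 ((mul_comm _ _).trans h4)]
  field_simp

include h hu hinj in
-- This is Gaussian integration by parts, `E[G X(x)] = ∑ σ(x, u j) E[∂_j G]`, where `∂_j` of a
-- product of signs is concentrated on `X (u j) = 0`. The inverse covariance matrix replaces
-- distributional derivatives.
theorem integral_prod_sign_mul (hx : x ∈ Set.Ioo (-1 : ℝ) 1) (hxu : ∀ i, x ≠ u i) :
    ∫ ω, (∏ k, Real.sign (X (u k) ω)) * X x ω ∂P = ∑ j, sigma x (u j) * (√(2 / Real.pi) *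
      √(1 - u j ^ 2) * (∏ k, Real.sign (mob (u j) (u (j.succAbove k)))) *
        signMoment X P fun k => u (j.succAbove k)) := by
  have h1 := h.integral_mul_self hu hinj hx hxu measurable_prod_sign (h.integrable_prod_sign hu)
    (h.integrable_prod_sign_mul hu)
  set E : Fin (N + 1) → ℝ := fun i => ∫ ω, (∏ k, Real.sign (X (u k) ω)) * X (u i) ω ∂P with hE
  have h2 : ∫ ω, (∏ k, Real.sign (X (u k) ω)) * ∑ k, regCoeff u x k * X (u k) ω ∂P =
      ∑ k, regCoeff u x k * E k := by
    simp_rw [hE, ← integral_const_mul]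
    rw [← integral_finsetSum _ fun k _ => (h.integrable_prod_sign_mul hu _).const_mul _]
    refine integral_congr_ae (Filter.Eventually.of_forall fun ω => ?_)
    dsimp only
    rw [Finset.mul_sum]
    exact Finset.sum_congr rfl fun k _ => by ring
  have h3 : (Sigma u).mulVec ((precision u).mulVec E) = E := by
    rw [Matrix.mulVec_mulVec, mul_eq_one_comm.1 (precision_mul_Sigma hu hinj), Matrix.one_mulVec]
  simp_rw [← h.precision_mulVec_integral hu hinj]
  set T := (precision u).mulVec E with hT
  have h4 : ∀ k, E k = ∑ j, sigma (u k) (u j) * T j := fun k => (congrFun h3 k).symm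
  rw [h1, h2]
  simp_rw [h4, ← sum_regCoeff_mul_sigma hu hinj hx hxu, Finset.mul_sum, Finset.sum_mul]
  rw [Finset.sum_comm]
  exact Finset.sum_congr rfl fun j _ => Finset.sum_congr rfl fun k _ => by ring

end IsSzegoProcess

namespace IsSzegoProcess

variable {Ω : Type*} [MeasurableSpace Ω] {X : ℝ → Ω → ℝ} {P : Measure Ω} [IsProbabilityMeasure P]
  (h : IsSzegoProcess X P)

theorem signMoment_cons (X : ℝ → Ω → ℝ) (P : Measure Ω) {N : ℕ} (v : Fin N → ℝ) (t : ℝ) :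
    signMoment X P (Fin.cons t v : Fin (N + 1) → ℝ) =
      ∫ ω, (∏ k, Real.sign (X (v k) ω)) * Real.sign (X t ω) ∂P := by
  simp only [signMoment, Fin.prod_univ_succ, Fin.cons_zero, Fin.cons_succ, mul_comm]

include h in
-- With `t` to the left of every `v k` all Möbius factors are positive, so the constant `c` is `1`.
theorem hasDerivAt_signMoment_cons {N : ℕ} {v : Fin (N + 1) → ℝ}
    (hv : ∀ i, v i ∈ Set.Ioo (-1 : ℝ) 1) (hmono : StrictMono v) {t : ℝ} (ht : -1 < t)
    (htv : t < v 0) :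
    HasDerivAt (fun t => signMoment X P (Fin.cons t v : Fin (N + 2) → ℝ))
      (√(2 / Real.pi) ^ 2 * ∑ j : Fin (N + 1), (-1) ^ (j : ℕ) * K t (v j) 0 1 *
        signMoment X P fun k => v (j.succAbove k)) t := by
  have htI : t ∈ Set.Ioo (-1 : ℝ) 1 := ⟨ht, htv.trans (hv 0).2⟩
  have htv' : ∀ i, t < v i := fun i => htv.trans_le (hmono.monotone (Fin.zero_le i))
  have hc : ∀ y : Fin (N + 1) → ℝ, ∏ k, Real.sign (mob t (v k) * y k) =
      1 * ∏ k, Real.sign (y k) := by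
    intro y
    rw [one_mul]
    refine Finset.prod_congr rfl fun k _ => ?_
    rw [Real.sign_mul_sign, mob, Real.sign_of_pos
      (div_pos (sub_pos.2 (htv' k)) (one_sub_mul_pos htI (hv k))), one_mul]
  have h1 := h.hasDerivAt_integral_mul_sign hv hmono.injective htI (fun i => (htv' i).ne)
    measurable_prod_sign (h.integrable_prod_sign hv) (h.integrable_prod_sign_mul hv) hc
  simp_rw [signMoment_cons X P v]
  refine h1.congr_deriv ?_
  rw [h.integral_prod_sign_mul hv hmono.injective htI (fun i => (htv' i).ne), one_mul,
    Finset.mul_sum, Finset.mul_sum]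
  refine Finset.sum_congr rfl fun j _ => ?_
  rw [prod_sign_succAbove hv hmono, K_zero_one htI (hv j)]
  ring

include h in
-- By induction in steps of two, moment and Pfaffian have the same derivative in the leftmost point,
-- and both tend to `0` as it tends to `-1`.
theorem signMoment_eq {N : ℕ} {u : Fin N → ℝ} (hu : ∀ i, u i ∈ Set.Ioo (-1 : ℝ) 1)
    (hmono : StrictMono u) : signMoment X P u =
      √(2 / Real.pi) ^ N * pfRec N (Matrix.of fun i j => K (u i) (u j) 1 1) := by
  induction N using Nat.twoStepInduction with
  | zero => simp [signMoment, pfRec]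
  | one =>
    have hu' : ∀ i : Fin 0, (Fin.elim0 i : ℝ) ∈ Set.Ioo (-1 : ℝ) 1 := fun i => i.elim0
    -- Regression on the empty family: the slope sum is `0`, so the mean sign is `gaussSign 0`.
    have h1 := h.integral_mul_sign (Φ := fun _ => 1) hu' (fun i => i.elim0) (hu 0)
      (fun i => i.elim0) measurable_const (integrable_const _)
    simpa [signMoment, pfRec, gaussSign_zero] using h1
  | more N ih _ =>
    set v : Fin (N + 1) → ℝ := Fin.tail u with hv
    have hvI : ∀ i, v i ∈ Set.Ioo (-1 : ℝ) 1 := fun i => hu _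
    have hvm : StrictMono v := fun i j hij => hmono (Fin.succ_lt_succ_iff.2 hij)
    set g : ℝ → ℝ := fun t => √(2 / Real.pi) ^ (N + 2) *
      ∑ j : Fin (N + 1), (-1) ^ (j : ℕ) * K t (v j) 1 1 *
        pfRec N (Matrix.of fun i k => K (v (j.succAbove i)) (v (j.succAbove k)) 1 1) with hg
    have hpf : √(2 / Real.pi) ^ (N + 2) *
        pfRec (N + 2) (Matrix.of fun i j => K (u i) (u j) 1 1) = g (u 0) := rfl
    set D : ℝ → ℝ := fun t => signMoment X P (Fin.cons t v : Fin (N + 2) → ℝ) - g t with hD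
    have hderiv : ∀ t ∈ Set.Ioo (-1) (v 0), HasDerivAt D 0 t := by
      intro t ht
      have htI : t ∈ Set.Ioo (-1 : ℝ) 1 := ⟨ht.1, ht.2.trans (hvI 0).2⟩
      have h1 := h.hasDerivAt_signMoment_cons hvI hvm ht.1 ht.2
      have h2 : HasDerivAt g (√(2 / Real.pi) ^ (N + 2) *
          ∑ j : Fin (N + 1), (-1) ^ (j : ℕ) * K t (v j) 0 1 *
            pfRec N (Matrix.of fun i k => K (v (j.succAbove i)) (v (j.succAbove k)) 1 1)) t := by
        refine HasDerivAt.const_mul _ (HasDerivAt.fun_sum fun j _ => HasDerivAt.mul_const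
          (HasDerivAt.const_mul _ (hasDerivAt_K_one_one htI (hvI j) ?_)) _)
        exact (ht.2.trans_le (hvm.monotone (Fin.zero_le j))).ne
      refine (h1.sub h2).congr_deriv ?_
      rw [sub_eq_zero, pow_add, mul_comm (_ ^ N), mul_assoc, Finset.mul_sum (a := _ ^ N)]
      congr 1
      refine Finset.sum_congr rfl fun j _ => ?_
      rw [ih (u := fun k => v (j.succAbove k)) (fun _ => hvI _)
        (hvm.comp (Fin.strictMono_succAbove j))]
      ring
    have hlim : Filter.Tendsto D (nhdsWithin (-1) (Set.Ioi (-1))) (nhds 0) := by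
      have h1 := h.tendsto_integral_mul_sign hvI hvm.injective measurable_prod_sign
        (h.integrable_prod_sign hvI)
      have h2 : Filter.Tendsto g (nhdsWithin (-1) (Set.Ioi (-1))) (nhds (√(2 / Real.pi) ^ (N + 2) *
          ∑ j : Fin (N + 1), (-1) ^ (j : ℕ) * 0 *
            pfRec N (Matrix.of fun i k => K (v (j.succAbove i)) (v (j.succAbove k)) 1 1))) := by
        refine Filter.Tendsto.const_mul _ (tendsto_finsetSum _ fun j _ => Filter.Tendsto.mul_const _
          (Filter.Tendsto.const_mul _ (tendsto_K_one_one (hvI j))))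
      simp_rw [← signMoment_cons X P v] at h1
      simpa using h1.sub h2
    have hu0 : u 0 ∈ Set.Ioo (-1) (v 0) := ⟨(hu 0).1, hmono (Fin.succ_pos 0)⟩
    have hconst : ∀ t ∈ Set.Ioo (-1) (v 0), D t = D (u 0) := fun t ht =>
      isOpen_Ioo.is_const_of_deriv_eq_zero isPreconnected_Ioo
        (fun y hy => (hderiv y hy).differentiableAt.differentiableWithinAt)
        (fun y hy => (hderiv y hy).deriv) ht hu0
    have h0 : D (u 0) = 0 := by
      refine tendsto_nhds_unique (tendsto_const_nhds.congr' ?_) hlim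
      filter_upwards [Ioo_mem_nhdsGT (hvI 0).1] with t ht
      exact (hconst t ht).symm
    rw [hpf, ← sub_eq_zero, ← h0, hD]
    simp only [hv, Fin.cons_self_tail]

end IsSzegoProcess

/-! ### Mixed moments of values and signs. -/

theorem prod_sign_ne {M : ℕ} {u : Fin M → ℝ} (hu : ∀ i, u i ∈ Set.Ioo (-1 : ℝ) 1)
    (hmono : StrictMono u) (j : Fin M) :
    ∏ k : {k // k ≠ j}, Real.sign (mob (u j) (u k)) = (-1) ^ (j : ℕ) := by
  cases M with
  | zero => exact j.elim0
  | succ N =>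
    rw [← prod_sign_succAbove hu hmono, ← (finSuccAboveEquiv j).prod_comp]
    rfl

/-- The row of the kernel `K` used for the index `x`: it is `0` at the first members of the pairs
in `J`, and `1` elsewhere. -/
def rowType {n : ℕ} (J : Finset (Fin n)) (x : Fin (n * 2)) : Fin 2 :=
  if (finProdFinEquiv.symm x).1 ∈ J ∧ (finProdFinEquiv.symm x).2 = 0 then 0 else 1

theorem rowType_insert_self {n : ℕ} (J : Finset (Fin n)) (i : Fin n) :
    rowType (insert i J) (finProdFinEquiv (i, 0)) = 0 := by
  simp [rowType]

theorem rowType_of_notMem {n : ℕ} {J : Finset (Fin n)} {i : Fin n} (hi : i ∉ J) (p : Fin 2) :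
    rowType J (finProdFinEquiv (i, p)) = 1 := by
  simp [rowType, hi]

theorem rowType_insert_of_ne {n : ℕ} {J : Finset (Fin n)} {i : Fin n} {x : Fin (n * 2)}
    (hx : x ≠ finProdFinEquiv (i, 0)) : rowType (insert i J) x = rowType J x := by
  obtain ⟨⟨j, p⟩, rfl⟩ := finProdFinEquiv.surjective x
  simp only [rowType, Equiv.symm_apply_apply, Finset.mem_insert]
  congr 1
  have : ¬ (j = i ∧ p = 0) := fun h => hx (by rw [h.1, h.2])
  simp only [eq_iff_iff]
  tauto

theorem rowType_univ {n : ℕ} (i : Fin n) (p : Fin 2) :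
    rowType Finset.univ (finProdFinEquiv (i, p)) = p := by
  simp only [rowType, Equiv.symm_apply_apply, Finset.mem_univ, true_and]
  split_ifs with hp
  · exact hp.symm
  · omega

/-- The identity if `p = 0`, and the sign function if `p = 1`. -/
noncomputable def signIf (p : Fin 2) (y : ℝ) : ℝ := if p = 0 then y else Real.sign y

theorem signIf_mul (p : Fin 2) (x y : ℝ) : signIf p (x * y) = signIf p x * signIf p y := by
  unfold signIf
  split_ifs
  · rfl
  · exact Real.sign_mul_sign x y

theorem signIf_eq (p : Fin 2) (x : ℝ) :
    signIf p x = Real.sign x * if p = 0 then |x| else 1 := by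
  unfold signIf
  split_ifs
  · rw [← Real.self_mul_sign_eq_abs]
    rcases eq_or_ne x 0 with rfl | hx
    · simp
    · rw [mul_left_comm, Real.sign_mul_sign_self hx, mul_one]
  · rw [mul_one]

theorem measurable_signIf (p : Fin 2) : Measurable (signIf p) := by
  unfold signIf
  split_ifs
  · exact measurable_id
  · exact Real.measurable_real_sign

theorem prod_ite_rowType {n : ℕ} (J : Finset (Fin n)) (g : Fin (n * 2) → ℝ) :
    ∏ x, (if rowType J x = 0 then g x else 1) = ∏ j ∈ J, g (finProdFinEquiv (j, 0)) := by
  rw [← finProdFinEquiv.prod_comp, Fintype.prod_prod_type]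
  simp only [Fin.prod_univ_two, rowType, Equiv.symm_apply_apply]
  simp [Finset.prod_ite_mem]

theorem sqrtDet_congr {n : ℕ} {J : Finset (Fin n)} {s s' : Fin n → ℝ} (h : ∀ j ∈ J, s j = s' j) :
    sqrtDet J s = sqrtDet J s' := by
  unfold sqrtDet
  congr 1
  · exact Finset.prod_congr rfl fun i hi => by rw [h i hi]
  · refine Finset.prod_congr rfl fun i hi => Finset.prod_congr rfl fun j hj => ?_
    rw [h i hi, h j (Finset.mem_filter.1 hj).1]

/-- The mixed moment of values at the first members of the pairs in `J` and of signs of values at the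
remaining points. -/
noncomputable def mixedMoment {Ω : Type*} [MeasurableSpace Ω] (X : ℝ → Ω → ℝ) (P : Measure Ω)
    {n : ℕ} (J : Finset (Fin n)) (u : Fin (n * 2) → ℝ) : ℝ :=
  ∫ ω, ∏ x, signIf (rowType J x) (X (u x) ω) ∂P

/-- The matrix of kernels belonging to `mixedMoment`. -/
noncomputable def mixedK {n : ℕ} (J : Finset (Fin n)) (u : Fin (n * 2) → ℝ) :
    Matrix (Fin (n * 2)) (Fin (n * 2)) ℝ :=
  Matrix.of fun x y => K (u x) (u y) (rowType J x) (rowType J y)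

namespace IsSzegoProcess

variable {Ω : Type*} [MeasurableSpace Ω] {X : ℝ → Ω → ℝ} {P : Measure Ω} [IsProbabilityMeasure P]
  (h : IsSzegoProcess X P)

theorem abs_prod_signIf_le {ι : Type} [Fintype ι] (p : ι → Fin 2) (y : ι → ℝ) :
    |∏ k, signIf (p k) (y k)| ≤ |∏ k with p k = 0, y k| := by
  have h1 : ∏ k, signIf (p k) (y k) = (∏ k, Real.sign (y k)) * ∏ k with p k = 0, |y k| := by
    simp_rw [signIf_eq, Finset.prod_mul_distrib, Finset.prod_ite, Finset.prod_const_one, mul_one]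
  rw [h1, abs_mul, Finset.abs_prod _ (fun k => |y k|), Finset.abs_prod _ y]
  simp_rw [abs_abs]
  exact mul_le_of_le_one_left (Finset.prod_nonneg fun _ _ => abs_nonneg _) (abs_prod_sign_le _)

theorem measurable_prod_signIf {ι : Type} [Fintype ι] (p : ι → Fin 2) :
    Measurable fun y : ι → ℝ => ∏ k, signIf (p k) (y k) :=
  Finset.measurable_fun_prod _ fun k _ => (measurable_signIf _).comp (measurable_pi_apply k)

include h in
theorem integrable_prod_signIf {ι : Type} [Fintype ι] (p : ι → Fin 2) {u : ι → ℝ}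
    (hu : ∀ i, u i ∈ Set.Ioo (-1 : ℝ) 1) :
    Integrable (fun ω => ∏ k, signIf (p k) (X (u k) ω)) P :=
  (h.integrable_prod _ hu).abs.mono'
    ((measurable_prod_signIf p).comp_aemeasurable (h.aemeasurable_pi hu)).aestronglyMeasurable
    (Filter.Eventually.of_forall fun _ => abs_prod_signIf_le _ _)

include h in
theorem integrable_prod_signIf_mul {ι : Type} [Fintype ι] (p : ι → Fin 2) {u : ι → ℝ}
    (hu : ∀ i, u i ∈ Set.Ioo (-1 : ℝ) 1) (j : ι) :
    Integrable (fun ω => (∏ k, signIf (p k) (X (u k) ω)) * X (u j) ω) P := by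
  -- The extra factor is a further index `none` of type `0` at `u j`; repeated points are allowed
  -- here.
  have h1 := h.integrable_prod_signIf (fun o : Option ι => o.elim 0 p)
    (u := fun o : Option ι => o.elim (u j) u) (by rintro (_ | k); exacts [hu j, hu k])
  simp only [Fintype.prod_option, Option.elim_none, Option.elim_some] at h1
  refine h1.congr (Filter.Eventually.of_forall fun ω => ?_)
  simp [signIf, mul_comm]

include h in
theorem hasDerivAt_mixedMoment {n : ℕ} {J : Finset (Fin n)} {i : Fin n} (hi : ∀ j ∈ J, i < j)
    {u : Fin (n * 2) → ℝ} (hu : ∀ x, u x ∈ Set.Ioo (-1 : ℝ) 1) (hmono : StrictMono u) :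
    HasDerivAt (fun t => sqrtDet J (fun j => u (finProdFinEquiv (j, 0))) *
        mixedMoment X P J (Function.update u (finProdFinEquiv (i, 0)) t))
      (√(2 / Real.pi) * (sqrtDet (insert i J) (fun j => u (finProdFinEquiv (j, 0))) *
        mixedMoment X P (insert i J) u)) (u (finProdFinEquiv (i, 0))) := by
  have hiJ : i ∉ J := fun h' => lt_irrefl _ (hi i h')
  set x := finProdFinEquiv (i, (0 : Fin 2)) with hx
  have hxJ : rowType J x = 1 := rowType_of_notMem hiJ 0
  have hc : ∀ y : {y // y ≠ x} → ℝ,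
      ∏ k : {y // y ≠ x}, signIf (rowType J k) (mob (u x) (u k) * y k) =
        (∏ j ∈ J, |(u x - u (finProdFinEquiv (j, 0))) / (1 - u x * u (finProdFinEquiv (j, 0)))|) *
          ∏ k : {y // y ≠ x}, signIf (rowType J k) (y k) := by
    intro y
    simp_rw [signIf_mul, Finset.prod_mul_distrib]
    congr 1
    simp_rw [signIf_eq, Finset.prod_mul_distrib]
    -- The first member of pair `i` has the even position `2i`, so an even number of points lies to
    -- its left and the Möbius signs cancel.
    have hev : (-1 : ℝ) ^ ((finProdFinEquiv (i, (0 : Fin 2)) : Fin (n * 2)) : ℕ) = 1 := by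
      simp [finProdFinEquiv]
    rw [prod_sign_ne hu hmono x, hx, hev, one_mul, ← hx]
    have h2 := Fintype.prod_eq_mul_prod_subtype_ne
      (fun y => if rowType J y = 0 then |mob (u x) (u y)| else 1) x
    rw [hxJ, if_neg (by decide), one_mul, prod_ite_rowType] at h2
    rw [← h2]
    refine Finset.prod_congr rfl fun j _ => ?_
    rw [mob, abs_div, abs_div, abs_sub_comm]
  have h1 := h.hasDerivAt_integral_mul_sign (u := fun k : {y // y ≠ x} => u k) (x := u x)
    (Φ := fun y => ∏ k : {y // y ≠ x}, signIf (rowType J k) (y k)) (fun k => hu _)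
    (hmono.injective.comp Subtype.val_injective) (hu x)
    (fun k hk => k.2 (hmono.injective hk).symm)
    (measurable_prod_signIf fun k : {y // y ≠ x} => rowType J k)
    (h.integrable_prod_signIf (fun k : {y // y ≠ x} => rowType J k) fun k => hu _)
    (h.integrable_prod_signIf_mul (fun k : {y // y ≠ x} => rowType J k) fun k => hu _) hc
  have h2 : ∀ t, mixedMoment X P J (Function.update u x t) =
      ∫ ω, (∏ k : {y // y ≠ x}, signIf (rowType J k) (X (u k) ω)) * Real.sign (X t ω) ∂P := by
    intro t
    refine integral_congr_ae (Filter.Eventually.of_forall fun ω => ?_)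
    dsimp only
    rw [Fintype.prod_eq_mul_prod_subtype_ne _ x, mul_comm, hxJ, Function.update_self]
    congr 1
    exact Finset.prod_congr rfl fun k _ => by rw [Function.update_of_ne k.2]
  have h3 : mixedMoment X P (insert i J) u =
      ∫ ω, (∏ k : {y // y ≠ x}, signIf (rowType J k) (X (u k) ω)) * X (u x) ω ∂P := by
    refine integral_congr_ae (Filter.Eventually.of_forall fun ω => ?_)
    dsimp only
    rw [Fintype.prod_eq_mul_prod_subtype_ne _ x, mul_comm, hx, rowType_insert_self]
    congr 1
    exact Finset.prod_congr rfl fun k _ => by rw [rowType_insert_of_ne k.2]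
  simp_rw [h2]
  refine (h1.const_mul _).congr_deriv ?_
  rw [h3, sqrtDet_insert_of_lt _ hi]
  ring

theorem hasDerivAt_pfaffian_mixedK {n : ℕ} {J : Finset (Fin n)} {i : Fin n} (hiJ : i ∉ J)
    {u : Fin (n * 2) → ℝ} (hu : ∀ x, u x ∈ Set.Ioo (-1 : ℝ) 1) (hinj : Function.Injective u) :
    HasDerivAt (fun t => pfaffian (mixedK J (Function.update u (finProdFinEquiv (i, 0)) t)))
      (pfaffian (mixedK (insert i J) u)) (u (finProdFinEquiv (i, 0))) := by
  set x := finProdFinEquiv (i, (0 : Fin 2)) with hx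
  have hxJ : rowType J x = 1 := rowType_of_notMem hiJ 0
  have hxi : rowType (insert i J) x = 0 := rowType_insert_self J i
  have hrow : ∀ y ≠ x, HasDerivAt (fun t => K t (u y) 1 (rowType J y))
      (K (u x) (u y) 0 (rowType J y)) (u x) := fun y hy =>
    hasDerivAt_K (hu x) (hu y) (fun h' => hy (hinj h').symm) _
  refine hasDerivAt_pfaffian x ?_ ?_ ?_
  · intro y hy
    simp only [mixedK, Matrix.of_apply, Function.update_self, Function.update_of_ne hy, hxJ, hxi,
      rowType_insert_of_ne hy]
    exact hrow y hy
  · intro y hy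
    simp only [mixedK, Matrix.of_apply, Function.update_self, Function.update_of_ne hy, hxJ, hxi,
      rowType_insert_of_ne hy]
    simp_rw [K_skew (u y)]
    exact (hrow y hy).neg
  · intro y z hy hz t
    simp only [mixedK, Matrix.of_apply, Function.update_of_ne hy, Function.update_of_ne hz,
      rowType_insert_of_ne hy, rowType_insert_of_ne hz]

/-- The order of the points is an open condition, so an identity for ordered points may be
differentiated in one of them. -/
theorem eventually_strictMono_update {M : ℕ} {u : Fin M → ℝ} (hmono : StrictMono u) (x : Fin M) :
    ∀ᶠ t in nhds (u x), StrictMono (Function.update u x t) := by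
  have h1 : ∀ i j : Fin M, i < j → ∀ᶠ t in nhds (u x),
      Function.update u x t i < Function.update u x t j := by
    intro i j hij
    have hi : ContinuousAt (fun t => Function.update u x t i) (u x) := by fun_prop
    have hj : ContinuousAt (fun t => Function.update u x t j) (u x) := by fun_prop
    refine hi.eventually_lt hj ?_
    simpa using hmono hij
  have h2 : ∀ᶠ t in nhds (u x), ∀ i j : Fin M, i < j →
      Function.update u x t i < Function.update u x t j :=
    Filter.eventually_all.2 fun i => Filter.eventually_all.2 fun j =>
      Filter.eventually_imp_distrib_left.2 (h1 i j)
  exact h2.mono fun t ht i j hij => ht i j hij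

include h in
-- For empty `J` this is `signMoment_eq`. Inserting `i` differentiates both sides in the first point
-- of pair `i`, on which the prefactor `sqrtDet J` does not depend; one factor `√(2/π)` cancels each
-- time.
theorem sqrtDet_mul_mixedMoment {n : ℕ} (J : Finset (Fin n)) {u : Fin (n * 2) → ℝ}
    (hu : ∀ x, u x ∈ Set.Ioo (-1 : ℝ) 1) (hmono : StrictMono u) :
    sqrtDet J (fun j => u (finProdFinEquiv (j, 0))) * mixedMoment X P J u =
      √(2 / Real.pi) ^ (n * 2 - J.card) * pfaffian (mixedK J u) := by
  induction J using Finset.induction_on_min generalizing u with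
  | empty =>
    have h1 := h.signMoment_eq hu hmono
    rw [← pfaffian_eq_pfRec] at h1
    simpa [sqrtDet, mixedMoment, mixedK, signMoment, rowType, signIf] using h1
  | insert i J hi ih =>
    have hiJ : i ∉ J := fun h' => lt_irrefl _ (hi i h')
    set x := finProdFinEquiv (i, (0 : Fin 2)) with hx
    have h1 := h.hasDerivAt_mixedMoment hi hu hmono
    have h2 := (hasDerivAt_pfaffian_mixedK hiJ hu hmono.injective).const_mul
      (√(2 / Real.pi) ^ (n * 2 - J.card))
    rw [← hx] at h1 h2
    have hEq : (fun t => sqrtDet J (fun j => u (finProdFinEquiv (j, 0))) *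
        mixedMoment X P J (Function.update u x t)) =ᶠ[nhds (u x)]
        fun t => √(2 / Real.pi) ^ (n * 2 - J.card) * pfaffian (mixedK J (Function.update u x t)) := by
      filter_upwards [eventually_strictMono_update hmono x, Ioo_mem_nhds (hu x).1 (hu x).2]
        with t ht htI
      rw [← ih (u := Function.update u x t) ?_ ht]
      · congr 1
        refine sqrtDet_congr fun j hj => ?_
        rw [Function.update_of_ne]
        intro h'
        have := finProdFinEquiv.injective h'
        exact (hi j hj).ne' (Prod.ext_iff.1 this).1
      · intro y
        rcases eq_or_ne y x with rfl | hy
        · rwa [Function.update_self]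
        · rw [Function.update_of_ne hy]
          exact hu y
    have h3 := h1.unique (h2.congr_of_eventuallyEq hEq)
    -- This keeps the natural subtraction in the exponent from truncating.
    have hcard : J.card + 1 ≤ n := by
      have := Finset.card_le_univ (insert i J)
      rwa [Finset.card_insert_of_notMem hiJ, Fintype.card_fin] at this
    have hpos : √(2 / Real.pi) ≠ 0 := (Real.sqrt_pos.2 (by positivity)).ne'
    refine mul_left_cancel₀ hpos (h3.trans ?_)
    rw [Finset.card_insert_of_notMem hiJ, ← mul_assoc, ← pow_succ',
      show n * 2 - (J.card + 1) + 1 = n * 2 - J.card by omega]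

end IsSzegoProcess

/-! ### Merging the points of each pair. -/

theorem blockK_apply {n : ℕ} (t : Fin n → ℝ) (i j : Fin n) (p q : Fin 2) :
    blockK t (finProdFinEquiv (i, p)) (finProdFinEquiv (j, q)) = K (t i) (t j) p q := by
  simp [blockK]

theorem blockK_skew {n : ℕ} (t : Fin n → ℝ) (x y : Fin (n * 2)) :
    blockK t x y = -blockK t y x := by
  obtain ⟨⟨i, p⟩, rfl⟩ := finProdFinEquiv.surjective x
  obtain ⟨⟨j, q⟩, rfl⟩ := finProdFinEquiv.surjective y
  rw [blockK_apply, blockK_apply, K_skew]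

/-- Relabelling the points moves whole pairs of rows and columns, which is an even permutation. -/
theorem pfaffian_blockK_comp {n : ℕ} (t : Fin n → ℝ) (π : Equiv.Perm (Fin n)) :
    pfaffian (blockK (t ∘ π)) = pfaffian (blockK t) := by
  have h1 : blockK (t ∘ π) =
      (blockK t).submatrix (pairPerm (fun _ => 1) π) (pairPerm (fun _ => 1) π) := by
    ext x y
    obtain ⟨⟨i, p⟩, rfl⟩ := finProdFinEquiv.surjective x
    obtain ⟨⟨j, q⟩, rfl⟩ := finProdFinEquiv.surjective y
    rw [Matrix.submatrix_apply, pairPerm_apply, pairPerm_apply, blockK_apply, blockK_apply]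
    rfl
  rw [h1, pfaffian_submatrix (blockK_skew t), sign_pairPerm]
  simp

/-- Only the arcsine entry jumps on the diagonal. The case `p ≠ q` covers the off-diagonal entries
of the blocks `K (t i) (t i)`. -/
theorem continuousAt_K {s t : ℝ} (hs : s ∈ Set.Ioo (-1 : ℝ) 1) (ht : t ∈ Set.Ioo (-1 : ℝ) 1)
    {p q : Fin 2} (h : s ≠ t ∨ p ≠ q) :
    ContinuousAt (fun z : ℝ × ℝ => K z.1 z.2 p q) (s, t) := by
  have h1 := (one_sub_mul_pos hs ht).ne'
  have h2 := one_sub_sq_pos hs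
  have h3 := one_sub_sq_pos ht
  have hsqrt : √((1 - s ^ 2) * (1 - t ^ 2)) ≠ 0 := (Real.sqrt_pos.2 (mul_pos h2 h3)).ne'
  have c00 : ContinuousAt (fun z : ℝ × ℝ => K z.1 z.2 0 0) (s, t) := by
    simp only [K_apply_zero_zero]
    exact ContinuousAt.div (by fun_prop) (by fun_prop) (mul_ne_zero hsqrt (pow_ne_zero 2 h1))
  have c01 : ContinuousAt (fun z : ℝ × ℝ => K z.1 z.2 0 1) (s, t) := by
    simp only [K_apply_zero_one]
    refine ContinuousAt.mul (ContinuousAt.sqrt (ContinuousAt.div ?_ ?_ h2.ne'))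
      (ContinuousAt.div ?_ ?_ h1) <;> fun_prop
  have c10 : ContinuousAt (fun z : ℝ × ℝ => K z.1 z.2 1 0) (s, t) := by
    simp only [K_apply_one_zero]
    refine ContinuousAt.neg (ContinuousAt.mul (ContinuousAt.sqrt (ContinuousAt.div ?_ ?_ h3.ne'))
      (ContinuousAt.div ?_ ?_ h1)) <;> fun_prop
  have c11 : s ≠ t → ContinuousAt (fun z : ℝ × ℝ => K z.1 z.2 1 1) (s, t) := by
    intro hst
    have hEq : (fun z : ℝ × ℝ => K z.1 z.2 1 1) =ᶠ[nhds (s, t)] fun z => Real.sign (t - s) *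
        Real.arcsin (√(1 - z.1 ^ 2) * √(1 - z.2 ^ 2) / (1 - z.1 * z.2)) := by
      have hd : ContinuousAt (fun z : ℝ × ℝ => z.2 - z.1) (s, t) := by fun_prop
      have hsgn : ∀ᶠ z in nhds (s, t), Real.sign (z.2 - z.1) = Real.sign (t - s) :=
        hd.eventually (Real.sign_eventuallyEq (f := fun y => y) continuousAt_id
          (sub_ne_zero.2 hst.symm))
      filter_upwards [hsgn, prod_mem_nhds (Ioo_mem_nhds hs.1 hs.2) (Ioo_mem_nhds ht.1 ht.2)]
        with z hz hz'
      rw [K_apply_one_one, c_eq hz'.1 hz'.2, hz]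
    refine ContinuousAt.congr ?_ hEq.symm
    refine continuousAt_const.mul (Real.continuous_arcsin.continuousAt.comp
      (ContinuousAt.div ?_ ?_ h1)) <;> fun_prop
  fin_cases p <;> fin_cases q
  · exact c00
  · exact c01
  · exact c10
  · exact c11 (h.resolve_right (by simp))

theorem K_self (s : ℝ) (p : Fin 2) : K s s p p = 0 := by
  have := K_skew s s p p
  linarith

/-- The points `s i` and `s i + ε`. -/
noncomputable def splitPoints {n : ℕ} (s : Fin n → ℝ) (ε : ℝ) (x : Fin (n * 2)) : ℝ :=
  s (finProdFinEquiv.symm x).1 + ((finProdFinEquiv.symm x).2 : ℕ) * ε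

theorem splitPoints_apply {n : ℕ} (s : Fin n → ℝ) (ε : ℝ) (i : Fin n) (p : Fin 2) :
    splitPoints s ε (finProdFinEquiv (i, p)) = s i + (p : ℕ) * ε := by
  simp [splitPoints]

theorem eventually_splitPoints {n : ℕ} {s : Fin n → ℝ} (hs : ∀ i, s i ∈ Set.Ioo (-1 : ℝ) 1)
    (hmono : StrictMono s) : ∀ᶠ ε in nhdsWithin (0 : ℝ) (Set.Ioi 0),
      (∀ x, splitPoints s ε x ∈ Set.Ioo (-1 : ℝ) 1) ∧ StrictMono (splitPoints s ε) := by
  have h1 : ∀ i, ∀ᶠ ε in nhdsWithin (0 : ℝ) (Set.Ioi 0), s i + ε < 1 := by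
    intro i
    have hc : ContinuousAt (fun ε => s i + ε) 0 := by fun_prop
    exact nhdsWithin_le_nhds (hc.eventually_lt continuousAt_const (by simpa using (hs i).2))
  have h2 : ∀ i j, i < j → ∀ᶠ ε in nhdsWithin (0 : ℝ) (Set.Ioi 0), s i + ε < s j := by
    intro i j hij
    have hc : ContinuousAt (fun ε => s i + ε) 0 := by fun_prop
    exact nhdsWithin_le_nhds (hc.eventually_lt continuousAt_const (by simpa using hmono hij))
  have h3 : ∀ᶠ ε in nhdsWithin (0 : ℝ) (Set.Ioi 0), ∀ i j, i < j → s i + ε < s j :=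
    Filter.eventually_all.2 fun i => Filter.eventually_all.2 fun j =>
      Filter.eventually_imp_distrib_left.2 (h2 i j)
  filter_upwards [Filter.eventually_all.2 h1, h3, self_mem_nhdsWithin] with ε h1 h3 hε
  have hε : 0 < ε := hε
  have hp : ∀ p : Fin 2, 0 ≤ ((p : ℕ) : ℝ) * ε ∧ ((p : ℕ) : ℝ) * ε ≤ ε := by
    intro p
    fin_cases p <;> simp [hε.le]
  constructor
  · intro x
    obtain ⟨⟨i, p⟩, rfl⟩ := finProdFinEquiv.surjective x
    rw [splitPoints_apply]
    have := hp p
    have := h1 i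
    have := (hs i).1
    constructor <;> linarith
  · intro x y hxy
    obtain ⟨⟨i, p⟩, rfl⟩ := finProdFinEquiv.surjective x
    obtain ⟨⟨j, q⟩, rfl⟩ := finProdFinEquiv.surjective y
    rw [splitPoints_apply, splitPoints_apply]
    have hlt : (p : ℕ) + 2 * i < q + 2 * j := hxy
    rcases lt_trichotomy i j with hij | rfl | hij
    · have := h3 i j hij
      have := hp p
      have := hp q
      linarith
    · have hpq : (p : ℕ) < q := by omega
      have : ((p : ℕ) : ℝ) < (q : ℕ) := by exact_mod_cast hpq
      nlinarith
    · have : (j : ℕ) < i := hij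
      omega

theorem tendsto_mixedK {n : ℕ} {s : Fin n → ℝ} (hs : ∀ i, s i ∈ Set.Ioo (-1 : ℝ) 1)
    (hinj : Function.Injective s) : Filter.Tendsto (fun ε => mixedK Finset.univ (splitPoints s ε))
      (nhdsWithin 0 (Set.Ioi 0)) (nhds (blockK s)) := by
  refine tendsto_pi_nhds.2 fun x => tendsto_pi_nhds.2 fun y => ?_
  obtain ⟨⟨i, p⟩, rfl⟩ := finProdFinEquiv.surjective x
  obtain ⟨⟨j, q⟩, rfl⟩ := finProdFinEquiv.surjective y
  simp only [mixedK, Matrix.of_apply, rowType_univ, splitPoints_apply, blockK_apply]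
  by_cases hne : s i ≠ s j ∨ p ≠ q
  · have h1 := (continuousAt_K (hs i) (hs j) hne).tendsto
    have h2 : ContinuousAt (fun ε : ℝ => (s i + ((p : ℕ) : ℝ) * ε, s j + ((q : ℕ) : ℝ) * ε)) 0 := by
      fun_prop
    have h3 := h2.tendsto
    simp only [mul_zero, add_zero] at h3
    exact (h1.comp h3).mono_left nhdsWithin_le_nhds
  -- A diagonal entry of the whole matrix: it is `0` for every `ε`, so the jump of the arcsine entry
  -- does no harm.
  · push Not at hne
    obtain ⟨hij, rfl⟩ := hne
    obtain rfl := hinj hij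
    simp only [K_self]
    exact tendsto_const_nhds

namespace IsSzegoProcess

variable {Ω : Type*} [MeasurableSpace Ω] {X : ℝ → Ω → ℝ} {P : Measure Ω} [IsProbabilityMeasure P]
  (h : IsSzegoProcess X P)

include h in
theorem ae_ne_zero {s : ℝ} (hs : s ∈ Set.Ioo (-1 : ℝ) 1) : ∀ᵐ ω ∂P, X s ω ≠ 0 := by
  have hv : (sigma s s).toNNReal ≠ 0 := by
    rw [Ne, Real.toNNReal_eq_zero, not_le]
    exact sigma_self_pos hs
  have := nullSingletonClass_gaussianReal (μ := 0) hv
  have h1 : ∀ᵐ y ∂P.map (X s), y ≠ 0 := by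
    rw [h.map_eq_gaussianReal hs]
    simp [ae_iff]
  exact ae_of_ae_map (h.aemeasurable s hs) h1

theorem mixedMoment_splitPoints (X : ℝ → Ω → ℝ) (P : Measure Ω) {n : ℕ} (s : Fin n → ℝ) (ε : ℝ) :
    mixedMoment X P Finset.univ (splitPoints s ε) =
      ∫ ω, ∏ i, (X (s i) ω * Real.sign (X (s i + ε) ω)) ∂P := by
  unfold mixedMoment
  simp_rw [← finProdFinEquiv.prod_comp, Fintype.prod_prod_type, Fin.prod_univ_two, rowType_univ,
    splitPoints_apply]
  simp [signIf]

include h in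
-- Almost surely the path is continuous and nonzero at each `s i`, so the sign at `s i + ε` is
-- eventually that at `s i`. The modulus of the product of values dominates.
theorem tendsto_mixedMoment (hcont : ∀ s ∈ Set.Ioo (-1 : ℝ) 1, ∀ᵐ ω ∂P,
      ContinuousAt (fun t => X t ω) s) {n : ℕ} {s : Fin n → ℝ}
    (hs : ∀ i, s i ∈ Set.Ioo (-1 : ℝ) 1) (hmono : StrictMono s) :
    Filter.Tendsto (fun ε => mixedMoment X P Finset.univ (splitPoints s ε))
      (nhdsWithin 0 (Set.Ioi 0)) (nhds (∫ ω, |∏ i, X (s i) ω| ∂P)) := by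
  simp_rw [mixedMoment_splitPoints]
  refine tendsto_integral_filter_of_dominated_convergence (fun ω => |∏ i, X (s i) ω|) ?_ ?_
    (h.integrable_prod _ hs).abs ?_
  · filter_upwards [eventually_splitPoints hs hmono] with ε hε
    refine AEMeasurable.aestronglyMeasurable (Finset.aemeasurable_fun_prod _ fun i _ =>
      (h.aemeasurable _ (hs i)).mul (Real.measurable_real_sign.comp_aemeasurable
        (h.aemeasurable _ ?_)))
    simpa [splitPoints_apply] using hε.1 (finProdFinEquiv (i, 1))
  · refine Filter.Eventually.of_forall fun ε => Filter.Eventually.of_forall fun ω => ?_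
    rw [Finset.prod_mul_distrib, norm_mul]
    exact mul_le_of_le_one_right (norm_nonneg _) (abs_prod_sign_le fun i => X (s i + ε) ω)
  · filter_upwards [ae_all_iff.2 fun i => hcont (s i) (hs i), ae_all_iff.2 fun i => h.ae_ne_zero (hs i)]
      with ω hω hω0
    rw [Finset.abs_prod]
    refine tendsto_finsetProd _ fun i _ => ?_
    rw [← Real.self_mul_sign_eq_abs]
    refine Filter.Tendsto.const_mul _ (tendsto_const_nhds.congr' ?_)
    have h1 : Filter.Tendsto (fun ε => s i + ε) (nhdsWithin 0 (Set.Ioi 0)) (nhds (s i)) := by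
      have : ContinuousAt (fun ε => s i + ε) 0 := by fun_prop
      simpa using this.tendsto.mono_left (nhdsWithin_le_nhds (s := Set.Ioi 0))
    filter_upwards [h1.eventually (Real.sign_eventuallyEq (hω i) (hω0 i))] with ε hε
    exact hε.symm

include h in
theorem integral_abs_prod_of_strictMono (hcont : ∀ s ∈ Set.Ioo (-1 : ℝ) 1, ∀ᵐ ω ∂P,
      ContinuousAt (fun t => X t ω) s) {n : ℕ} {s : Fin n → ℝ}
    (hs : ∀ i, s i ∈ Set.Ioo (-1 : ℝ) 1) (hmono : StrictMono s) :
    sqrtDet Finset.univ s * ∫ ω, |∏ i, X (s i) ω| ∂P =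
      √(2 / Real.pi) ^ n * pfaffian (blockK s) := by
  have h1 := (h.tendsto_mixedMoment hcont hs hmono).const_mul (sqrtDet Finset.univ s)
  have h2 := ((continuous_pfaffian.tendsto _).comp (tendsto_mixedK hs hmono.injective)).const_mul
    (√(2 / Real.pi) ^ n)
  refine tendsto_nhds_unique (h1.congr' ?_) h2
  filter_upwards [eventually_splitPoints hs hmono] with ε hε
  have h3 := h.sqrtDet_mul_mixedMoment Finset.univ hε.1 hε.2
  simp only [splitPoints_apply, Fin.val_zero, Nat.cast_zero, zero_mul, add_zero,
    Finset.card_univ, Fintype.card_fin] at h3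
  rw [h3, show n * 2 - n = n by omega]
  rfl

include h in
-- Both sides are symmetric in the points, so these may be sorted.
theorem integral_abs_prod (hcont : ∀ s ∈ Set.Ioo (-1 : ℝ) 1, ∀ᵐ ω ∂P,
      ContinuousAt (fun t => X t ω) s) {n : ℕ} {t : Fin n → ℝ}
    (ht : ∀ i, t i ∈ Set.Ioo (-1 : ℝ) 1) (hinj : Function.Injective t) :
    ∫ ω, |∏ i, X (t i) ω| ∂P = (2 / Real.pi) ^ ((n : ℝ) / 2) *
      (Sigma t).det ^ (-(1 / 2) : ℝ) * pfaffian (blockK t) := by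
  set π := Tuple.sort t with hπ
  have hmono : StrictMono (t ∘ π) :=
    (Tuple.monotone_sort t).strictMono_of_injective (hinj.comp π.injective)
  have h1 := h.integral_abs_prod_of_strictMono hcont (s := t ∘ π) (fun i => ht _) hmono
  have hdet : (Sigma (t ∘ π)).det = (Sigma t).det :=
    Matrix.det_submatrix_equiv_self π (Sigma t)
  have hpos := sqrtDet_univ_pos (u := t ∘ π) (fun i => ht _) hmono.injective
  have hconst : ((2 : ℝ) / Real.pi) ^ ((n : ℝ) / 2) = √(2 / Real.pi) ^ n := by
    rw [Real.sqrt_eq_rpow, ← Real.rpow_natCast, ← Real.rpow_mul (by positivity)]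
    congr 1
    ring
  rw [← hdet, det_Sigma_rpow (u := t ∘ π) (fun i => ht _) hmono.injective, hconst,
    ← pfaffian_blockK_comp t π,
    mul_right_comm, ← h1, mul_right_comm, mul_inv_cancel₀ hpos.ne', one_mul]
  refine integral_congr_ae (Filter.Eventually.of_forall fun ω => ?_)
  dsimp only
  rw [← Equiv.prod_comp π fun i => X (t i) ω]
  rfl

include h in
theorem covariance_eq {s t : ℝ} (hs : s ∈ Set.Ioo (-1 : ℝ) 1) (ht : t ∈ Set.Ioo (-1 : ℝ) 1) :
    cov[X s, X t; P] = sigma s t := by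
  have hvar : ∀ {x : ℝ}, x ∈ Set.Ioo (-1 : ℝ) 1 → Var[X x; P] = sigma x x := by
    intro x hx
    have h1 := variance_id_gaussianReal (μ := 0) (v := (sigma x x).toNNReal)
    rw [← h.map_eq_gaussianReal hx, variance_map aemeasurable_id (h.aemeasurable x hx)] at h1
    simpa [(sigma_self_pos hx).le] using h1
  rcases eq_or_ne s t with rfl | hst
  · rw [covariance_self (h.aemeasurable s hs), hvar hs]
  · have hL2 : ∀ {x : ℝ}, x ∈ Set.Ioo (-1 : ℝ) 1 → MemLp (X x) 2 P := fun hx => h.memLp hx (by simp)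
    have hmean : ∀ {x : ℝ}, x ∈ Set.Ioo (-1 : ℝ) 1 → ∫ ω, X x ω ∂P = 0 := by
      intro x hx
      have h1 := integral_id_gaussianReal (μ := 0) (v := (sigma x x).toNNReal)
      rw [← h.map_eq_gaussianReal hx, integral_map (h.aemeasurable x hx) (by fun_prop)] at h1
      exact h1
    have hsq : ∫ ω, X t ω * X t ω ∂P = sigma t t := by
      have h1 := hvar ht
      rw [← covariance_self (h.aemeasurable t ht), covariance_eq_sub (hL2 ht) (hL2 ht), hmean ht] at h1
      simpa using h1
    -- Regression on the single point `t` expresses `E[X t X s]` through `E[X t ^ 2]`.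
    have h1 := h.integral_mul_self (ι := Unit) (u := fun _ => t) (x := s) (Φ := fun y => y ())
      (fun _ => ht) (fun _ _ _ => rfl) hs (fun _ => hst) (measurable_pi_apply ())
      ((hL2 ht).integrable (by norm_num)) (fun _ => (hL2 ht).integrable_mul (hL2 ht))
    have h2 := sum_regCoeff_mul_sigma (ι := Unit) (u := fun _ => t) (x := s)
      (fun _ => ht) (fun _ _ _ => rfl) hs (fun _ => hst) ()
    simp only [Finset.univ_unique, Finset.sum_singleton] at h1 h2
    rw [covariance_comm, covariance_eq_sub (hL2 ht) (hL2 hs), hmean ht, zero_mul, sub_zero]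
    simp only [Pi.mul_apply]
    rw [h1, ← h2, ← hsq, ← integral_const_mul]
    refine integral_congr_ae (Filter.Eventually.of_forall fun ω => ?_)
    simp only [PUnit.default_eq_unit]
    ring

end IsSzegoProcess

/-! ### The random power series as a process with Szegő covariance. -/

section PowerSeries

variable {Ω : Type*} [MeasurableSpace Ω] {P : Measure Ω} {a : ℕ → Ω → ℝ}

/-- The expectation of the sum is a geometric series times `E|a 0|`, hence finite. -/
theorem ae_summable_abs_mul_pow (ha : ∀ k, HasLaw (a k) (gaussianReal 0 1) P) {r : ℝ}
    (hr0 : 0 ≤ r) (hr1 : r < 1) : ∀ᵐ ω ∂P, Summable fun k => |a k ω| * r ^ k := by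
  have hint : ∀ k, ∫⁻ ω, ‖a k ω * r ^ k‖ₑ ∂P =
      (∫⁻ x, ‖x‖ₑ ∂gaussianReal 0 1) * ENNReal.ofReal r ^ k := by
    intro k
    simp_rw [enorm_mul]
    rw [lintegral_mul_const'' _ (ha k).aemeasurable.enorm, ← (ha k).map_eq,
      lintegral_map' (by fun_prop) (ha k).aemeasurable, Real.enorm_of_nonneg (pow_nonneg hr0 k),
      ENNReal.ofReal_pow hr0]
  have hC : (∫⁻ x, ‖x‖ₑ ∂gaussianReal 0 1) ≠ ⊤ :=
    ((memLp_id_gaussianReal (μ := 0) (v := 1) 1).integrable le_rfl).2.ne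
  have hfin : ∫⁻ ω, ∑' k, ‖a k ω * r ^ k‖ₑ ∂P ≠ ⊤ := by
    rw [lintegral_tsum fun k => ((ha k).aemeasurable.mul_const _).enorm]
    simp_rw [hint]
    rw [ENNReal.tsum_mul_left, ENNReal.tsum_geometric]
    refine ENNReal.mul_ne_top hC (ENNReal.inv_ne_top.2 (tsub_pos_of_lt ?_).ne')
    simpa using hr1
  filter_upwards [ae_lt_top' (AEMeasurable.tsum fun k =>
    ((ha k).aemeasurable.mul_const _).enorm) hfin] with ω hω
  have h1 : Summable fun k => ‖a k ω * r ^ k‖₊ := ENNReal.tsum_coe_ne_top_iff_summable.1 hω.ne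
  refine (NNReal.summable_coe.2 h1).congr fun k => ?_
  simp [abs_of_nonneg hr0]

theorem ae_summable_mul_pow (ha : ∀ k, HasLaw (a k) (gaussianReal 0 1) P) {t : ℝ}
    (ht : t ∈ Set.Ioo (-1 : ℝ) 1) : ∀ᵐ ω ∂P, Summable fun k => a k ω * t ^ k := by
  filter_upwards [ae_summable_abs_mul_pow ha (abs_nonneg t) (abs_lt.2 ht)] with ω hω
  refine Summable.of_norm (hω.congr fun k => ?_)
  simp

theorem ae_continuousAt (ha : ∀ k, HasLaw (a k) (gaussianReal 0 1) P) {s : ℝ}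
    (hs : s ∈ Set.Ioo (-1 : ℝ) 1) : ∀ᵐ ω ∂P, ContinuousAt (fun t => f a t ω) s := by
  obtain ⟨r, hsr, hr1⟩ := exists_between (abs_lt.2 hs)
  have hr0 : 0 ≤ r := (abs_nonneg s).trans hsr.le
  filter_upwards [ae_summable_abs_mul_pow ha hr0 hr1] with ω hω
  have h1 : ContinuousOn (fun t => f a t ω) (Set.Ioo (-r) r) := by
    refine continuousOn_tsum (fun k => by fun_prop) hω fun k t ht => ?_
    rw [norm_mul, norm_pow, Real.norm_eq_abs, Real.norm_eq_abs]
    exact mul_le_mul_of_nonneg_left (pow_le_pow_left₀ (abs_nonneg t) (abs_lt.2 ht).le k)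
      (abs_nonneg _)
  have h2 := abs_lt.1 hsr
  exact h1.continuousAt (Ioo_mem_nhds h2.1 h2.2)

theorem aemeasurable_f (ha : ∀ k, HasLaw (a k) (gaussianReal 0 1) P) {t : ℝ}
    (ht : t ∈ Set.Ioo (-1 : ℝ) 1) : AEMeasurable (f a t) P := by
  refine aemeasurable_of_tendsto_metrizable_ae Filter.atTop
    (f := fun m ω => ∑ k ∈ Finset.range m, a k ω * t ^ k)
    (fun m => Finset.aemeasurable_fun_sum _ fun k _ => (ha k).aemeasurable.mul_const _) ?_
  filter_upwards [ae_summable_mul_pow ha ht] with ω hω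
  exact hω.hasSum.tendsto_sum_nat

theorem integral_cexp_sum (ha : ∀ k, HasLaw (a k) (gaussianReal 0 1) P) (hindep : iIndepFun a P)
    (c : ℕ → ℝ) (m : ℕ) :
    ∫ ω, Complex.exp (((∑ k ∈ Finset.range m, c k * a k ω : ℝ) : ℂ) * Complex.I) ∂P =
      ((Real.exp (-(∑ k ∈ Finset.range m, c k ^ 2) / 2) : ℝ) : ℂ) := by
  have hm : ∀ k, AEMeasurable (fun ω => c k * a k ω) P := fun k =>
    (ha k).aemeasurable.const_mul _
  have hi : iIndepFun (fun k ω => c k * a k ω) P :=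
    hindep.comp (fun k x => c k * x) fun k => by fun_prop
  have h1 := congrFun ((hi.restrict (Finset.range m)).charFun_map_fun_finsetSum_eq_prod
    (s := Finset.range m) fun k _ => hm k) 1
  rw [charFun_apply_real, integral_map (Finset.aemeasurable_fun_sum _ fun k _ => hm k)
    (by fun_prop), Finset.prod_apply] at h1
  simp only [Complex.ofReal_one, one_mul] at h1
  rw [h1]
  have h2 : ∀ k, charFun (P.map fun ω => c k * a k ω) 1 = Complex.exp (-(c k : ℂ) ^ 2 / 2) := by
    intro k
    rw [charFun_map_mul_comp (ha k).aemeasurable, (ha k).map_eq, charFun_gaussianReal]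
    congr 1
    simp
    ring
  simp_rw [h2, ← Complex.exp_sum, Complex.ofReal_exp]
  congr 1
  push_cast
  rw [← Finset.sum_div, Finset.sum_neg_distrib]

theorem hasSum_sq_sum_mul_pow {ι : Type} [Fintype ι] {u : ι → ℝ} (ξ : ι → ℝ)
    (hu : ∀ k, u k ∈ Set.Ioo (-1 : ℝ) 1) :
    HasSum (fun m : ℕ => (∑ k, ξ k * u k ^ m) ^ 2)
      (∑ k, ∑ l, ξ k * ξ l * sigma (u k) (u l)) := by
  have h1 : ∀ m : ℕ, (∑ k, ξ k * u k ^ m) ^ 2 =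
      ∑ k, ∑ l, ξ k * ξ l * (u k * u l) ^ m := by
    intro m
    rw [pow_two, Finset.sum_mul_sum]
    exact Finset.sum_congr rfl fun k _ => Finset.sum_congr rfl fun l _ => by ring
  simp_rw [h1]
  refine hasSum_sum fun k _ => hasSum_sum fun l _ => HasSum.mul_left _ ?_
  rw [sigma, one_div]
  refine hasSum_geometric_of_abs_lt_one ?_
  rw [abs_mul]
  exact mul_lt_one_of_nonneg_of_lt_one_left (abs_nonneg _) (abs_lt.2 (hu k)) (abs_lt.2 (hu l)).le

/-- The characteristic functions of the partial sums are explicit by independence. They converge by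
dominated convergence, and the sum of squared coefficients tends to the quadratic form of `σ` by the
geometric series. -/
theorem isSzegoProcess_f [IsProbabilityMeasure P]
    (ha : ∀ k, HasLaw (a k) (gaussianReal 0 1) P) (hindep : iIndepFun a P) :
    IsSzegoProcess (f a) P where
  aemeasurable _ ht := aemeasurable_f ha ht
  integral_cexp {ι} _ u ξ hu := by
    set c : ℕ → ℝ := fun m => ∑ k, ξ k * u k ^ m with hc
    have hR : Filter.Tendsto
        (fun m => ((Real.exp (-(∑ k ∈ Finset.range m, c k ^ 2) / 2) : ℝ) : ℂ)) Filter.atTop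
        (nhds ((Real.exp (-(∑ k, ∑ l, ξ k * ξ l * sigma (u k) (u l)) / 2) : ℝ) : ℂ)) := by
      have h1 := (hasSum_sq_sum_mul_pow ξ hu).tendsto_sum_nat
      exact (Complex.continuous_ofReal.tendsto _).comp
        ((Real.continuous_exp.tendsto _).comp (h1.neg.div_const 2))
    simp_rw [← integral_cexp_sum ha hindep c] at hR
    refine tendsto_nhds_unique (tendsto_integral_of_dominated_convergence (fun _ => 1) ?_
      (integrable_const _) ?_ ?_) hR
    · intro m
      exact AEMeasurable.aestronglyMeasurable (Complex.measurable_exp.comp_aemeasurable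
        ((Complex.measurable_ofReal.comp_aemeasurable (Finset.aemeasurable_fun_sum _ fun k _ =>
          (ha k).aemeasurable.const_mul _)).mul_const _))
    · intro m
      exact Filter.Eventually.of_forall fun ω => (Complex.norm_exp_ofReal_mul_I _).le
    · filter_upwards [ae_all_iff.2 fun i => ae_summable_mul_pow ha (hu i)] with ω hω
      have h1 : HasSum (fun m => c m * a m ω) (∑ i, ξ i * f a (u i) ω) := by
        have h2 := hasSum_sum fun i (_ : i ∈ Finset.univ) => (hω i).hasSum.mul_left (ξ i)
        refine h2.congr_fun fun m => ?_
        rw [hc, Finset.sum_mul]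
        exact Finset.sum_congr rfl fun i _ => by ring
      exact (Complex.continuous_exp.tendsto _).comp
        (((Complex.continuous_ofReal.tendsto _).comp h1.tendsto_sum_nat).mul_const _)

end PowerSeries

end GaussianPowerSeries

theorem theorem2 {Ω : Type*} [MeasurableSpace Ω] (P : Measure Ω) [IsProbabilityMeasure P]
    (a : ℕ → Ω → ℝ) (ha_law : ∀ k, HasLaw (a k) (gaussianReal 0 1) P) (ha_indep : iIndepFun a P)
    (n : ℕ) (t : Fin n → ℝ) (ht : ∀ i, t i ∈ Set.Ioo (-1 : ℝ) 1) (ht_inj : Function.Injective t) :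
    (∀ᵐ ω ∂P, ∀ i, Summable fun k : ℕ => a k ω * t i ^ k) ∧
    (∀ i j, cov[GaussianPowerSeries.f a (t i), GaussianPowerSeries.f a (t j); P] =
      GaussianPowerSeries.Sigma t i j) ∧
    Integrable (fun ω => |∏ i, GaussianPowerSeries.f a (t i) ω|) P ∧
    ∫ ω, |∏ i, GaussianPowerSeries.f a (t i) ω| ∂P =
      (2 / Real.pi) ^ ((n : ℝ) / 2) * (GaussianPowerSeries.Sigma t).det ^ (-(1 / 2) : ℝ) *
        pfaffian (GaussianPowerSeries.blockK t) := by
  have h := GaussianPowerSeries.isSzegoProcess_f ha_law ha_indep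
  exact ⟨ae_all_iff.2 fun i => GaussianPowerSeries.ae_summable_mul_pow ha_law (ht i),
    fun i j => h.covariance_eq (ht i) (ht j), (h.integrable_prod _ ht).abs,
    h.integral_abs_prod (fun s hs => GaussianPowerSeries.ae_continuousAt ha_law hs) ht ht_inj⟩
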